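/- **Setting.** A relational schema $(R,F)$ consists of a finite set $R$ of attributes and a finite set $F$ of functional dependencies (FDs) $f$ with $\mathrm{lhs}(f)\subseteq R$ and $\mathrm{rhs}(f)\in R$. The closure $X^+$ of $X\subseteq R$ is the set of attributes derivable from $X$ by applying FDs; $X$ is a superkey if $X^+=R$, a key if it is a minimal superkey, and an attribute is *prime* if it belongs to some key. The schema is regarded as a finite structure with domain $R\cup F$ and relations $\mathit{att}$, $\mathit{fd}$, $\mathit{lh}(b,f)$ ($b\in\mathrm{lhs}(f)$) and $\mathit{rh}(b,f)$ ($b=\mathrm{rhs}(f)$). Let $\mathcal T$ be a rooted tree decomposition of this structure in which each internal node has one or two (ordered) children; the bag of a node $s$ is written as a pair $(\mathit{At}(s),\mathit{Fd}(s))$ of a set of attributes and a set of FDs. Call $\mathcal T$ *modified normalized* if (i) $f\in \mathit{Fd}(s)$ implies $\mathrm{rhs}(f)\in \mathit{At}(s)$; (ii) the bag of a node with exactly one child arises from the bag of the child by introducing or removing exactly one attribute or one FD, or else the child is a branch node (a node with two children) with the identical bag; (iii) a branch node and its two children have identical bags; (iv) each branch node has a parent, which has no other child and has the identical bag; (v)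 each attribute occurs in the bag of at least one leaf. For a node $s$ let $\bar{\mathcal T}_s$ be obtained from $\mathcal T$ by deleting the subtree rooted at $s$ except for $s$ itself, and let $\mathrm{Att}(\bar{\mathcal T}_s)$, $\mathrm{FD}(\bar{\mathcal T}_s)$ be the sets of attributes and of FDs occurring in its bags. For $Y,\Delta C\subseteq \mathit{At}(s)$, $FY,FC\subseteq \mathit{Fd}(s)$ and a linearly ordered set $C^o$ with underlying set contained in $\mathit{At}(s)$, the predicate $\mathit{solve}{\downarrow}(s,Y,FY,C^o,\Delta C,FC)$ holds iff there are extensions $\hat Y$, $\hat C^o$ (ordered) of $Y$, $C^o$ to $\mathrm{Att}(\bar{\mathcal T}_s)$ and $\widehat{FC}$ of $FC$ to $\mathrm{FD}(\bar{\mathcal T}_s)$ (i.e. their restrictions to the bag of $s$ are $Y$, $C^o$, $FC$) such that 1. $\hat Y$ and $\hat C^o$ form a partition of $\mathrm{Att}(\bar{\mathcal T}_s)$; 2. for every $f\in \mathrm{FD}(\bar{\mathcal T}_s)\setminus \mathit{Fd}(s)$ with $\mathrm{rhs}(f)\notin\hat Y$ we have $\mathrm{lhs}(f)\not\subseteq\hat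 Y$; moreover $FY=\{f\in \mathit{Fd}(s)\mid \mathrm{rhs}(f)\notin\hat Y,\ \mathrm{lhs}(f)\cap \mathrm{Att}(\bar{\mathcal T}_s)\not\subseteq\hat Y\}$; 3. for every $f\in\widehat{FC}$: $\mathrm{rhs}(f)\in\hat C^o$, and $b<\mathrm{rhs}(f)$ in $\hat C^o$ for all $b\in\mathrm{lhs}(f)\cap\hat C^o$; 4. $\Delta C\cup(\hat C^o\setminus \mathit{At}(s))=\{\mathrm{rhs}(f)\mid f\in\widehat{FC}\}$. The monadic predicate $\mathit{prime}(a)$ holds iff there are a leaf $s$ with $a\in \mathit{At}(s)$ and $Y,FY,C^o,\Delta C,FC$ such that $\mathit{solve}{\downarrow}(s,Y,FY,C^o,\Delta C,FC)$, $a\notin Y$, $FY=\{f\in \mathit{Fd}(s)\mid\mathrm{rhs}(f)\notin Y\}$ and $\Delta C=C^o\setminus\{a\}$. **Theorem.** For every schema $(R,F)$ and every modified normalized tree decomposition $\mathcal T$ of it, and for every $a\in R$: $\mathit{prime}(a)$ holds if and only if $a$ is a prime attribute of $(R,F)$. Moreover, for every fixed $w$, the predicate $\mathit{prime}$ can be computed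 in linear time for decompositions of width at most $w$: there are a random access machine program (with addition and subtraction, under the uniform cost measure) and a constant $c$ such that, given as input any encoding of length $m$ (a list, in arbitrary order, of all ground atoms over an arbitrary numbering of the attributes, FDs and tree nodes) of the structure that represents a schema together with a modified normalized tree decomposition of width at most $w$, i.e. has the relations $\mathit{att},\mathit{fd},\mathit{lh},\mathit{rh},\mathit{root},\mathit{leaf},\mathit{child}_1,\mathit{child}_2,\mathit{bag}$, the program halts after at most $c\cdot m$ steps and outputs the characteristic function of the set $\{a\in R\mid \mathit{prime}(a)\}$. -/

import Mathlib

namespace PrimeAttr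

/-! ### Relational schemas -/

/-- A relational schema with attribute set `A` and functional dependencies (FDs) indexed by `F`;
the FD `f` is `lhs f → rhs f`. -/
structure RelSchema (A F : Type*) where
  lhs : F → Finset A
  rhs : F → A

namespace RelSchema

variable {A F : Type*} (S : RelSchema A F)

/-- `S.Closure X a`: the attribute `a` belongs to the closure `X⁺`, i.e. it is obtained from `X` by
finitely many applications of FDs. -/
inductive Closure (X : Finset A) : A → Prop
  | base (a : A) : a ∈ X → Closure X a
  | step (f : F) : (∀ b ∈ S.lhs f, Closure X b) → Closure X (S.rhs f)

def IsSuperkey (X : Finset A) : Prop := ∀ a, S.Closure X a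

def IsKey (X : Finset A) : Prop := Minimal S.IsSuperkey X

def IsPrimeAttribute (a : A) : Prop := ∃ K : Finset A, S.IsKey K ∧ a ∈ K

end RelSchema

/-! ### Rooted trees and tree decompositions -/

/-- A rooted tree on the node set `T` in which every node has at most two children.
`child₁ x s`: `x` is the first or the only child of `s`; `child₂ x s`: `x` is the second child. -/
structure RootedTree (T : Type*) where
  root : T
  child₁ : T → T → Prop
  child₂ : T → T → Prop
  child₁_unique : ∀ {x y s}, child₁ x s → child₁ y s → x = y
  child₂_unique : ∀ {x y s}, child₂ x s → child₂ y s → x = y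
  first_of_second : ∀ {x s}, child₂ x s → ∃ y, child₁ y s ∧ y ≠ x
  parent_unique : ∀ {x s s'}, child₁ x s ∨ child₂ x s → child₁ x s' ∨ child₂ x s' → s = s'
  root_no_parent : ∀ s, ¬ child₁ root s ∧ ¬ child₂ root s
  reaches_root : ∀ t, Relation.ReflTransGen (fun x s => child₁ x s ∨ child₂ x s) t root

namespace RootedTree

variable {T : Type*} (B : RootedTree T)

/-- `x` is a child of `s`. -/
def IsChild (x s : T) : Prop := B.child₁ x s ∨ B.child₂ x s

def IsLeaf (s : T) : Prop := ∀ x, ¬ B.IsChild x s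

/-- `s` has two children. -/
def IsBranch (s : T) : Prop := ∃ x, B.child₂ x s

/-- The underlying undirected graph. -/
def graph : SimpleGraph T := SimpleGraph.fromRel B.IsChild

/-- The nodes of the subtree rooted at `s`. -/
def subtree (s : T) : Set T := {t | Relation.ReflTransGen B.IsChild t s}

/-- The nodes of the envelope of the subtree rooted at `s`: that subtree is removed from the
tree, except for `s` itself. -/
def envelope (s : T) : Set T := {t | t = s ∨ t ∉ B.subtree s}

end RootedTree

/-- A tree decomposition of (the relational structure with relations `fd`, `att`, `lh`, `rh` of)
a schema. The bag of the node `s` is the pair `(At s, Fd s)`. -/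
structure TreeDecomposition {A F : Type*} (S : RelSchema A F) (T : Type*)
    extends RootedTree T where
  At : T → Finset A
  Fd : T → Finset F
  att_covered : ∀ a, ∃ s, a ∈ At s
  fd_covered : ∀ f, ∃ s, f ∈ Fd s
  lh_covered : ∀ f, ∀ b ∈ S.lhs f, ∃ s, b ∈ At s ∧ f ∈ Fd s
  rh_covered : ∀ f, ∃ s, S.rhs f ∈ At s ∧ f ∈ Fd s
  att_connected : ∀ a, (toRootedTree.graph.induce {s | a ∈ At s}).Connected
  fd_connected : ∀ f, (toRootedTree.graph.induce {s | f ∈ Fd s}).Connected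

namespace TreeDecomposition

variable {A F T : Type*} [DecidableEq A] [DecidableEq F] {S : RelSchema A F}
  (D : TreeDecomposition S T)

/-- The decomposition has width at most `w`: bags have at most `w + 1` elements. -/
def WidthLE (w : ℕ) : Prop := ∀ s, (D.At s).card + (D.Fd s).card ≤ w + 1

/-! The possible relations between the bag of a node `s` with one child and that child `s₁`. -/

def AttIntro (s s₁ : T) : Prop :=
  D.Fd s = D.Fd s₁ ∧ ∃ b, b ∉ D.At s₁ ∧ D.At s = insert b (D.At s₁)

def AttRemoval (s s₁ : T) : Prop :=
  D.Fd s = D.Fd s₁ ∧ ∃ b, b ∉ D.At s ∧ D.At s₁ = insert b (D.At s)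

def FdIntro (s s₁ : T) : Prop :=
  D.At s = D.At s₁ ∧ ∃ f, f ∉ D.Fd s₁ ∧ D.Fd s = insert f (D.Fd s₁)

def FdRemoval (s s₁ : T) : Prop :=
  D.At s = D.At s₁ ∧ ∃ f, f ∉ D.Fd s ∧ D.Fd s₁ = insert f (D.Fd s)

def SameBag (s s₁ : T) : Prop := D.At s = D.At s₁ ∧ D.Fd s = D.Fd s₁

/-- The modified normal form of tree decompositions used for the enumeration of the prime
attributes. -/
structure IsModifiedNormalized : Prop where
  /-- with an FD, a bag also contains its right-hand side -/
  rhs_mem : ∀ s, ∀ f ∈ D.Fd s, S.rhs f ∈ D.At s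
  /-- a node with one child introduces or removes a single element, unless it is the copy that
  has been inserted above a branch node -/
  one_child : ∀ s s₁, D.child₁ s₁ s → ¬ D.IsBranch s →
    D.AttIntro s s₁ ∨ D.AttRemoval s s₁ ∨ D.FdIntro s s₁ ∨ D.FdRemoval s s₁ ∨
      (D.IsBranch s₁ ∧ D.SameBag s s₁)
  /-- a branch node has the same bag as its two children -/
  two_children : ∀ s s₁, D.IsBranch s → D.IsChild s₁ s → D.SameBag s s₁
  /-- a branch node has a parent, of which it is the only child, with the same bag -/
  branch_parent : ∀ s, D.IsBranch s → ∃ u, D.child₁ s u ∧ ¬ D.IsBranch u ∧ D.SameBag u s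
  /-- every attribute occurs in the bag of some leaf -/
  att_in_leaf : ∀ a, ∃ s, D.IsLeaf s ∧ a ∈ D.At s

/-! ### The predicates `solve↓` and `prime` -/

/-- The attributes occurring in the bags of a set of nodes. -/
def attOf (N : Set T) : Set A := {b | ∃ t ∈ N, b ∈ D.At t}

/-- The FDs occurring in the bags of a set of nodes. -/
def fdOf (N : Set T) : Set F := {f | ∃ t ∈ N, f ∈ D.Fd t}

/-- The condition characterizing the `solve` predicates, for the part of the decomposition that
consists of the nodes in `N`, at the node `s ∈ N`. Ordered sets of attributes are lists without
repetitions; `Y'`, `C'`, `FC'` are the extensions of `Y`, `C`, `FC` from the bag of `s` to all bags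
of nodes in `N`. -/
def SolveCondition (N : Set T) (s : T) (Y : Finset A) (FY : Finset F) (C : List A)
    (ΔC : Finset A) (FC : Finset F) : Prop :=
  ΔC ⊆ D.At s ∧
  ∃ (Y' : Finset A) (C' : List A) (FC' : Finset F),
    C'.Nodup ∧ ↑FC' ⊆ D.fdOf N ∧
    Y' ∩ D.At s = Y ∧ C'.filter (fun b => b ∈ D.At s) = C ∧ FC' ∩ D.Fd s = FC ∧
    -- `Y'` and `C'` form a partition of the attributes
    ((∀ b, b ∈ D.attOf N ↔ b ∈ Y' ∨ b ∈ C') ∧ ∀ b ∈ Y', b ∉ C') ∧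
    -- FDs occurring outside of the bag of `s` do not violate the closedness of `Y'`, and
    -- `FY` consists of the FDs in the bag of `s` with right-hand side outside of `Y'` for which
    -- this is already verified
    ((∀ f ∈ D.fdOf N, f ∉ D.Fd s → S.rhs f ∉ Y' → ¬ S.lhs f ⊆ Y') ∧
      ∀ f, f ∈ FY ↔ f ∈ D.Fd s ∧ S.rhs f ∉ Y' ∧ ¬ ((S.lhs f : Set A) ∩ D.attOf N ⊆ ↑Y')) ∧
    -- the FDs in `FC'` are consistent with the order on `C'`
    (∀ f ∈ FC', S.rhs f ∈ C' ∧
      ∀ b ∈ S.lhs f, b ∈ C' → C'.idxOf b < C'.idxOf (S.rhs f)) ∧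
    -- `ΔC ∪ (C' \ At s)` is the set of right-hand sides of the FDs in `FC'`
    (∀ b, (b ∈ ΔC ∨ (b ∈ C' ∧ b ∉ D.At s)) ↔ ∃ f ∈ FC', S.rhs f = b)

/-- The predicate `solve↓`. -/
def SolveDown (s : T) (Y : Finset A) (FY : Finset F) (C : List A)
    (ΔC : Finset A) (FC : Finset F) : Prop :=
  D.SolveCondition (D.envelope s) s Y FY C ΔC FC

/-- The monadic predicate `prime`. -/
def PrimePred (a : A) : Prop :=
  ∃ (s : T) (Y : Finset A) (FY : Finset F) (C : List A) (ΔC : Finset A) (FC : Finset F),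
    D.IsLeaf s ∧ a ∈ D.At s ∧ D.SolveDown s Y FY C ΔC FC ∧ a ∉ Y ∧
    FY = (D.Fd s).filter (fun f => S.rhs f ∉ Y) ∧
    ΔC = C.toFinset \ {a}

end TreeDecomposition

/-! ### The input structure and its encoding -/

/-- The ground atoms describing a schema together with a tree decomposition. -/
inductive Atom (A F T : Type*)
  | att (a : A)
  | fd (f : F)
  | lh (b : A) (f : F)
  | rh (b : A) (f : F)
  | root (s : T)
  | leaf (s : T)
  | child₁ (x s : T)
  | child₂ (x s : T)
  | bag (s : T) (At : Finset A) (Fd : Finset F)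

namespace TreeDecomposition

variable {A F T : Type*} {S : RelSchema A F} (D : TreeDecomposition S T)

/-- The atoms that hold in the structure representing the schema and the decomposition. -/
def Holds : Atom A F T → Prop
  | .att _ => True
  | .fd _ => True
  | .lh b f => b ∈ S.lhs f
  | .rh b f => b = S.rhs f
  | .root s => s = D.root
  | .leaf s => D.IsLeaf s
  | .child₁ x s => D.child₁ x s
  | .child₂ x s => D.child₂ x s
  | .bag s At Fd => At = D.At s ∧ Fd = D.Fd s

end TreeDecomposition

/-- `x.Written num u`: the list `u` of numbers is a way to write down the atom `x`, where the domain
elements (attributes, FDs and tree nodes) are numbered by `num`. An atom is written as the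
number of its predicate followed by the arguments; the two sets in a `bag` atom are written by
listing their elements in some order, preceded by their cardinalities. -/
def Atom.Written {A F T : Type*} [DecidableEq A] [DecidableEq F]
    (num : A ⊕ F ⊕ T → ℕ) : Atom A F T → List ℕ → Prop
  | .att a, u => u = [0, num (.inl a)]
  | .fd f, u => u = [1, num (.inr (.inl f))]
  | .lh b f, u => u = [2, num (.inl b), num (.inr (.inl f))]
  | .rh b f, u => u = [3, num (.inl b), num (.inr (.inl f))]
  | .root s, u => u = [4, num (.inr (.inr s))]
  | .leaf s, u => u = [5, num (.inr (.inr s))]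
  | .child₁ x s, u => u = [6, num (.inr (.inr x)), num (.inr (.inr s))]
  | .child₂ x s, u => u = [7, num (.inr (.inr x)), num (.inr (.inr s))]
  | .bag s At Fd, u => ∃ (as : List A) (fs : List F),
      as.Nodup ∧ as.toFinset = At ∧ fs.Nodup ∧ fs.toFinset = Fd ∧
      u = [8, num (.inr (.inr s)), as.length, fs.length] ++
        as.map (fun a => num (.inl a)) ++ fs.map (fun f => num (.inr (.inl f)))

/-- The list `u` encodes the structure representing the schema and the decomposition `D`: it
lists, in some order and each of them once, all atoms that hold. -/
def TreeDecomposition.EncodedBy {A F T : Type*} [DecidableEq A] [DecidableEq F]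
    {S : RelSchema A F} (D : TreeDecomposition S T) (num : A ⊕ F ⊕ T → ℕ) (u : List ℕ) : Prop :=
  ∃ (atoms : List (Atom A F T)) (parts : List (List ℕ)),
    atoms.Nodup ∧ (∀ x, x ∈ atoms ↔ D.Holds x) ∧
    List.Forall₂ (fun x v => x.Written num v) atoms parts ∧ u = parts.flatten

/-! ### Random access machines

Random access machines with addition and subtraction and the uniform cost measure. The memory
consists of registers and of arrays; a program is a fixed finite object, so only finitely many
registers and arrays occur in it. Array indices may be computed (indirect addressing), register
and array names may not. -/

namespace RAM

/-- Contents of the memory. -/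
structure State where
  reg : ℕ → ℕ
  arr : ℕ → ℕ → ℕ

inductive Expr
  | lit (n : ℕ)
  | reg (r : ℕ)
  | get (k : ℕ) (i : Expr)
  | add (x y : Expr)
  | sub (x y : Expr)

/-- The value of an expression (subtraction is truncated). -/
def Expr.eval (σ : State) : Expr → ℕ
  | .lit n => n
  | .reg r => σ.reg r
  | .get k i => σ.arr k (i.eval σ)
  | .add x y => x.eval σ + y.eval σ
  | .sub x y => x.eval σ - y.eval σ

/-- The cost of evaluating an expression: one step for each operation. -/
def Expr.cost : Expr → ℕ
  | .lit _ => 1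
  | .reg _ => 1
  | .get _ i => i.cost + 1
  | .add x y => x.cost + y.cost + 1
  | .sub x y => x.cost + y.cost + 1

inductive Program
  | skip
  /-- write the value of `x` into the register `r` -/
  | set (r : ℕ) (x : Expr)
  /-- write the value of `x` into the cell with index `i` of the array `k` -/
  | put (k : ℕ) (i x : Expr)
  | seq (p q : Program)
  /-- execute `p` if the value of `x` is not zero, and `q` otherwise -/
  | ite (x : Expr) (p q : Program)
  /-- execute `p` as long as the value of `x` is not zero -/
  | loop (x : Expr) (p : Program)

def State.setReg (σ : State) (r v : ℕ) : State :=
  { σ with reg := Function.update σ.reg r v }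

def State.putArr (σ : State) (k i v : ℕ) : State :=
  { σ with arr := Function.update σ.arr k (Function.update (σ.arr k) i v) }

/-- `Exec p σ τ t`: started with memory `σ`, the program `p` halts after `t` steps with memory `τ`. -/
inductive Exec : Program → State → State → ℕ → Prop
  | skip (σ) : Exec .skip σ σ 1
  | set (σ r x) : Exec (.set r x) σ (σ.setReg r (x.eval σ)) (x.cost + 1)
  | put (σ k i x) : Exec (.put k i x) σ (σ.putArr k (i.eval σ) (x.eval σ)) (i.cost + x.cost + 1)
  | seq {p q σ ρ τ t₁ t₂} : Exec p σ ρ t₁ → Exec q ρ τ t₂ → Exec (.seq p q) σ τ (t₁ + t₂)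
  | ite_true {x p q σ τ t} : x.eval σ ≠ 0 → Exec p σ τ t →
      Exec (.ite x p q) σ τ (x.cost + 1 + t)
  | ite_false {x p q σ τ t} : x.eval σ = 0 → Exec q σ τ t →
      Exec (.ite x p q) σ τ (x.cost + 1 + t)
  | loop_done {x p σ} : x.eval σ = 0 → Exec (.loop x p) σ σ (x.cost + 1)
  | loop_step {x p σ ρ τ t₁ t₂} : x.eval σ ≠ 0 → Exec p σ ρ t₁ → Exec (.loop x p) ρ τ t₂ →
      Exec (.loop x p) σ τ (x.cost + 1 + t₁ + t₂)

/-- The initial memory: the input is stored in array `0` and its length in register `0`; all other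
cells are zero. -/
def init (u : List ℕ) : State where
  reg := fun r => if r = 0 then u.length else 0
  arr := fun k i => if k = 0 then u.getD i 0 else 0

end RAM

end PrimeAttr

/-! An attribute `a` is prime iff some closed set `Y` avoids `a` while `insert a Y` is a superkey
(`IsPrimeAttribute.iff_closed`). The superkey condition can be witnessed by a linear order of the
complement of `Y` in which every attribute except `a` is the right-hand side of an FD whose
left-hand side lies in `Y` or earlier in the order. The envelope of a leaf is the whole tree, so
`SolveDown` at a leaf, with the values prescribed in `PrimePred`, asserts the existence of exactly
such a `Y` and such an order; this gives `primePred_iff`.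

For the running time, primality is recast as a constraint problem on the tree with finitely many
values per node. A certificate gives each bag a view: the trace of `Y` and of the set of FDs used, a
strict partial order, and pointers. A pointer makes an existential condition ("some FD derives `b`",
"some attribute of `lhs f` is outside `Y`") local: it leads from any occurrence of an element to a
node whose bag contains the witness. One further direction per node guarantees that at most one
attribute, the candidate `a`, is exempt from having a derivation. The orders of the bags need not be
total; they glue to a single ranking in ℚ, because ℚ is dense and occurrences of an attribute are
connected (`exists_rank`). Hence `a` is prime iff some certificate marks it
(`isPrimeAttribute_iff_exists_isCertificate`).

A constraint problem on a tree is solved by arc consistency: a bottom-up and a top-down pass leave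
at each node precisely the values that occur in global solutions (`DownInv.mem_iff`). When the width
is fixed, there are finitely many views, so a revision of one edge is a finite case distinction that
can be written into the program (`ConstTime.switch`). What remains is to bring the input into random
access form. Pairs are addressed as `a * n + b` through a table of multiples, since multiplication
is not available, and breadth-first search lists parents before children. The cells of the quadratic
matrices need no initialization because fresh memory is zero. Every loop has a body of constant time
and at most as many iterations as the input has entries. -/

namespace PrimeAttr.RAM

/-! ### Constant time operations on the memory -/

/-- `e` is the value of an expression. -/
def IsExpr (e : State → ℕ) : Prop := ∃ x : Expr, ∀ σ, x.eval σ = e σ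

/-- `P` is decided by an expression. -/
def IsTest (P : State → Prop) : Prop := ∃ x : Expr, ∀ σ, x.eval σ ≠ 0 ↔ P σ

/-- The value of `v` can be tested for equality with each constant. -/
def FinTest {V : Type*} (v : State → V) : Prop := ∀ v₀, IsTest (fun σ => v σ = v₀)

/-- `f` is computed by a program in a bounded number of steps. -/
def ConstTime (f : State → State) : Prop :=
  ∃ (p : Program) (c : ℕ), ∀ σ, ∃ t ≤ c, Exec p σ (f σ) t

theorem IsExpr.lit (n : ℕ) : IsExpr (fun _ => n) := ⟨.lit n, fun _ => rfl⟩

theorem IsExpr.reg (r : ℕ) : IsExpr (fun σ => σ.reg r) := ⟨.reg r, fun _ => rfl⟩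

theorem IsExpr.arr (k : ℕ) {i : State → ℕ} (hi : IsExpr i) : IsExpr (fun σ => σ.arr k (i σ)) := by
  obtain ⟨x, hx⟩ := hi
  exact ⟨.get k x, fun σ => by simp [Expr.eval, hx]⟩

theorem IsExpr.add {e e' : State → ℕ} (h : IsExpr e) (h' : IsExpr e') :
    IsExpr (fun σ => e σ + e' σ) := by
  obtain ⟨x, hx⟩ := h
  obtain ⟨y, hy⟩ := h'
  exact ⟨.add x y, fun σ => by simp [Expr.eval, hx, hy]⟩

theorem IsExpr.sub {e e' : State → ℕ} (h : IsExpr e) (h' : IsExpr e') :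
    IsExpr (fun σ => e σ - e' σ) := by
  obtain ⟨x, hx⟩ := h
  obtain ⟨y, hy⟩ := h'
  exact ⟨.sub x y, fun σ => by simp [Expr.eval, hx, hy]⟩

theorem IsExpr.ne_zero {e : State → ℕ} (h : IsExpr e) : IsTest (fun σ => e σ ≠ 0) := by
  obtain ⟨x, hx⟩ := h
  exact ⟨x, fun σ => by rw [hx]⟩

theorem IsTest.congr {P P' : State → Prop} (h : IsTest P) (hP : ∀ σ, P σ ↔ P' σ) : IsTest P' := by
  obtain ⟨x, hx⟩ := h
  exact ⟨x, fun σ => (hx σ).trans (hP σ)⟩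

/-- Subtraction is truncated, so `e' - e` is nonzero exactly when `e < e'`. -/
theorem IsExpr.lt {e e' : State → ℕ} (h : IsExpr e) (h' : IsExpr e') :
    IsTest (fun σ => e σ < e' σ) :=
  (h'.sub h).ne_zero.congr fun σ => by omega

theorem IsExpr.eq {e e' : State → ℕ} (h : IsExpr e) (h' : IsExpr e') :
    IsTest (fun σ => e σ = e' σ) :=
  ((IsExpr.lit 1).sub ((h.sub h').add (h'.sub h))).ne_zero.congr fun σ => by omega

theorem IsTest.not {P : State → Prop} (h : IsTest P) : IsTest (fun σ => ¬ P σ) := by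
  obtain ⟨x, hx⟩ := h
  refine ⟨.sub (.lit 1) x, fun σ => ?_⟩
  beta_reduce
  rw [← hx]
  simp only [Expr.eval]
  omega

theorem IsTest.or {P P' : State → Prop} (h : IsTest P) (h' : IsTest P') :
    IsTest (fun σ => P σ ∨ P' σ) := by
  obtain ⟨x, hx⟩ := h
  obtain ⟨y, hy⟩ := h'
  refine ⟨.add x y, fun σ => ?_⟩
  beta_reduce
  rw [← hx, ← hy]
  simp only [Expr.eval]
  omega

theorem IsTest.and {P P' : State → Prop} (h : IsTest P) (h' : IsTest P') :
    IsTest (fun σ => P σ ∧ P' σ) :=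
  (h.not.or h'.not).not.congr fun σ => by tauto

theorem IsTest.const (P : Prop) : IsTest (fun _ => P) := by
  by_cases h : P
  · exact (IsExpr.lit 1).ne_zero.congr fun _ => by simp [h]
  · exact (IsExpr.lit 0).ne_zero.congr fun _ => by simp [h]

theorem IsTest.exists {ι : Type*} [Finite ι] {P : ι → State → Prop} (h : ∀ i, IsTest (P i)) :
    IsTest (fun σ => ∃ i, P i σ) := by
  have key : ∀ s : Set ι, s.Finite → IsTest (fun σ => ∃ i ∈ s, P i σ) := by
    intro s hs
    induction s, hs using Set.Finite.induction_on with
    | empty => exact (IsTest.const False).congr (by simp)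
    | @insert a _ _ _ ih => exact ((h a).or ih).congr (by simp)
  exact (key Set.univ Set.finite_univ).congr (by simp)

theorem IsTest.forall {ι : Type*} [Finite ι] {P : ι → State → Prop} (h : ∀ i, IsTest (P i)) :
    IsTest (fun σ => ∀ i, P i σ) :=
  (IsTest.exists fun i => (h i).not).not.congr fun σ => by simp

theorem IsTest.finTest {P : State → Prop} (h : IsTest P) : FinTest P := by
  intro v
  by_cases hv : v
  · exact h.congr fun σ => by simp [hv]
  · exact h.not.congr fun σ => by simp [hv]

theorem FinTest.comp {V W : Type*} [Finite V] {v : State → V} (h : FinTest v) (g : V → W) :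
    FinTest (fun σ => g (v σ)) := fun w =>
  (IsTest.exists fun x => (h x).and (IsTest.const (g x = w))).congr fun σ => by simp

theorem FinTest.prod {V W : Type*} {v : State → V} {w : State → W} (hv : FinTest v)
    (hw : FinTest w) : FinTest (fun σ => (v σ, w σ)) := fun x =>
  ((hv x.1).and (hw x.2)).congr fun σ => by simp [Prod.ext_iff]

theorem FinTest.pi {ι V : Type*} [Finite ι] {v : State → ι → V}
    (h : ∀ i, FinTest (fun σ => v σ i)) : FinTest v := fun x =>
  (IsTest.forall fun i => h i (x i)).congr fun σ => by simp [funext_iff]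

theorem ConstTime.id : ConstTime _root_.id := ⟨.skip, 1, fun σ => ⟨1, le_rfl, .skip σ⟩⟩

/-- The assignment of the value of `e` to the register `r`. -/
def setR (r : ℕ) (e : State → ℕ) (σ : State) : State := σ.setReg r (e σ)

/-- The assignment of the value of `e` to the cell with index `i` of the array `k`. -/
def putA (k : ℕ) (i e : State → ℕ) (σ : State) : State := σ.putArr k (i σ) (e σ)

theorem ConstTime.setR (r : ℕ) {e : State → ℕ} (h : IsExpr e) : ConstTime (setR r e) := by
  obtain ⟨x, hx⟩ := h
  refine ⟨.set r x, x.cost + 1, fun σ => ⟨_, le_rfl, ?_⟩⟩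
  have := Exec.set σ r x
  rwa [hx] at this

theorem ConstTime.putA (k : ℕ) {i e : State → ℕ} (hi : IsExpr i) (h : IsExpr e) :
    ConstTime (putA k i e) := by
  obtain ⟨x, hx⟩ := h
  obtain ⟨y, hy⟩ := hi
  refine ⟨.put k y x, y.cost + x.cost + 1, fun σ => ⟨_, le_rfl, ?_⟩⟩
  have := Exec.put σ k y x
  rwa [hx, hy] at this

theorem ConstTime.comp {f g : State → State} (hg : ConstTime g) (hf : ConstTime f) :
    ConstTime (g ∘ f) := by
  obtain ⟨p, c, hp⟩ := hf
  obtain ⟨q, d, hq⟩ := hg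
  refine ⟨.seq p q, c + d, fun σ => ?_⟩
  obtain ⟨t, ht, h⟩ := hp σ
  obtain ⟨t', ht', h'⟩ := hq (f σ)
  exact ⟨t + t', by omega, h.seq h'⟩

open Classical in
/-- Execute `f` if `P` holds, and `g` otherwise. -/
noncomputable def branch (P : State → Prop) (f g : State → State) (σ : State) : State :=
  if P σ then f σ else g σ

theorem branch_pos {P : State → Prop} {f g : State → State} {σ : State} (h : P σ) :
    branch P f g σ = f σ := if_pos h

theorem branch_neg {P : State → Prop} {f g : State → State} {σ : State} (h : ¬ P σ) :
    branch P f g σ = g σ := if_neg h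

theorem ConstTime.branch {P : State → Prop} {f g : State → State} (hP : IsTest P)
    (hf : ConstTime f) (hg : ConstTime g) : ConstTime (branch P f g) := by
  obtain ⟨x, hx⟩ := hP
  obtain ⟨p, c, hp⟩ := hf
  obtain ⟨q, d, hq⟩ := hg
  refine ⟨.ite x p q, x.cost + 1 + (c + d), fun σ => ?_⟩
  by_cases h : P σ
  · obtain ⟨t, ht, h'⟩ := hp σ
    refine ⟨x.cost + 1 + t, by omega, ?_⟩
    rw [branch_pos h]
    exact .ite_true ((hx σ).2 h) h'
  · obtain ⟨t, ht, h'⟩ := hq σ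
    refine ⟨x.cost + 1 + t, by omega, ?_⟩
    rw [branch_neg h]
    exact .ite_false (by by_contra h0; exact h ((hx σ).1 h0)) h'

/-- The finitely many values of `v` are tried one after another in nested branches. No computability
of `g` in its first argument is needed: the result for each value is built into the program. -/
theorem ConstTime.switch {V : Type*} [Finite V] {v : State → V} (hv : FinTest v)
    {g : V → State → State} (hg : ∀ x, ConstTime (g x)) : ConstTime (fun σ => g (v σ) σ) := by
  classical
  have key : ∀ s : Set V, s.Finite →
      ∃ f, ConstTime f ∧ ∀ σ, v σ ∈ s → f σ = g (v σ) σ := by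
    intro s hs
    induction s, hs using Set.Finite.induction_on with
    | empty => exact ⟨_, ConstTime.id, by simp⟩
    | @insert a s _ _ ih =>
      obtain ⟨f, hf, hfs⟩ := ih
      refine ⟨_, ConstTime.branch (hv a) (hg a) hf, fun σ hσ => ?_⟩
      by_cases h : v σ = a
      · rw [branch_pos h, h]
      · rw [branch_neg h]
        exact hfs σ (hσ.resolve_left h)
  obtain ⟨f, hf, h⟩ := key Set.univ Set.finite_univ
  convert hf using 1
  exact funext fun σ => (h σ trivial).symm

@[simp]
theorem setReg_reg (σ : State) (r v r' : ℕ) :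
    (σ.setReg r v).reg r' = if r' = r then v else σ.reg r' := by
  simp [State.setReg, Function.update_apply]

@[simp]
theorem putArr_arr (σ : State) (k i v k' i' : ℕ) :
    (σ.putArr k i v).arr k' i' = if k' = k ∧ i' = i then v else σ.arr k' i' := by
  by_cases h : k' = k
  · subst h
    simp [State.putArr, Function.update_apply]
  · simp [State.putArr, h]

theorem ConstTime.foldl {ι : Type*} {g : ι → State → State} (hg : ∀ i, ConstTime (g i))
    (l : List ι) : ConstTime (fun σ => l.foldl (fun τ i => g i τ) σ) := by
  induction l with
  | nil => exact ConstTime.id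
  | cons a l ih => exact ih.comp (hg a)

/-- A loop with a body of constant time takes time linear in the number of iterations. -/
theorem ConstTime.loop {P : State → Prop} {f : State → State} (hP : IsTest P) (hf : ConstTime f) :
    ∃ (p : Program) (c : ℕ), ∀ (n : ℕ) (σ : State), (∀ i < n, P (f^[i] σ)) → ¬ P (f^[n] σ) →
      ∃ t ≤ c * (n + 1), Exec p σ (f^[n] σ) t := by
  obtain ⟨x, hx⟩ := hP
  obtain ⟨p, c, hp⟩ := hf
  refine ⟨.loop x p, x.cost + 1 + c, fun n => ?_⟩
  induction n with
  | zero =>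
    intro σ _ h
    refine ⟨x.cost + 1, by simp, .loop_done ?_⟩
    by_contra h0
    exact h ((hx σ).1 h0)
  | succ n ih =>
    intro σ h h'
    obtain ⟨t, ht, e⟩ := hp σ
    obtain ⟨t', ht', e'⟩ := ih (f σ) (fun i hi => h (i + 1) (by omega)) h'
    refine ⟨_, ?_, .loop_step ((hx σ).2 (h 0 (by omega))) e e'⟩
    rw [Nat.mul_succ]
    omega

/-- Some program transforms `σ` into `τ` in time linear in `n` whenever `R n σ τ`. -/
def Linear (R : ℕ → State → State → Prop) : Prop :=
  ∃ (p : Program) (c : ℕ), ∀ n σ τ, R n σ τ → ∃ t ≤ c * (n + 1), Exec p σ τ t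

theorem Linear.comp {R R' : ℕ → State → State → Prop} (h : Linear R) (h' : Linear R') :
    Linear (fun n σ τ => ∃ ρ, R n σ ρ ∧ R' n ρ τ) := by
  obtain ⟨p, c, hp⟩ := h
  obtain ⟨q, d, hq⟩ := h'
  refine ⟨.seq p q, c + d, ?_⟩
  rintro n σ τ ⟨ρ, h₁, h₂⟩
  obtain ⟨t, ht, e⟩ := hp _ _ _ h₁
  obtain ⟨t', ht', e'⟩ := hq _ _ _ h₂
  exact ⟨t + t', by rw [add_mul]; omega, e.seq e'⟩

theorem ConstTime.linear {f : State → State} (hf : ConstTime f) :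
    Linear (fun _ σ τ => τ = f σ) := by
  obtain ⟨p, c, hp⟩ := hf
  refine ⟨p, c, ?_⟩
  rintro n σ _ rfl
  obtain ⟨t, ht, e⟩ := hp σ
  exact ⟨t, ht.trans (Nat.le_mul_of_pos_right c n.succ_pos), e⟩

theorem Linear.loop {P : State → Prop} {f : State → State} (hP : IsTest P) (hf : ConstTime f) :
    Linear (fun n σ τ => ∃ k ≤ n, (∀ i < k, P (f^[i] σ)) ∧ ¬ P (f^[k] σ) ∧ τ = f^[k] σ) := by
  obtain ⟨p, c, hp⟩ := ConstTime.loop hP hf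
  refine ⟨p, c, ?_⟩
  rintro n σ _ ⟨k, hk, h, h', rfl⟩
  obtain ⟨t, ht, e⟩ := hp k σ h h'
  exact ⟨t, ht.trans (Nat.mul_le_mul_left _ (by omega)), e⟩

end PrimeAttr.RAM

namespace PrimeAttr

/-! ### Prime attributes -/

namespace RelSchema

variable {A F : Type*} {S : RelSchema A F}

theorem Closure.mem_of_closed {X : Finset A} {Z : Set A} (hX : ∀ b ∈ X, b ∈ Z)
    (hZ : ∀ f, (∀ b ∈ S.lhs f, b ∈ Z) → S.rhs f ∈ Z) {a : A} (h : S.Closure X a) : a ∈ Z := by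
  induction h with
  | base a ha => exact hX a ha
  | step f _ ih => exact hZ f ih

theorem Closure.mono {X X' : Finset A} (hX : X ⊆ X') {a : A} (h : S.Closure X a) :
    S.Closure X' a :=
  h.mem_of_closed (Z := {a | S.Closure X' a}) (fun b hb => .base b (hX hb)) fun f => Closure.step f

theorem Closure.trans {X X' : Finset A} (hX : ∀ b ∈ X, S.Closure X' b) {a : A}
    (h : S.Closure X a) : S.Closure X' a :=
  h.mem_of_closed (Z := {a | S.Closure X' a}) hX fun f => Closure.step f

/-- `Y` is closed under the application of FDs. -/
def IsClosed (S : RelSchema A F) (Y : Finset A) : Prop := ∀ f, S.lhs f ⊆ Y → S.rhs f ∈ Y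

/-- For a key `K` containing `a`, the closure of `K.erase a` serves as `Y`; it misses `a` because
`K` is minimal. Conversely, a key contained in `insert a Y` must contain `a`, since otherwise its
closure would stay inside the closed set `Y`. -/
theorem IsPrimeAttribute.iff_closed [Finite A] [DecidableEq A] {a : A} :
    S.IsPrimeAttribute a ↔ ∃ Y, S.IsClosed Y ∧ a ∉ Y ∧ S.IsSuperkey (insert a Y) := by
  classical
  have := Fintype.ofFinite A
  constructor
  · rintro ⟨K, hK, ha⟩
    refine ⟨Finset.univ.filter fun b => S.Closure (K.erase a) b, fun f hf => ?_, fun h => ?_,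
      fun b => (hK.1 b).mono fun c hc => ?_⟩
    · simp only [Finset.mem_filter, Finset.mem_univ, true_and]
      exact .step f fun b hb => by simpa using hf hb
    · have h : S.Closure (K.erase a) a := by simpa using h
      refine Finset.notMem_erase a K (hK.2 (y := K.erase a) (fun b => ?_) (K.erase_subset a) ha)
      refine (hK.1 b).trans fun c hc => ?_
      by_cases hca : c = a
      · rwa [hca]
      · exact .base c (Finset.mem_erase.2 ⟨hca, hc⟩)
    · by_cases hca : c = a
      · exact Finset.mem_insert.2 (.inl hca)
      · exact Finset.mem_insert_of_mem
          (by simpa using Closure.base (S := S) c (Finset.mem_erase.2 ⟨hca, hc⟩))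
  · rintro ⟨Y, hY, ha, hs⟩
    obtain ⟨K, hK, hm⟩ := exists_minimal_le_of_wellFoundedLT S.IsSuperkey _ hs
    refine ⟨K, hm, ?_⟩
    by_contra haK
    refine ha ((hm.1 a).mem_of_closed (Z := {b | b ∈ Y}) (fun b hb => ?_) hY)
    refine (Finset.mem_insert.1 (hK hb)).resolve_left ?_
    rintro rfl
    exact haK hb

/-- Otherwise, take an attribute of least rank outside the closure: the FD given for it has its
whole left-hand side in the closure. The order is left general because both list positions and
rational ranks are used. -/
theorem isSuperkey_of_rank [Finite A] {α : Type*} [LinearOrder α] {X : Finset A} (ρ : A → α)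
    (h : ∀ b, b ∉ X → ∃ f, S.rhs f = b ∧ ∀ c ∈ S.lhs f, c ∈ X ∨ ρ c < ρ b) : S.IsSuperkey X := by
  by_contra hX
  simp only [IsSuperkey, not_forall] at hX
  obtain ⟨b, hb, hmin⟩ := Set.exists_min_image {b | ¬ S.Closure X b} ρ (Set.toFinite _) hX
  obtain ⟨f, rfl, hf⟩ := h b fun hbX => hb (.base b hbX)
  refine hb (.step f fun c hc => ?_)
  rcases hf c hc with h | h
  · exact .base c h
  · by_contra hc'
    exact (hmin c hc').not_gt h

/-- `f` derives its right-hand side from `Y`, `a`, and attributes preceding it in `C`. -/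
def Derives [DecidableEq A] (S : RelSchema A F) (C : List A) (a : A) (f : F) : Prop :=
  S.rhs f ∈ C ∧ S.rhs f ≠ a ∧ ∀ b ∈ S.lhs f, b ∈ C → C.idxOf b < C.idxOf (S.rhs f)

/-- A longest list of attributes outside `Y` that contains `a` and derives its other members in
order is exhaustive. If an attribute were missing, the set of members of `Y` and of the list could
not be closed, as it contains the superkey `insert a Y`; an FD leading out of it would lengthen the
list. -/
theorem exists_derivation_order [Finite A] [DecidableEq A] {Y : Finset A} {a : A}
    (ha : a ∉ Y) (hs : S.IsSuperkey (insert a Y)) :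
    ∃ C : List A, C.Nodup ∧ (∀ b, b ∈ C ↔ b ∉ Y) ∧
      ∀ b ∈ C, b ≠ a → ∃ f, S.Derives C a f ∧ S.rhs f = b := by
  have := Fintype.ofFinite A
  let P : List A → Prop := fun C => C.Nodup ∧ a ∈ C ∧ (∀ b ∈ C, b ∉ Y) ∧
    ∀ b ∈ C, b ≠ a → ∃ f, S.rhs f = b ∧ ∀ c ∈ S.lhs f, c ∈ Y ∨ c ∈ C ∧ C.idxOf c < C.idxOf b
  have grow : ∀ C, P C → (∃ b, b ∉ C ∧ b ∉ Y) → ∃ C', P C' ∧ C'.length = C.length + 1 := by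
    rintro C ⟨hn, haC, hCY, hC⟩ ⟨b, hbC, hbY⟩
    have : ∃ f, (∀ c ∈ S.lhs f, c ∈ Y ∨ c ∈ C) ∧ ¬ (S.rhs f ∈ Y ∨ S.rhs f ∈ C) := by
      by_contra! hf
      have := (hs b).mem_of_closed (Z := {c | c ∈ Y ∨ c ∈ C}) ?_ ?_
      · exact this.elim hbY hbC
      · intro c hc
        rcases Finset.mem_insert.1 hc with rfl | hc
        · exact .inr haC
        · exact .inl hc
      · intro f h
        have := hf f h
        simp only [Set.mem_ofPred_eq]
        tauto
    obtain ⟨f, hf, hr⟩ := this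
    rw [not_or] at hr
    refine ⟨C ++ [S.rhs f], ⟨?_, by simp [haC], ?_, ?_⟩, by simp⟩
    · rw [List.nodup_append]
      refine ⟨hn, by simp, ?_⟩
      rintro c hc d hd rfl
      simp only [List.mem_singleton] at hd
      exact hr.2 (hd ▸ hc)
    · intro c hc
      rcases List.mem_append.1 hc with hc | hc
      · exact hCY c hc
      · rw [List.mem_singleton.1 hc]
        exact hr.1
    · intro c hc hca
      rcases List.mem_append.1 hc with hc | hc
      · obtain ⟨g, hg, h⟩ := hC c hc hca
        refine ⟨g, hg, fun d hd => (h d hd).imp_right fun h => ⟨by simp [h.1], ?_⟩⟩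
        rw [List.idxOf_append_of_mem h.1, List.idxOf_append_of_mem hc]
        exact h.2
      · rw [List.mem_singleton.1 hc]
        refine ⟨f, rfl, fun d hd => (hf d hd).imp_right fun h => ⟨by simp [h], ?_⟩⟩
        rw [List.idxOf_append_of_mem h, List.idxOf_append_of_notMem hr.2]
        exact (List.idxOf_lt_length_of_mem h).trans_le (by omega)
  have h₁ : P [a] := ⟨by simp, by simp, by simpa using ha, by simp⟩
  have hb : ∀ C, P C → C.length ≤ Fintype.card A := fun C h => h.1.length_le_card
  -- Lists without repetitions have length at most the number of attributes, so a longest one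
  -- exists.
  obtain ⟨C, hC, hmax⟩ : ∃ C, P C ∧ ∀ C', P C' → C'.length ≤ C.length := by
    have hbdd : BddAbove (List.length '' {C | P C}) :=
      ⟨Fintype.card A, by rintro _ ⟨C, h, rfl⟩; exact hb C h⟩
    obtain ⟨C, hC, h⟩ := Nat.sSup_mem (Set.Nonempty.image _ (s := {C | P C}) ⟨[a], h₁⟩) hbdd
    exact ⟨C, hC, fun C' h' => h ▸ le_csSup hbdd ⟨C', h', rfl⟩⟩
  have hall : ∀ b, b ∈ C ↔ b ∉ Y := by
    refine fun b => ⟨hC.2.2.1 b, fun hbY => ?_⟩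
    by_contra hbC
    obtain ⟨C', h', hl⟩ := grow C hC ⟨b, hbC, hbY⟩
    have := hmax C' h'
    omega
  refine ⟨C, hC.1, hall, fun b hb hba => ?_⟩
  obtain ⟨f, rfl, hf⟩ := hC.2.2.2 b hb hba
  exact ⟨f, ⟨hb, hba, fun c hc hcC => ((hf c hc).resolve_left ((hall c).1 hcC)).2⟩, rfl⟩

theorem isSuperkey_of_derivation_order [Finite A] [DecidableEq A] {Y : Finset A} {a : A}
    {C : List A} (hC : ∀ b, b ∈ C ↔ b ∉ Y)
    (h : ∀ b ∈ C, b ≠ a → ∃ f, S.rhs f = b ∧ ∀ c ∈ S.lhs f, c ∈ C → C.idxOf c < C.idxOf b) :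
    S.IsSuperkey (insert a Y) := by
  refine isSuperkey_of_rank C.idxOf fun b hb => ?_
  rw [Finset.mem_insert, not_or] at hb
  obtain ⟨f, hf, h'⟩ := h b ((hC b).2 hb.2) hb.1
  refine ⟨f, hf, fun c hc => ?_⟩
  by_cases hcC : c ∈ C
  · exact .inr (h' c hc hcC)
  · exact .inl (Finset.mem_insert_of_mem (by simpa [hC] using hcC))

end RelSchema

/-! ### Rooted trees -/

namespace RootedTree

variable {T : Type*} (B : RootedTree T)

/-- `B.IsChildAt c x s`: `x` is the first (`c = false`) or second (`c = true`) child of `s`. -/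
def IsChildAt (c : Bool) (x s : T) : Prop := if c then B.child₂ x s else B.child₁ x s

variable {B}

theorem isChild_iff {x s : T} : B.IsChild x s ↔ ∃ c, B.IsChildAt c x s := by
  simp [IsChild, IsChildAt]

theorem IsChildAt.isChild {c : Bool} {x s : T} (h : B.IsChildAt c x s) : B.IsChild x s :=
  isChild_iff.2 ⟨c, h⟩

theorem IsChildAt.unique {c : Bool} {x y s : T} (h : B.IsChildAt c x s) (h' : B.IsChildAt c y s) :
    x = y := by
  cases c
  · exact B.child₁_unique h h'
  · exact B.child₂_unique h h'

theorem IsChild.parent_unique {x s s' : T} (h : B.IsChild x s) (h' : B.IsChild x s') : s = s' :=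
  B.parent_unique h h'

theorem not_isChild_root (s : T) : ¬ B.IsChild B.root s := fun h =>
  h.elim (B.root_no_parent s).1 (B.root_no_parent s).2

theorem IsChildAt.index_unique {c c' : Bool} {x s : T} (h : B.IsChildAt c x s)
    (h' : B.IsChildAt c' x s) : c = c' := by
  have key : ∀ {x s}, B.child₁ x s → ¬ B.child₂ x s := fun h₁ h₂ => by
    obtain ⟨y, hy, hne⟩ := B.first_of_second h₂
    exact hne (B.child₁_unique hy h₁)
  cases c <;> cases c' <;> first | rfl | skip
  · exact (key h h').elim
  · exact (key h' h).elim

theorem exists_parent {x : T} (hx : x ≠ B.root) : ∃ s, B.IsChild x s := by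
  rcases (B.reaches_root x).cases_head with h | ⟨s, h, _⟩
  · exact (hx h).elim
  · exact ⟨s, h⟩

/-- Parents are unique, so a cycle through `x` would contain all ancestors of `x`, among them the
root, which has no parent. -/
theorem transGen_irrefl (x : T) : ¬ Relation.TransGen B.IsChild x x := by
  intro h
  have key : ∀ t, Relation.ReflTransGen B.IsChild x t → Relation.TransGen B.IsChild t x := by
    intro t ht
    induction ht with
    | refl => exact h
    | tail _ hbc ih =>
      obtain ⟨d, hd, hdx⟩ := Relation.TransGen.head'_iff.1 ih
      obtain rfl := hd.parent_unique hbc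
      rcases Relation.ReflTransGen.cases_head hdx with rfl | ⟨e, he, hex⟩
      · exact h
      · exact Relation.TransGen.head' he hex
  obtain ⟨d, hd, _⟩ := Relation.TransGen.head'_iff.1 (key _ (B.reaches_root x))
  exact not_isChild_root d hd

theorem wellFounded_isChild [Finite T] : WellFounded B.IsChild := by
  have : Std.Irrefl (Relation.TransGen B.IsChild) := ⟨transGen_irrefl⟩
  exact Subrelation.wf (Relation.TransGen.single ·)
    (Finite.wellFounded_of_trans_of_irrefl (Relation.TransGen B.IsChild))

theorem mem_subtree_self (s : T) : s ∈ B.subtree s := Relation.ReflTransGen.refl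

theorem mem_subtree_root (t : T) : t ∈ B.subtree B.root := B.reaches_root t

theorem IsChild.mem_subtree {t x s : T} (h : B.IsChild x s) (ht : t ∈ B.subtree x) :
    t ∈ B.subtree s := Relation.ReflTransGen.tail ht h

theorem mem_subtree_cases {t s : T} (h : t ∈ B.subtree s) :
    t = s ∨ ∃ x, B.IsChild x s ∧ t ∈ B.subtree x := by
  rcases Relation.ReflTransGen.cases_tail h with h | ⟨x, h, h'⟩
  · exact .inl h.symm
  · exact .inr ⟨x, h', h⟩

theorem IsChild.notMem_subtree {x s : T} (h : B.IsChild x s) : s ∉ B.subtree x := fun h' =>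
  transGen_irrefl s (Relation.TransGen.tail' h' h)

theorem parent_mem_subtree {t s x : T} (ht : t ∈ B.subtree x) (hne : t ≠ x) (h : B.IsChild t s) :
    s ∈ B.subtree x := by
  rcases Relation.ReflTransGen.cases_head ht with rfl | ⟨s', h', h''⟩
  · exact (hne rfl).elim
  · rwa [h.parent_unique h']

/-- The ancestors of `t` form a chain, so one of the siblings lies in the subtree of the other. If
they were different, their parent would lie in that subtree as well. -/
theorem eq_of_mem_subtree_of_isChild {t x y s : T} (hx : B.IsChild x s) (hy : B.IsChild y s)
    (htx : t ∈ B.subtree x) (hty : t ∈ B.subtree y) : x = y := by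
  have key : ∀ {x y}, B.IsChild x s → B.IsChild y s → x ∈ B.subtree y → x = y := by
    intro x y hx hy h
    by_contra hne
    exact hy.notMem_subtree (parent_mem_subtree h hne hx)
  have hu : Relator.RightUnique B.IsChild := fun _ _ _ h h' => h.parent_unique h'
  rcases Relation.ReflTransGen.total_of_right_unique hu htx hty with h | h
  · exact key hx hy h
  · exact (key hy hx h).symm

theorem IsLeaf.envelope {s : T} (h : B.IsLeaf s) : B.envelope s = Set.univ := by
  refine Set.eq_univ_of_forall fun t => ?_
  by_cases ht : t ∈ B.subtree s
  · rcases mem_subtree_cases ht with h' | ⟨x, hx, _⟩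
    · exact .inl h'
    · exact (h x hx).elim
  · exact .inr ht

theorem graph_adj {x y : T} (h : B.graph.Adj x y) : B.IsChild x y ∨ B.IsChild y x :=
  ((SimpleGraph.fromRel_adj _ _ _).1 h).2

theorem connected_induction {H : Set T} (hH : (B.graph.induce H).Connected) {P : T → Prop}
    (hP : ∀ x s, B.IsChild x s → x ∈ H → s ∈ H → (P x ↔ P s)) {s t : T} (hs : s ∈ H)
    (ht : t ∈ H) : P s ↔ P t := by
  have h := hH.preconnected ⟨s, hs⟩ ⟨t, ht⟩
  rw [SimpleGraph.reachable_iff_reflTransGen] at h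
  have key : ∀ u : H, Relation.ReflTransGen (B.graph.induce H).Adj ⟨s, hs⟩ u → (P s ↔ P u) := by
    intro u hu
    induction hu with
    | refl => rfl
    | @tail b c _ hbc ih =>
      rcases graph_adj (B := B) hbc with h | h
      · exact ih.trans (hP _ _ h b.2 c.2)
      · exact ih.trans (hP _ _ h c.2 b.2).symm
  exact key _ h

/-- A connected set of nodes that leaves the subtree of `x` contains `x` and its parent. -/
theorem mem_of_connected {H : Set T} (hH : (B.graph.induce H).Connected) {x s t t' : T}
    (hx : B.IsChild x s) (ht : t ∈ H) (htx : t ∈ B.subtree x) (ht' : t' ∈ H)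
    (htx' : t' ∉ B.subtree x) : x ∈ H ∧ s ∈ H := by
  by_contra hH'
  refine htx' ((connected_induction hH (P := fun u => u ∈ B.subtree x) ?_ ht ht').1 htx)
  refine fun u v huv hu hv => ⟨fun h => parent_mem_subtree h ?_ huv, fun h => ?_⟩
  · rintro rfl
    rw [hx.parent_unique huv] at hH'
    exact hH' ⟨hu, hv⟩
  · exact Relation.ReflTransGen.head huv h

/-- Induction on a set of nodes that grows from the root. -/
theorem grow_induction [Finite T] {P : Set T → Prop} {N₀ : Set T} (h₀ : P N₀)
    (hr : B.root ∈ N₀)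
    (hs : ∀ N x s, P N → s ∈ N → x ∉ N → B.IsChild x s → P (insert x N)) : P Set.univ := by
  obtain ⟨N, ⟨hN, hNr⟩, hmax⟩ := Set.Finite.exists_maximal (s := {N | P N ∧ B.root ∈ N})
    (Set.toFinite _) ⟨N₀, h₀, hr⟩
  suffices h : N = Set.univ from h ▸ hN
  by_contra hne
  obtain ⟨y, hy⟩ := (Set.ne_univ_iff_exists_notMem N).1 hne
  have : ∃ x s, s ∈ N ∧ x ∉ N ∧ B.IsChild x s := by
    by_contra! hcon
    have key : ∀ t, t ∈ B.subtree B.root → t ∈ N := by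
      intro t ht
      induction ht using Relation.ReflTransGen.head_induction_on with
      | refl => exact hNr
      | @head a c hac _ ih =>
        by_contra ha
        exact hcon a c ih ha hac
    exact hy (key y (mem_subtree_root y))
  obtain ⟨x, s, hsN, hxN, hxs⟩ := this
  exact hxN (hmax ⟨hs N x s hN hsN hxN hxs, Set.mem_insert_of_mem _ hNr⟩
    (Set.subset_insert x N) (Set.mem_insert x N))

end RootedTree

/-! ### The predicate `prime` selects the prime attributes -/

namespace TreeDecomposition

open RelSchema

variable {A F T : Type*} {S : RelSchema A F} {D : TreeDecomposition S T}

theorem attOf_univ : D.attOf Set.univ = Set.univ := by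
  refine Set.eq_univ_of_forall fun b => ?_
  obtain ⟨t, ht⟩ := D.att_covered b
  exact ⟨t, trivial, ht⟩

theorem fdOf_univ : D.fdOf Set.univ = Set.univ := by
  refine Set.eq_univ_of_forall fun b => ?_
  obtain ⟨t, ht⟩ := D.fd_covered b
  exact ⟨t, trivial, ht⟩

variable [DecidableEq A] [DecidableEq F]

/-- At a leaf nothing is cut off, so `Y'` and `C'` partition all attributes. The prescribed `FY`
settles closedness of `Y'` for the FDs in the bag, condition 2 for all others. The prescribed `ΔC`
says that every member of `C'` except `a` is the right-hand side of an FD in `FC'`. -/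
theorem isPrimeAttribute_of_primePred [Finite A] {a : A}
    (h : D.PrimePred a) : S.IsPrimeAttribute a := by
  obtain ⟨s, Y, FY, C, ΔC, FC, hs, has, ⟨-, Y', C', FC', -, -, rfl, rfl, -, ⟨hp, hd⟩,
    ⟨hc, hFY⟩, hFC, hr⟩, ha, rfl, rfl⟩ := h
  rw [hs.envelope, attOf_univ] at hp hFY
  rw [hs.envelope, fdOf_univ] at hc
  have hC : ∀ b, b ∈ C' ↔ b ∉ Y' := fun b =>
    ⟨fun h h' => hd b h' h, fun h => ((hp b).1 trivial).resolve_left h⟩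
  refine IsPrimeAttribute.iff_closed.2 ⟨Y', fun f hf => ?_, fun h => ?_, ?_⟩
  · by_contra hY
    by_cases hfs : f ∈ D.Fd s
    · refine ((hFY f).1 ?_).2.2 (by simpa using hf)
      simp [hfs, hY]
    · exact hc f trivial hfs hY hf
  · exact ha (by simp [h, has])
  · refine isSuperkey_of_derivation_order hC fun b hb hba => ?_
    obtain ⟨f, hf, rfl⟩ := (hr b).1 (by
      by_cases hbs : b ∈ D.At s
      · left; simp [hb, hbs, hba]
      · exact .inr ⟨hb, hbs⟩)
    exact ⟨f, rfl, (hFC f hf).2⟩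

/-- The extension of `FC` is the set of all FDs that derive along the order `C`; their right-hand
sides are exactly the members of `C` other than `a`. -/
theorem primePred_of_isPrimeAttribute [Finite A] [Finite F] (hD : D.IsModifiedNormalized) {a : A}
    (h : S.IsPrimeAttribute a) : D.PrimePred a := by
  classical
  have := Fintype.ofFinite F
  obtain ⟨s, hs, has⟩ := hD.att_in_leaf a
  obtain ⟨Y, hY, ha, hk⟩ := IsPrimeAttribute.iff_closed.1 h
  obtain ⟨C, hn, hC, hd⟩ := exists_derivation_order ha hk
  let FC := Finset.univ.filter fun f => S.Derives C a f
  refine ⟨s, Y ∩ D.At s, _, C.filter fun b => b ∈ D.At s, _, FC ∩ D.Fd s, hs, has,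
    ⟨?_, Y, C, FC, hn, ?_, rfl, rfl, rfl, ⟨?_, ?_⟩, ⟨?_, ?_⟩, ?_, ?_⟩, by simp [ha], rfl, rfl⟩
  · intro b hb
    simp only [Finset.mem_sdiff, List.mem_toFinset, List.mem_filter, decide_eq_true_eq] at hb
    exact hb.1.2
  · rw [hs.envelope, fdOf_univ]
    exact Set.subset_univ _
  · intro b
    rw [hs.envelope, attOf_univ, hC]
    simp [em]
  · exact fun b hb hb' => (hC b).1 hb' hb
  · exact fun f _ _ hr hl => hr (hY f hl)
  · intro f
    rw [hs.envelope, attOf_univ]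
    simp only [Finset.mem_filter, Finset.mem_inter, Set.inter_univ, Finset.coe_subset]
    constructor
    · rintro ⟨hf, hr⟩
      -- The right-hand side of an FD in the bag is itself in the bag, so the trace of `Y` on the
      -- bag decides whether it belongs to `Y`.
      have hr : S.rhs f ∉ Y := fun h => hr ⟨h, hD.rhs_mem s f hf⟩
      exact ⟨hf, hr, fun h => hr (hY f h)⟩
    · rintro ⟨hf, hr, _⟩
      exact ⟨hf, fun h => hr h.1⟩
  · intro f hf
    have hf : S.Derives C a f := by simpa [FC] using hf
    exact ⟨hf.1, hf.2.2⟩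
  · intro b
    have : (∃ f ∈ FC, S.rhs f = b) ↔ b ∈ C ∧ b ≠ a := by
      constructor
      · rintro ⟨f, hf, rfl⟩
        have hf : S.Derives C a f := by simpa [FC] using hf
        exact ⟨hf.1, hf.2.1⟩
      · rintro ⟨hb, hba⟩
        obtain ⟨f, hf, rfl⟩ := hd b hb hba
        exact ⟨f, by simpa [FC] using hf, rfl⟩
    rw [this]
    simp only [Finset.mem_sdiff, List.mem_toFinset, List.mem_filter, decide_eq_true_eq,
      Finset.mem_singleton]
    by_cases hba : b = a
    · subst hba
      simp [has]
    · tauto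

theorem primePred_iff [Finite A] [Finite F] (hD : D.IsModifiedNormalized) (a : A) :
    D.PrimePred a ↔ S.IsPrimeAttribute a :=
  ⟨isPrimeAttribute_of_primePred, primePred_of_isPrimeAttribute hD⟩

end TreeDecomposition

end PrimeAttr

namespace PrimeAttr

/-! ### Local certificates for prime attributes -/

/-- A direction at a node of a rooted tree. -/
inductive Dir
  | here
  | up
  | down (c : Bool)

/-- The structure induced on a bag with elements at the positions in `Fin K`, and the shape of the
tree at its node. -/
structure Label (K : ℕ) where
  isAtt : Fin K → Prop
  lh : Fin K → Fin K → Prop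
  rh : Fin K → Fin K → Prop
  child : Bool → Prop
  root : Prop

/-- The restriction of a certificate to a bag: the closed set of attributes and the set of FDs used
in the derivation (`mem`), the order of the derivation (`lt`), for each element the direction to a
node that justifies it (`ptr`), and the direction to a node at which the prime attribute is marked
(`dir`), with the position of this attribute (`pos`). -/
structure View (K : ℕ) where
  mem : Fin K → Prop
  lt : Fin K → Fin K → Prop
  ptr : Fin K → Dir
  dir : Dir
  pos : Fin K

instance : Finite Dir :=
  Finite.of_injective (β := Option (Option Bool))
    (fun | .here => none | .up => some none | .down c => some (some c))
    (by rintro (_ | _ | _) (_ | _ | _) h <;> simp_all)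

instance (K : ℕ) : Finite (Label K) :=
  Finite.of_injective (fun l => (l.isAtt, l.lh, l.rh, l.child, l.root))
    (by rintro ⟨⟩ ⟨⟩ h; simpa using h)

instance (K : ℕ) : Finite (View K) :=
  Finite.of_injective (fun v => (v.mem, v.lt, v.ptr, v.dir, v.pos))
    (by rintro ⟨⟩ ⟨⟩ h; simpa using h)

namespace View

variable {K : ℕ}

/-- The attribute at position `i` is marked. -/
def Marks (q : View K) (i : Fin K) : Prop := q.dir = .here ∧ q.pos = i

/-- The conditions on a certificate that concern a single bag. -/
structure Ok (l : Label K) (q : View K) : Prop where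
  lt_irrefl : ∀ i, ¬ q.lt i i
  lt_trans : ∀ i j k, q.lt i j → q.lt j k → q.lt i k
  lhs_lt : ∀ i j k, l.rh i k → l.lh j k → q.mem k → ¬ q.mem j → q.lt j i
  att_here : ∀ i, l.isAtt i → q.ptr i = .here → q.mem i ∨ q.Marks i ∨ ∃ k, l.rh i k ∧ q.mem k
  fd_here : ∀ i k, l.rh i k → q.ptr k = .here → q.mem i ∨ ∃ j, l.lh j k ∧ ¬ q.mem j
  ptr_up : ∀ i, q.ptr i = .up → ¬ l.root
  ptr_down : ∀ i c, q.ptr i = .down c → l.child c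
  marks : ∀ i, q.Marks i → l.isAtt i ∧ ¬ q.mem i

/-- The conditions on a certificate that concern the bag of a node (with view `q`) and that of its
first (`c = false`) or second (`c = true`) child (with view `q'`); `m i j` states that the element
at the position `i` of the former bag is at the position `j` of the latter. -/
structure Compat (c : Bool) (m : Fin K → Fin K → Prop) (q q' : View K) : Prop where
  mem : ∀ i j, m i j → (q.mem i ↔ q'.mem j)
  lt : ∀ i j i' j', m i j → m i' j' → (q.lt i i' ↔ q'.lt j j')
  up : ∀ j, q'.ptr j = .up → ∃ i, m i j
  down : ∀ i, q.ptr i = .down c → ∃ j, m i j ∧ q'.ptr j ≠ .up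
  dir : q'.dir = .up ∨ q.dir = .down c

end View

namespace RootedTree

variable {T : Type*} (B : RootedTree T)

open Classical in
/-- The direction from the node `s` to the node `t`. -/
noncomputable def toward (t s : T) : Dir :=
  if s = t then .here
  else if h : ∃ c x, B.IsChildAt c x s ∧ t ∈ B.subtree x then .down h.choose
  else .up

variable {B}

theorem toward_eq_here {t s : T} : B.toward t s = .here ↔ s = t := by
  unfold toward
  split_ifs <;> simp_all

theorem toward_eq_up {t s : T} : B.toward t s = .up ↔ t ∉ B.subtree s := by
  unfold toward
  split_ifs with h h'
  · simp [h, mem_subtree_self]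
  · obtain ⟨c, x, hx, ht⟩ := h'
    simpa using hx.isChild.mem_subtree ht
  · simp only [true_iff]
    intro h''
    rcases mem_subtree_cases h'' with h₁ | ⟨x, hx, h₁⟩
    · exact h h₁.symm
    · obtain ⟨c, hc⟩ := isChild_iff.1 hx
      exact h' ⟨c, x, hc, h₁⟩

theorem toward_eq_down {t s : T} {c : Bool} :
    B.toward t s = .down c ↔ ∃ x, B.IsChildAt c x s ∧ t ∈ B.subtree x := by
  unfold toward
  split_ifs with h h'
  · subst h
    simp only [false_iff, not_exists, not_and]
    exact fun x hx => hx.isChild.notMem_subtree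
  · have hc := h'.choose_spec
    simp only [Dir.down.injEq]
    constructor
    · rintro rfl
      exact hc
    · rintro ⟨x, hx, ht⟩
      obtain ⟨y, hy, ht'⟩ := hc
      obtain rfl := eq_of_mem_subtree_of_isChild hx.isChild hy.isChild ht ht'
      exact hy.index_unique hx
  · simp only [false_iff]
    exact fun ⟨x, hx⟩ => h' ⟨c, x, hx⟩

end RootedTree

namespace TreeDecomposition

open RelSchema PrimeAttr.RootedTree

variable {A F T : Type*} {S : RelSchema A F} (D : TreeDecomposition S T) {K : ℕ}

/-- `el s` lists the elements of the bag of `s`, each of them once. -/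
structure IsIndexing (el : T → Fin K → Option (A ⊕ F)) : Prop where
  inj : ∀ s i j e, el s i = some e → el s j = some e → i = j
  att : ∀ s b, b ∈ D.At s ↔ ∃ i, el s i = some (.inl b)
  fd : ∀ s f, f ∈ D.Fd s ↔ ∃ i, el s i = some (.inr f)

/-- The label of a node, for a given indexing of the bags. -/
def label (el : T → Fin K → Option (A ⊕ F)) (s : T) : Label K where
  isAtt i := ∃ b, el s i = some (.inl b)
  lh i j := ∃ b f, el s i = some (.inl b) ∧ el s j = some (.inr f) ∧ b ∈ S.lhs f
  rh i j := ∃ b f, el s i = some (.inl b) ∧ el s j = some (.inr f) ∧ b = S.rhs f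
  child c := ∃ x, D.IsChildAt c x s
  root := s = D.root

/-- The positions `i` in the bag of `s` and `j` in the bag of `x` hold the same element. -/
def Matches (el : T → Fin K → Option (A ⊕ F)) (s x : T) (i j : Fin K) : Prop :=
  ∃ e, el s i = some e ∧ el x j = some e

/-- The views `v` of the bags form a certificate. -/
structure IsCertificate (el : T → Fin K → Option (A ⊕ F)) (v : T → View K) : Prop where
  ok : ∀ s, (v s).Ok (D.label el s)
  compat : ∀ c x s, D.IsChildAt c x s → (v s).Compat c (Matches el s x) (v x)

variable {D} {el : T → Fin K → Option (A ⊕ F)} {v : T → View K}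

theorem IsIndexing.connected (hel : D.IsIndexing el) (e : A ⊕ F) :
    (D.graph.induce {s | ∃ i, el s i = some e}).Connected := by
  rcases e with b | f
  · have h : {s | ∃ i, el s i = some (.inl b)} = {s | b ∈ D.At s} :=
      Set.ext fun s => (hel.att s b).symm
    rw [h]
    exact D.att_connected b
  · have h : {s | ∃ i, el s i = some (.inr f)} = {s | f ∈ D.Fd s} :=
      Set.ext fun s => (hel.fd s f).symm
    rw [h]
    exact D.fd_connected f

namespace IsCertificate

theorem mem_iff (hel : D.IsIndexing el) (hv : D.IsCertificate el v) {s t : T} {i j : Fin K}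
    {e : A ⊕ F} (hs : el s i = some e) (ht : el t j = some e) :
    (v s).mem i ↔ (v t).mem j := by
  -- Quantifying over the position turns the claim into a property of nodes, which can be propagated
  -- along the connected set of occurrences of `e`.
  have key : ∀ {u k}, el u k = some e → ((∃ k, el u k = some e ∧ (v u).mem k) ↔ (v u).mem k) :=
    fun h => ⟨fun ⟨k', h', h''⟩ => hel.inj _ _ _ _ h h' ▸ h'', fun h' => ⟨_, h, h'⟩⟩
  rw [← key hs, ← key ht]
  refine connected_induction (P := fun u => ∃ k, el u k = some e ∧ (v u).mem k) (hel.connected e)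
    ?_ ⟨i, hs⟩ ⟨j, ht⟩
  rintro x y hxy ⟨k, hk⟩ ⟨l, hl⟩
  obtain ⟨c, hc⟩ := isChild_iff.1 hxy
  rw [key hk, key hl]
  exact ((hv.compat c x y hc).mem l k ⟨e, hl, hk⟩).symm

/-- Following the pointers leads to a node that justifies the element. -/
theorem exists_here [Finite T] (hv : D.IsCertificate el v) {s : T}
    {i : Fin K} {e : A ⊕ F} (hs : el s i = some e) :
    ∃ t j, el t j = some e ∧ (v t).ptr j = .here := by
  -- `Compat.down` forbids the child to point back up, so a descent never turns round and ends by
  -- well-foundedness. An ascent ends at the root at the latest, where `ptr_up` excludes the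
  -- direction `up`.
  have down : ∀ s i, el s i = some e → (v s).ptr i ≠ .up →
      ∃ t j, el t j = some e ∧ (v t).ptr j = .here := by
    intro s
    induction s using (wellFounded_isChild (B := D.toRootedTree)).induction with
    | _ s ih =>
      intro i hi hup
      rcases hp : (v s).ptr i with _ | _ | c
      · exact ⟨s, i, hi, hp⟩
      · exact (hup hp).elim
      · obtain ⟨x, hx⟩ := (hv.ok s).ptr_down i c hp
        obtain ⟨j, ⟨e', h₁, h₂⟩, hj⟩ := (hv.compat c x s hx).down i hp
        obtain rfl : e = e' := Option.some.inj (hi.symm.trans h₁)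
        exact ih x hx.isChild j h₂ hj
  have h := D.reaches_root s
  induction h using Relation.ReflTransGen.head_induction_on generalizing i with
  | refl => exact down _ i hs fun h => (hv.ok _).ptr_up i h rfl
  | @head x s hxs _ ih =>
    by_cases hup : (v x).ptr i = .up
    · obtain ⟨c, hc⟩ := isChild_iff.1 hxs
      obtain ⟨k, e', h₁, h₂⟩ := (hv.compat c x s hc).up i hup
      obtain rfl : e = e' := Option.some.inj (hs.symm.trans h₂)
      exact ih h₁
    · exact down x i hs hup

theorem dir_up (hv : D.IsCertificate el v) {s t : T} (hs : (v s).dir = .up)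
    (ht : t ∈ D.subtree s) : (v t).dir = .up := by
  induction ht using Relation.ReflTransGen.head_induction_on with
  | refl => exact hs
  | head h _ ih =>
    obtain ⟨c, hc⟩ := isChild_iff.1 h
    simpa [ih] using (hv.compat c _ _ hc).dir

/-- At most one node is marked. -/
theorem dir_here_unique [Finite T] (hv : D.IsCertificate el v) {s t : T}
    (hs : (v s).dir = .here) (ht : (v t).dir = .here) : s = t := by
  -- Induction on a common ancestor `u`. A marked node in the subtree of a child forces `u` to point
  -- to that child, since otherwise everything below the child would point up. So `u` is not marked
  -- itself, and two marked nodes strictly below it are below the same child.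
  have key : ∀ u, s ∈ D.subtree u → t ∈ D.subtree u → s = t := by
    intro u
    induction u using (wellFounded_isChild (B := D.toRootedTree)).induction with
    | _ u ih =>
      have hchild : ∀ x w, (v w).dir = .here → D.IsChild x u → w ∈ D.subtree x →
          ∃ c, D.IsChildAt c x u ∧ (v u).dir = .down c := by
        intro x w hw hx hwx
        obtain ⟨c, hc⟩ := isChild_iff.1 hx
        refine ⟨c, hc, (hv.compat c x u hc).dir.resolve_left fun h => ?_⟩
        simp [hv.dir_up h hwx] at hw
      intro hsu htu
      rcases mem_subtree_cases hsu with rfl | ⟨x, hx, hsx⟩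
      · rcases mem_subtree_cases htu with rfl | ⟨y, hy, hty⟩
        · rfl
        · obtain ⟨c, -, hc⟩ := hchild y t ht hy hty
          simp [hs] at hc
      · obtain ⟨c, hcx, hc⟩ := hchild x s hs hx hsx
        rcases mem_subtree_cases htu with rfl | ⟨y, hy, hty⟩
        · simp [ht] at hc
        · obtain ⟨c', hcy, hc'⟩ := hchild y t ht hy hty
          obtain rfl : c = c' := by simpa [hc] using hc'
          obtain rfl := hcx.unique hcy
          exact ih x hx hsx hty
  exact key _ (mem_subtree_root s) (mem_subtree_root t)

end IsCertificate

/-! ### Soundness: an attribute marked by a certificate is prime -/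

section Soundness

variable [DecidableEq A] [DecidableEq F]

/-- `ρ` induces the order of the certificate on the attributes in `B` of the bag of `x`. -/
def Respects (el : T → Fin K → Option (A ⊕ F)) (v : T → View K) (ρ : A → ℚ) (x : T)
    (B : Finset A) : Prop :=
  ∀ i j b b', el x i = some (.inl b) → el x j = some (.inl b') → b ∈ B → b' ∈ B →
    (v x).lt i j → ρ b < ρ b'

/-- By transitivity, the ranks of the attributes below `n` are smaller than those of the attributes
above `n`. Since ℚ is dense without endpoints, a value for `n` fits between these two finite,
possibly empty, sets. -/
theorem IsCertificate.exists_respects_insert (hel : D.IsIndexing el) (hv : D.IsCertificate el v)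
    {ρ : A → ℚ} {x : T} {B : Finset A} (hρ : Respects el v ρ x B) {n : A} (hn : n ∈ D.At x)
    (hnB : n ∉ B) : ∃ r, Respects el v (Function.update ρ n r) x (insert n B) := by
  classical
  obtain ⟨k, hk⟩ := (hel.att x n).1 hn
  obtain ⟨r, hr₁, hr₂⟩ := Order.exists_between_finsets
    (lo := (B.filter fun b => ∃ i, el x i = some (.inl b) ∧ (v x).lt i k).image ρ)
    (hi := (B.filter fun b => ∃ i, el x i = some (.inl b) ∧ (v x).lt k i).image ρ) (by
      simp only [Finset.mem_image, Finset.mem_filter]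
      rintro _ ⟨b, ⟨hb, i, hi, hik⟩, rfl⟩ _ ⟨b', ⟨hb', j, hj, hkj⟩, rfl⟩
      exact hρ i j b b' hi hj hb hb' ((hv.ok x).lt_trans i k j hik hkj))
  refine ⟨r, fun i j b b' hi hj hb hb' hij => ?_⟩
  have hne : b ≠ b' := by
    rintro rfl
    obtain rfl := hel.inj _ _ _ _ hi hj
    exact (hv.ok x).lt_irrefl i hij
  by_cases hbn : b = n
  · subst hbn
    obtain rfl := hel.inj _ _ _ _ hi hk
    rw [Function.update_self, Function.update_of_ne hne.symm]
    exact hr₂ _ (Finset.mem_image_of_mem _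
      (Finset.mem_filter.2 ⟨(Finset.mem_insert.1 hb').resolve_left hne.symm, j, hj, hij⟩))
  have hbB := (Finset.mem_insert.1 hb).resolve_left hbn
  rw [Function.update_of_ne hbn]
  by_cases hbn' : b' = n
  · subst hbn'
    obtain rfl := hel.inj _ _ _ _ hj hk
    rw [Function.update_self]
    exact hr₁ _ (Finset.mem_image_of_mem _ (Finset.mem_filter.2 ⟨hbB, i, hi, hij⟩))
  · rw [Function.update_of_ne hbn']
    exact hρ i j b b' hi hj hbB ((Finset.mem_insert.1 hb').resolve_left hbn') hij

/-- The attributes of the bag are inserted one at a time. Only those outside `B` get new ranks; the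
last clause is what protects the bags treated earlier. -/
theorem IsCertificate.exists_respects (hel : D.IsIndexing el) (hv : D.IsCertificate el v)
    {ρ : A → ℚ} {x : T} {B : Finset A} (hρ : Respects el v ρ x B) :
    ∃ ρ', Respects el v ρ' x (D.At x) ∧ ∀ b, (b ∈ D.At x → b ∈ B) → ρ' b = ρ b := by
  classical
  have key : ∀ E : Finset A, E ⊆ D.At x →
      ∃ ρ', Respects el v ρ' x (E ∪ B) ∧ ∀ b, (b ∈ D.At x → b ∈ B) → ρ' b = ρ b := by
    intro E
    induction E using Finset.induction_on with
    | empty => exact fun _ => ⟨ρ, by simpa using hρ, fun _ _ => rfl⟩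
    | insert n E _ ih =>
      intro hE
      obtain ⟨ρ', h, h'⟩ := ih ((Finset.subset_insert n E).trans hE)
      have hn := hE (Finset.mem_insert_self n E)
      rw [Finset.insert_union]
      by_cases hnE : n ∈ E ∪ B
      · exact ⟨ρ', by rwa [Finset.insert_eq_of_mem hnE], h'⟩
      · obtain ⟨r, hr⟩ := exists_respects_insert hel hv h hn hnE
        refine ⟨_, hr, fun b hb => ?_⟩
        rw [Function.update_of_ne, h' b hb]
        rintro rfl
        exact hnE (Finset.mem_union_right _ (hb hn))
  obtain ⟨ρ', h, h'⟩ := key _ subset_rfl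
  exact ⟨ρ', fun i j b b' hi hj hb hb' => h i j b b' hi hj (Finset.mem_union_left _ hb)
    (Finset.mem_union_left _ hb'), h'⟩

/-- The orders in the bags are induced by an order of all attributes. -/
theorem IsCertificate.exists_rank [Finite T] (hel : D.IsIndexing el)
    (hv : D.IsCertificate el v) :
    ∃ ρ : A → ℚ, ∀ s i j b b', el s i = some (.inl b) → el s j = some (.inl b') →
      (v s).lt i j → ρ b < ρ b' := by
  let P : Set T → Prop := fun N =>
    (∀ x s, D.IsChild x s → x ∈ N → s ∈ N) ∧ ∃ ρ, ∀ s ∈ N, Respects el v ρ s (D.At s)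
  have hP : P Set.univ := by
    refine grow_induction (B := D.toRootedTree) (N₀ := {D.root}) ⟨?_, ?_⟩ rfl ?_
    · rintro x s hxs rfl
      exact (not_isChild_root s hxs).elim
    · obtain ⟨ρ, hρ, -⟩ := hv.exists_respects hel (ρ := fun _ => 0) (x := D.root) (B := ∅)
        (fun _ _ _ _ _ _ h => by simp at h)
      exact ⟨ρ, by rintro s rfl; exact hρ⟩
    · rintro N x s ⟨hN, ρ, hρ⟩ hs hx hxs
      refine ⟨fun y u hyu hy => ?_, ?_⟩
      · rcases hy with rfl | hy
        · exact .inr (hxs.parent_unique hyu ▸ hs)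
        · exact .inr (hN y u hyu hy)
      · obtain ⟨c, hc⟩ := isChild_iff.1 hxs
        have hold : ∀ i b, el x i = some (.inl b) → b ∈ D.At x ∩ D.At s →
            ∃ k, el s k = some (.inl b) ∧ Matches el s x k i := by
          intro i b hi hb
          obtain ⟨k, hk⟩ := (hel.att s b).1 (Finset.mem_inter.1 hb).2
          exact ⟨k, hk, _, hk, hi⟩
        -- The ranks already fixed in the bag of `x` are those shared with its parent, where
        -- `Compat.lt` makes the two orders agree.
        obtain ⟨ρ', hx', hρ'⟩ := hv.exists_respects hel (ρ := ρ) (x := x)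
          (B := D.At x ∩ D.At s) (by
            intro i j b b' hi hj hb hb' hij
            obtain ⟨k, hk, hki⟩ := hold i b hi hb
            obtain ⟨l, hl, hlj⟩ := hold j b' hj hb'
            exact hρ s hs k l b b' hk hl (Finset.mem_inter.1 hb).2 (Finset.mem_inter.1 hb').2
              (((hv.compat c x s hc).lt k i l j hki hlj).2 hij))
        refine ⟨ρ', ?_⟩
        rintro t (rfl | ht)
        · exact hx'
        · have hsub : t ∉ D.subtree x := by
            intro htx
            induction htx using Relation.ReflTransGen.head_induction_on with
            | refl => exact hx ht
            | head h _ ih => exact ih (hN _ _ h ht)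
          -- An attribute common to `x` and a treated node `t` also occurs in the parent `s`, by
          -- connectedness, so its rank has been kept.
          have heq : ∀ b ∈ D.At t, ρ' b = ρ b := by
            refine fun b hb => hρ' b fun hbx => Finset.mem_inter.2 ⟨hbx, ?_⟩
            exact (mem_of_connected (D.att_connected b) hxs hbx (mem_subtree_self x) hb hsub).2
          intro i j b b' hi hj hb hb' hij
          rw [heq b hb, heq b' hb']
          exact hρ t ht i j b b' hi hj hb hb' hij
  obtain ⟨-, ρ, hρ⟩ := hP
  exact ⟨ρ, fun s i j b b' hi hj => hρ s trivial i j b b' hi hj ((hel.att s b).2 ⟨i, hi⟩)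
    ((hel.att s b').2 ⟨j, hj⟩)⟩

/-- The set `Y` is read off from the views. Closedness under an FD is checked at the node to which
the pointers of the FD lead, and the derivation of an attribute at the node to which its own
pointers lead. The common ranking of the bags excludes circular derivations. -/
theorem IsCertificate.isPrimeAttribute [Finite A] [Finite T]
    (hrhs : ∀ s, ∀ f ∈ D.Fd s, S.rhs f ∈ D.At s) (hel : D.IsIndexing el)
    (hv : D.IsCertificate el v) {a : A} {s : T} {i : Fin K} (hi : el s i = some (.inl a))
    (hm : (v s).Marks i) : S.IsPrimeAttribute a := by
  classical
  have := Fintype.ofFinite A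
  obtain ⟨ρ, hρ⟩ := hv.exists_rank hel
  let Y : Finset A := Finset.univ.filter fun b => ∃ s i, el s i = some (.inl b) ∧ (v s).mem i
  have hY : ∀ {s i b}, el s i = some (.inl b) → (b ∈ Y ↔ (v s).mem i) := by
    intro s i b h
    simp only [Y, Finset.mem_filter, Finset.mem_univ, true_and]
    exact ⟨fun ⟨t, j, ht, h'⟩ => (hv.mem_iff hel ht h).1 h', fun h' => ⟨s, i, h, h'⟩⟩
  refine IsPrimeAttribute.iff_closed.2 ⟨Y, fun f hf => ?_, ?_, isSuperkey_of_rank ρ ?_⟩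
  · obtain ⟨s, hs⟩ := D.fd_covered f
    obtain ⟨k, hk⟩ := (hel.fd s f).1 hs
    obtain ⟨t, k, hk, hp⟩ := hv.exists_here hk
    obtain ⟨l, hl⟩ := (hel.att t _).1 (hrhs t f ((hel.fd t f).2 ⟨k, hk⟩))
    rcases (hv.ok t).fd_here l k ⟨_, f, hl, hk, rfl⟩ hp with h | ⟨j, ⟨b, f', hj, hk', hb⟩, h⟩
    · exact (hY hl).2 h
    · obtain rfl : f' = f := by simpa [hk] using hk'.symm
      exact (h ((hY hj).1 (hf hb))).elim
  · rw [hY hi]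
    exact ((hv.ok s).marks i hm).2
  · intro b hb
    rw [Finset.mem_insert, not_or] at hb
    obtain ⟨t₀, ht₀⟩ := D.att_covered b
    obtain ⟨l, hl⟩ := (hel.att t₀ b).1 ht₀
    obtain ⟨t, l, hl, hp⟩ := hv.exists_here hl
    rcases (hv.ok t).att_here l ⟨b, hl⟩ hp with h | h | ⟨k, ⟨b', f, hl', hk, rfl⟩, h⟩
    · exact (hb.2 ((hY hl).2 h)).elim
    · obtain rfl := hv.dir_here_unique hm.1 h.1
      obtain rfl := hm.2.symm.trans h.2
      exact (hb.1 (by simpa [hi] using hl.symm)).elim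
    · obtain rfl : S.rhs f = b := by simpa [hl] using hl'.symm
      refine ⟨f, rfl, fun c hc => ?_⟩
      by_cases hcY : c ∈ Y
      · exact .inl (Finset.mem_insert_of_mem hcY)
      · obtain ⟨u, hcu, hfu⟩ := D.lh_covered f c hc
        obtain ⟨j, hj⟩ := (hel.att u c).1 hcu
        obtain ⟨k', hk'⟩ := (hel.fd u f).1 hfu
        obtain ⟨m, hm⟩ := (hel.att u _).1 (hrhs u f hfu)
        refine .inr (hρ u j m c _ hj hm ?_)
        exact (hv.ok u).lhs_lt m j k' ⟨_, f, hm, hk', rfl⟩ ⟨c, f, hj, hk', hc⟩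
          ((hv.mem_iff hel hk hk').1 h) (fun h => hcY ((hY hj).2 h))

end Soundness

/-- What justifies an element at the node `t`. -/
def Justifies [DecidableEq A] (D : TreeDecomposition S T) (Y : Finset A) (C : List A) (a : A)
    (t₀ t : T) : A ⊕ F → Prop
  | .inl b => b ∈ D.At t ∧ (b ∈ Y ∨ (b = a ∧ t = t₀) ∨ ∃ f ∈ D.Fd t, S.rhs f = b ∧ S.Derives C a f)
  | .inr f => f ∈ D.Fd t ∧ (S.rhs f ∈ Y ∨ ∃ b ∈ D.At t, b ∈ S.lhs f ∧ b ∉ Y)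

/-- For each element a node that justifies it is chosen; its pointers are the directions towards
this node, and `dir` is the direction towards a fixed node whose bag contains `a`. Connectedness of
the occurrences guarantees that the element is present along the whole way. -/
theorem exists_isCertificate [Finite A] [DecidableEq A]
    (hrhs : ∀ s, ∀ f ∈ D.Fd s, S.rhs f ∈ D.At s) (hel : D.IsIndexing el) {a : A}
    (ha : S.IsPrimeAttribute a) :
    ∃ v s i, D.IsCertificate el v ∧ el s i = some (.inl a) ∧ (v s).Marks i := by
  obtain ⟨Y, hY, haY, hk⟩ := IsPrimeAttribute.iff_closed.1 ha
  obtain ⟨C, hn, hC, hd⟩ := exists_derivation_order haY hk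
  obtain ⟨t₀, ht₀⟩ := D.att_covered a
  obtain ⟨i₀, hi₀⟩ := (hel.att t₀ a).1 ht₀
  have hJ : ∀ e, ∃ t, D.Justifies Y C a t₀ t e := by
    rintro (b | f)
    · by_cases hbY : b ∈ Y
      · obtain ⟨t, ht⟩ := D.att_covered b
        exact ⟨t, ht, .inl hbY⟩
      by_cases hba : b = a
      · subst hba
        exact ⟨t₀, ht₀, .inr (.inl ⟨rfl, rfl⟩)⟩
      · obtain ⟨f, hf, rfl⟩ := hd b ((hC b).2 hbY) hba
        obtain ⟨t, ht⟩ := D.fd_covered f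
        exact ⟨t, hrhs t f ht, .inr (.inr ⟨f, ht, rfl, hf⟩)⟩
    · by_cases hf : S.rhs f ∈ Y
      · obtain ⟨t, ht⟩ := D.fd_covered f
        exact ⟨t, ht, .inl hf⟩
      · obtain ⟨b, hb, hbY⟩ := Finset.not_subset.1 fun h => hf (hY f h)
        obtain ⟨t, hbt, ht⟩ := D.lh_covered f b hb
        exact ⟨t, ht, .inr ⟨b, hbt, hb, hbY⟩⟩
  choose tgt htgt using hJ
  have htgt_el : ∀ e, ∃ i, el (tgt e) i = some e := by
    rintro (b | f)
    · exact (hel.att _ _).1 (htgt (.inl b)).1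
    · exact (hel.fd _ _).1 (htgt (.inr f)).1
  let mem : A ⊕ F → Prop := Sum.elim (· ∈ Y) (S.Derives C a)
  -- Unoccupied positions get the pointer `here`, which demands nothing of them. The position `i₀`
  -- has a meaning only at `t₀`, the one node with `dir = here`.
  let v : T → View K := fun s =>
    { mem := fun i => ∃ e, el s i = some e ∧ mem e
      lt := fun i j => ∃ b b', el s i = some (.inl b) ∧ el s j = some (.inl b') ∧
        C.idxOf b < C.idxOf b'
      ptr := fun i => (el s i).elim .here fun e => D.toward (tgt e) s
      dir := D.toward t₀ s
      pos := i₀ }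
  have hmem : ∀ {s i e}, el s i = some e → ((v s).mem i ↔ mem e) := fun h =>
    ⟨fun ⟨e', h', h''⟩ => Option.some.inj (h'.symm.trans h) ▸ h'', fun h' => ⟨_, h, h'⟩⟩
  have hlt : ∀ {s i j b b'}, el s i = some (.inl b) → el s j = some (.inl b') →
      ((v s).lt i j ↔ C.idxOf b < C.idxOf b') := by
    intro s i j b b' h h'
    simp only [v, h, h', Option.some.injEq, Sum.inl.injEq]
    exact ⟨by rintro ⟨_, _, rfl, rfl, h⟩; exact h, fun h => ⟨_, _, rfl, rfl, h⟩⟩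
  have hptr : ∀ {s i e}, el s i = some e → (v s).ptr i = D.toward (tgt e) s := by
    intro s i e h
    simp [v, h]
  have hnone : ∀ {s i}, (v s).ptr i ≠ .here → ∃ e, el s i = some e := by
    intro s i h
    cases h' : el s i with
    | none => simp [v, h'] at h
    | some e => exact ⟨e, rfl⟩
  refine ⟨v, t₀, i₀, ⟨fun s => ?_, fun c x s hx => ?_⟩, hi₀, toward_eq_here.2 rfl, rfl⟩
  · constructor
    · rintro i ⟨b, b', h, h', hlt⟩
      rw [h] at h'
      simp_all
    · rintro i j k ⟨b, b', h₁, h₂, hlt₁⟩ ⟨c', c, h₃, h₄, hlt₂⟩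
      obtain rfl : b' = c' := by simpa [h₂] using h₃
      exact ⟨b, c, h₁, h₄, hlt₁.trans hlt₂⟩
    · rintro i j k ⟨_, f, hi, hk, rfl⟩ ⟨b, f', hj, hk', hb⟩ hf hbY
      obtain rfl : f = f' := by simpa [hk] using hk'
      rw [hmem hk] at hf
      rw [hmem hj] at hbY
      rw [hlt hj hi]
      exact hf.2.2 b hb ((hC b).2 hbY)
    · rintro i ⟨b, hi⟩ h
      rw [hptr hi, toward_eq_here] at h
      rcases (htgt (.inl b)).2 with h' | ⟨rfl, h'⟩ | ⟨f, hf, rfl, h'⟩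
      · exact .inl ((hmem hi).2 h')
      · obtain rfl := h.trans h'
        exact .inr (.inl ⟨toward_eq_here.2 rfl, hel.inj _ _ _ _ hi₀ hi⟩)
      · rw [← h] at hf
        obtain ⟨k, hk⟩ := (hel.fd _ _).1 hf
        exact .inr (.inr ⟨k, ⟨_, f, hi, hk, rfl⟩, (hmem hk).2 h'⟩)
    · rintro i k ⟨_, f, hi, hk, rfl⟩ h
      rw [hptr hk, toward_eq_here] at h
      rcases (htgt (.inr f)).2 with h' | ⟨b, hbt, hb, hbY⟩
      · exact .inl ((hmem hi).2 h')
      · rw [← h] at hbt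
        obtain ⟨j, hj⟩ := (hel.att _ _).1 hbt
        exact .inr ⟨j, ⟨b, f, hj, hk, hb⟩, fun h => hbY ((hmem hj).1 h)⟩
    · rintro i h rfl
      obtain ⟨e, he⟩ := hnone (s := D.root) (i := i) (by simp [h])
      rw [hptr he, toward_eq_up] at h
      exact h (mem_subtree_root _)
    · rintro i c h
      obtain ⟨e, he⟩ := hnone (s := s) (i := i) (by simp [h])
      rw [hptr he, toward_eq_down] at h
      obtain ⟨x, hx, -⟩ := h
      exact ⟨x, hx⟩
    · rintro i ⟨h, rfl⟩
      obtain rfl := toward_eq_here.1 h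
      exact ⟨⟨a, hi₀⟩, fun h => haY ((hmem hi₀).1 h)⟩
  · constructor
    · rintro i j ⟨e, hi, hj⟩
      rw [hmem hi, hmem hj]
    · rintro i j i' j' ⟨e, hi, hj⟩ ⟨e', hi', hj'⟩
      simp only [v, hi, hj, hi', hj']
    · intro j h
      obtain ⟨e, he⟩ := hnone (s := x) (i := j) (by simp [h])
      rw [hptr he, toward_eq_up] at h
      obtain ⟨i, hi⟩ := (mem_of_connected (hel.connected e) hx.isChild ⟨j, he⟩ (mem_subtree_self x)
        (htgt_el e) h).2
      exact ⟨i, e, hi, he⟩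
    · intro i h
      obtain ⟨e, he⟩ := hnone (s := s) (i := i) (by simp [h])
      rw [hptr he, toward_eq_down] at h
      obtain ⟨y, hy, ht⟩ := h
      obtain rfl := hx.unique hy
      obtain ⟨j, hj⟩ := (mem_of_connected (hel.connected e) hx.isChild (htgt_el e) ht ⟨i, he⟩
        hx.isChild.notMem_subtree).1
      exact ⟨j, ⟨e, he, hj⟩, by rw [hptr hj, Ne, toward_eq_up, not_not]; exact ht⟩
    · by_cases h : t₀ ∈ D.subtree x
      · exact .inr (toward_eq_down.2 ⟨x, hx, h⟩)
      · exact .inl (toward_eq_up.2 h)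

theorem isPrimeAttribute_iff_exists_isCertificate [Finite A] [Finite T] [DecidableEq A]
    [DecidableEq F] (hrhs : ∀ s, ∀ f ∈ D.Fd s, S.rhs f ∈ D.At s) (hel : D.IsIndexing el) (a : A) :
    S.IsPrimeAttribute a ↔
      ∃ v s i, D.IsCertificate el v ∧ el s i = some (.inl a) ∧ (v s).Marks i :=
  ⟨exists_isCertificate hrhs hel, fun ⟨_, _, _, hv, hi, hm⟩ => hv.isPrimeAttribute hrhs hel hi hm⟩

end TreeDecomposition

end PrimeAttr

namespace PrimeAttr

namespace RootedTree

/-! ### Arc consistency on rooted trees -/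

variable {T Q : Type*} (B : RootedTree T) (U : T → Q → Prop) (E : T → T → Q → Q → Prop)

/-- An assignment of values to the nodes that satisfies all constraints on nodes and edges. -/
structure IsSolution (f : T → Q) : Prop where
  node : ∀ s, U s (f s)
  edge : ∀ x s, B.IsChild x s → E s x (f s) (f x)

/-- The values `q` and `q'` of the node `s` and its child `x` satisfy the constraints. -/
def Arc (s x : T) (q q' : Q) : Prop := U s q ∧ U x q' ∧ E s x q q'

/-- Remove the values of `s` without a compatible value of its child `x`. -/
def reviseUp [DecidableEq T] (s x : T) (G : T → Set Q) : T → Set Q :=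
  Function.update G s {q ∈ G s | ∃ q' ∈ G x, Arc U E s x q q'}

/-- Remove the values of `x` without a compatible value of its parent `s`. -/
def reviseDown [DecidableEq T] (s x : T) (G : T → Set Q) : T → Set Q :=
  Function.update G x {q' ∈ G x | ∃ q ∈ G s, Arc U E s x q q'}

/-- Each value of `s` has a compatible value of `x`. -/
def ConsistentUp (G : T → Set Q) (s x : T) : Prop := ∀ q ∈ G s, ∃ q' ∈ G x, Arc U E s x q q'

/-- Each value of `x` has a compatible value of `s`. -/
def ConsistentDown (G : T → Set Q) (s x : T) : Prop := ∀ q' ∈ G x, ∃ q ∈ G s, Arc U E s x q q'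

variable {B U E}

/-- Consistency towards parents extends the value at `s` along the path to the root. From there,
consistency towards children extends the assignment to all remaining nodes; in a tree each new node
has only one assigned neighbour, its parent, so no conflict arises. -/
theorem exists_isSolution [Finite T] {G : T → Set Q}
    (hu : ∀ x s, B.IsChild x s → ConsistentUp U E G s x)
    (hd : ∀ x s, B.IsChild x s → ConsistentDown U E G s x) {s : T} {q : Q} (hq : q ∈ G s)
    (hU : U s q) : ∃ f, B.IsSolution U E f ∧ f s = q := by
  classical
  let Good : Set T → (T → Q) → Prop := fun N f => B.root ∈ N ∧ (∀ x s, B.IsChild x s → x ∈ N → s ∈ N) ∧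
    (∀ t ∈ N, f t ∈ G t) ∧ ∀ x s, B.IsChild x s → x ∈ N → Arc U E s x (f s) (f x)
  have extend : ∀ N f x s q', Good N f → s ∈ N → x ∉ N → B.IsChild x s → q' ∈ G x →
      Arc U E s x (f s) q' → Good (insert x N) (Function.update f x q') := by
    rintro N f x s q' ⟨hr, hN, hG, hE⟩ hs hx hxs hq' hA
    have hup : ∀ t ∈ N, Function.update f x q' t = f t := fun t ht =>
      Function.update_of_ne (by rintro rfl; exact hx ht) _ _
    refine ⟨Set.mem_insert_of_mem _ hr, fun y u hyu hy => ?_, fun t ht => ?_, fun y u hyu hy => ?_⟩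
    · rcases hy with rfl | hy
      · exact .inr (hxs.parent_unique hyu ▸ hs)
      · exact .inr (hN y u hyu hy)
    · rcases ht with rfl | ht
      · rwa [Function.update_self]
      · rw [hup t ht]
        exact hG t ht
    · rcases hy with rfl | hy
      · obtain rfl := hxs.parent_unique hyu
        rwa [hup s hs, Function.update_self]
      · rw [hup y hy, hup u (hN y u hyu hy)]
        exact hE y u hyu hy
  -- The induction follows the path downwards from the root; that no child of `s` is in `N` keeps
  -- the next node of the path unassigned.
  have path : ∀ s, s ∈ B.subtree B.root → ∀ q ∈ G s, ∃ N f, Good N f ∧ s ∈ N ∧ f s = q ∧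
      ∀ x, B.IsChild x s → x ∉ N := by
    intro s hs
    induction hs using Relation.ReflTransGen.head_induction_on with
    | refl =>
      refine fun q hq => ⟨{B.root}, fun _ => q, ⟨rfl, ?_, ?_, ?_⟩, rfl, rfl, ?_⟩
      · rintro x s hxs rfl
        exact (not_isChild_root s hxs).elim
      · rintro t rfl
        exact hq
      · rintro x s hxs rfl
        exact (not_isChild_root s hxs).elim
      · rintro x hx rfl
        exact not_isChild_root _ hx
    | @head x s hxs _ ih =>
      intro q' hq'
      obtain ⟨q, hq, hA⟩ := hd x s hxs q' hq'
      obtain ⟨N, f, hf, hs, rfl, hch⟩ := ih q hq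
      refine ⟨_, _, extend N f x s q' hf hs (hch x hxs) hxs hq' hA, Set.mem_insert _ _,
        Function.update_self .., fun y hy => ?_⟩
      rintro (rfl | hyN)
      · exact hy.notMem_subtree (mem_subtree_self _)
      · exact hch x hxs (hf.2.1 y x hy hyN)
  obtain ⟨N₀, f₀, hf₀, hs, hfs, -⟩ := path s (mem_subtree_root s) q hq
  have grow : (∃ f, Good Set.univ f ∧ f s = q) ∧ s ∈ Set.univ := by
    refine grow_induction (B := B) (P := fun N => (∃ f, Good N f ∧ f s = q) ∧ s ∈ N)
      ⟨⟨f₀, hf₀, hfs⟩, hs⟩ hf₀.1 ?_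
    rintro N x u ⟨⟨f, hf, hfs⟩, hsN⟩ hu' hx hxu
    obtain ⟨q', hq', hA⟩ := hu x u hxu (f u) (hf.2.2.1 u hu')
    refine ⟨⟨_, extend N f x u q' hf hu' hx hxu hq' hA, ?_⟩, .inr hsN⟩
    rw [Function.update_of_ne, hfs]
    rintro rfl
    exact hx hsN
  obtain ⟨⟨f, ⟨-, -, -, hE⟩, hfs⟩, -⟩ := grow
  refine ⟨f, ⟨fun t => ?_, fun x u hxu => (hE x u hxu trivial).2.2⟩, hfs⟩
  by_cases hts : t = s
  · rwa [hts, hfs]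
  by_cases ht : t = B.root
  · obtain ⟨x, hx, -⟩ := (mem_subtree_cases (mem_subtree_root (B := B) s)).resolve_left
      (fun h => hts (ht.trans h.symm))
    exact ht ▸ (hE x _ hx trivial).1
  · obtain ⟨u, hu⟩ := exists_parent ht
    exact (hE t u hu trivial).2.1

/-- The nodes are enumerated as `node 0`, …, `node (n - 1)`, parents before children. -/
structure IsTopDown (B : RootedTree T) (n : ℕ) (node : ℕ → T) : Prop where
  inj : ∀ i < n, ∀ j < n, node i = node j → i = j
  surj : ∀ t, ∃ i < n, node i = t
  zero : node 0 = B.root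
  lt : ∀ i < n, ∀ j < n, B.IsChild (node i) (node j) → j < i

/-- The state of the bottom-up pass when the nodes with index at least `k` have been treated. -/
def UpInv (B : RootedTree T) (U : T → Q → Prop) (E : T → T → Q → Q → Prop) (n : ℕ) (node : ℕ → T)
    (k : ℕ) (G : T → Set Q) : Prop :=
  (∀ f, B.IsSolution U E f → ∀ t, f t ∈ G t) ∧
    ∀ i < n, k ≤ i → ∀ s, B.IsChild (node i) s → ConsistentUp U E G s (node i)

/-- The state of the top-down pass when the nodes with index less than `k` have been treated. -/
def DownInv (B : RootedTree T) (U : T → Q → Prop) (E : T → T → Q → Q → Prop) (node : ℕ → T)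
    (k : ℕ) (G : T → Set Q) : Prop :=
  (∀ f, B.IsSolution U E f → ∀ t, f t ∈ G t) ∧
    (∀ x s, B.IsChild x s → ConsistentUp U E G s x) ∧
    ∀ i < k, ∀ s, B.IsChild (node i) s → ConsistentDown U E G s (node i)

variable {n : ℕ} {node : ℕ → T} {k : ℕ} {G : T → Set Q}

/-- Only the set at `s` shrinks. This could harm the edge from `s` to its own parent, but `s`
precedes `node k` in the enumeration, so that edge has not been treated yet. -/
theorem UpInv.step [DecidableEq T] (hn : B.IsTopDown n node) (h : UpInv B U E n node (k + 1) G)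
    (hk : k < n) {s : T} (hs : B.IsChild (node k) s) :
    UpInv B U E n node k (reviseUp U E s (node k) G) := by
  have hsub : ∀ t, reviseUp U E s (node k) G t ⊆ G t := by
    intro t
    by_cases ht : t = s
    · subst ht
      rw [reviseUp, Function.update_self]
      exact Set.sep_subset _ _
    · rw [reviseUp, Function.update_of_ne ht]
  refine ⟨fun f hf t => ?_, fun i hi hki u hu q hq => ?_⟩
  · by_cases ht : t = s
    · subst ht
      rw [reviseUp, Function.update_self]
      exact ⟨h.1 f hf t, _, h.1 f hf _, hf.node t, hf.node _, hf.edge _ _ hs⟩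
    · rw [reviseUp, Function.update_of_ne ht]
      exact h.1 f hf t
  · have hne : node i ≠ s := by
      rintro rfl
      have := hn.lt k hk i hi hs
      omega
    rw [reviseUp, Function.update_of_ne hne]
    rcases hki.eq_or_lt with rfl | hki
    · obtain rfl := hs.parent_unique hu
      rw [reviseUp, Function.update_self] at hq
      exact hq.2
    · exact h.2 i hi hki u hu q (hsub u hq)

/-- `node 0` is the root and has no parent, so once the index has come down to 1 all edges have been
treated. -/
theorem UpInv.downInv (hn : B.IsTopDown n node) (h : UpInv B U E n node 1 G) :
    DownInv B U E node 1 G := by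
  have hroot : ∀ i s, B.IsChild (node i) s → i ≠ 0 := by
    rintro i s h rfl
    rw [hn.zero] at h
    exact not_isChild_root s h
  refine ⟨h.1, fun x s hx => ?_, fun i hi s hs => ?_⟩
  · obtain ⟨i, hi, rfl⟩ := hn.surj x
    exact h.2 i hi (Nat.one_le_iff_ne_zero.2 (hroot i s hx)) s hx
  · exact (hroot i s hs (by omega)).elim

/-- Only the set at `node k` shrinks. A value supporting some `q` of the parent is never removed, as
`q` supports it in turn, so upward consistency survives. The edges to the children of `node k` are
treated later. -/
theorem DownInv.step [DecidableEq T] (hn : B.IsTopDown n node) (h : DownInv B U E node k G)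
    (hk : k < n) {s : T} (hs : B.IsChild (node k) s) :
    DownInv B U E node (k + 1) (reviseDown U E s (node k) G) := by
  have hsub : ∀ t, reviseDown U E s (node k) G t ⊆ G t := by
    intro t
    by_cases ht : t = node k
    · subst ht
      rw [reviseDown, Function.update_self]
      exact Set.sep_subset _ _
    · rw [reviseDown, Function.update_of_ne ht]
  refine ⟨fun f hf t => ?_, fun x u hxu q hq => ?_, fun i hi u hu q' hq' => ?_⟩
  · by_cases ht : t = node k
    · subst ht
      rw [reviseDown, Function.update_self]
      exact ⟨h.1 f hf _, _, h.1 f hf s, hf.node s, hf.node _, hf.edge _ _ hs⟩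
    · rw [reviseDown, Function.update_of_ne ht]
      exact h.1 f hf t
  · obtain ⟨q', hq', hA⟩ := h.2.1 x u hxu q (hsub u hq)
    refine ⟨q', ?_, hA⟩
    by_cases hx : x = node k
    · subst hx
      obtain rfl := hs.parent_unique hxu
      rw [reviseDown, Function.update_self]
      exact ⟨hq', q, hsub s hq, hA⟩
    · rwa [reviseDown, Function.update_of_ne hx]
  · have hne : u ≠ node k := by
      rintro rfl
      have := hn.lt i (by omega) k hk hu
      omega
    rw [reviseDown, Function.update_of_ne hne]
    rcases Nat.lt_succ_iff_lt_or_eq.1 hi with hi | rfl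
    · exact h.2.2 i hi u hu q' (hsub _ hq')
    · obtain rfl := hs.parent_unique hu
      rw [reviseDown, Function.update_self] at hq'
      exact hq'.2

/-- The conjunct `U s q` matters only for a tree with a single node; otherwise some arc at `s`
already includes it. -/
theorem DownInv.mem_iff [Finite T] (hn : B.IsTopDown n node) (h : DownInv B U E node n G) {s : T}
    {q : Q} : (q ∈ G s ∧ U s q) ↔ ∃ f, B.IsSolution U E f ∧ f s = q := by
  constructor
  · rintro ⟨hq, hU⟩
    refine exists_isSolution h.2.1 (fun x s hx => ?_) hq hU
    obtain ⟨i, hi, rfl⟩ := hn.surj x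
    exact h.2.2 i hi s hx
  · rintro ⟨f, hf, rfl⟩
    exact ⟨h.1 f hf s, hf.node s⟩

end RootedTree

end PrimeAttr

namespace PrimeAttr.RAM

/-! ### The program

Array `0` holds the input, array `1` the output. Array `2` is a table of the multiples of the
length of the input; the arrays `3` and `4` hold the relations `lh` and `rh` (as matrices), `5` the
parent of each node, `6` and `7` its first and second child, `8` the position of the list of the
elements of its bag in the input, `9` and `10` the numbers of attributes and FDs in its bag, `11` a
list of the nodes, and `12` the set of views that have not been excluded for a node. Register `0`
holds the length of the input and register `2` the root. -/

/-- The array holding the children with the given index. -/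
def childArr (c : Bool) : ℕ := if c then 7 else 6

/-- The number of the element at the position `i` of the bag of the node `s`. -/
def elemAt (σ : State) (s i : ℕ) : ℕ := σ.arr 0 (σ.arr 8 s + i)

def IsAttAt (σ : State) (s i : ℕ) : Prop := i < σ.arr 9 s

def IsFdAt (σ : State) (s i : ℕ) : Prop := ¬ i < σ.arr 9 s ∧ i < σ.arr 9 s + σ.arr 10 s

def IsElemAt (σ : State) (s i : ℕ) : Prop := i < σ.arr 9 s + σ.arr 10 s

/-- Whether the array `k` contains the pair of the elements at the positions `i` and `j` of the
bag of `s`. -/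
def RelatedAt (k : ℕ) (σ : State) (s i j : ℕ) : Prop :=
  IsAttAt σ s i ∧ IsFdAt σ s j ∧ σ.arr k (σ.arr 2 (elemAt σ s i) + elemAt σ s j) ≠ 0

/-- The label of the node with number `s`, as stored in the memory. -/
def storedLabel (K : ℕ) (σ : State) (s : ℕ) : Label K where
  isAtt i := IsAttAt σ s i
  lh i j := RelatedAt 3 σ s i j
  rh i j := RelatedAt 4 σ s i j
  child c := σ.arr (childArr c) s ≠ 0
  root := s = σ.reg 2

/-- Equality of elements of the bags of `s` and `x`. -/
def storedMatches (K : ℕ) (σ : State) (s x : ℕ) (i j : Fin K) : Prop :=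
  IsElemAt σ s i ∧ IsElemAt σ x j ∧ elemAt σ s i = elemAt σ x j

/-- The index of the child `x` of `s`. -/
noncomputable def storedIndex (σ : State) (s x : ℕ) : Bool :=
  @decide (¬ σ.arr 6 s = x + 1) (Classical.dec _)

/-! ### Constant-time tests on the stored structure -/

section Tests

variable {K : ℕ} {s x : State → ℕ}

theorem IsExpr.elemAt (hs : IsExpr s) (i : ℕ) : IsExpr (fun σ => elemAt σ (s σ) i) :=
  .arr 0 (.add (.arr 8 hs) (.lit i))

theorem IsExpr.isAttAt (hs : IsExpr s) (i : ℕ) : IsTest (fun σ => IsAttAt σ (s σ) i) :=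
  IsExpr.lt (.lit i) (.arr 9 hs)

theorem IsExpr.isElemAt (hs : IsExpr s) (i : ℕ) : IsTest (fun σ => IsElemAt σ (s σ) i) :=
  IsExpr.lt (.lit i) (.add (.arr 9 hs) (.arr 10 hs))

theorem IsExpr.relatedAt (hs : IsExpr s) (k i j : ℕ) :
    IsTest (fun σ => RelatedAt k σ (s σ) i j) :=
  (hs.isAttAt i).and (((hs.isAttAt j).not.and (hs.isElemAt j)).and
    (IsExpr.arr k (.add (.arr 2 (hs.elemAt i)) (hs.elemAt j))).ne_zero)

theorem IsExpr.finTest_label (hs : IsExpr s) : FinTest (fun σ => storedLabel K σ (s σ)) := by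
  have h₁ : FinTest fun σ => fun i : Fin K => IsAttAt σ (s σ) i :=
    FinTest.pi fun i => (hs.isAttAt i).finTest
  have h₂ : ∀ k, FinTest fun σ => fun i j : Fin K => RelatedAt k σ (s σ) i j := fun k =>
    FinTest.pi fun i => FinTest.pi fun j => (hs.relatedAt k i j).finTest
  have h₃ : FinTest fun σ => fun c => σ.arr (childArr c) (s σ) ≠ 0 :=
    FinTest.pi fun c => (IsExpr.arr _ hs).ne_zero.finTest
  have h₄ : FinTest fun σ => s σ = σ.reg 2 := (hs.eq (.reg 2)).finTest
  exact (h₁.prod ((h₂ 3).prod ((h₂ 4).prod (h₃.prod h₄)))).comp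
    fun y => (⟨y.1, y.2.1, y.2.2.1, y.2.2.2.1, y.2.2.2.2⟩ : Label K)

theorem IsExpr.finTest_matches (hs : IsExpr s) (hx : IsExpr x) :
    FinTest (fun σ => storedMatches K σ (s σ) (x σ)) :=
  FinTest.pi fun i => FinTest.pi fun j => IsTest.finTest <|
    (hs.isElemAt i).and ((hx.isElemAt j).and ((hs.elemAt i).eq (hx.elemAt j)))

theorem IsExpr.finTest_index (hs : IsExpr s) (hx : IsExpr x) :
    FinTest (fun σ => storedIndex σ (s σ) (x σ)) := by
  have h := (IsExpr.eq (.arr 6 hs) (hx.add (.lit 1))).not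
  rintro (_ | _)
  · exact h.not.congr fun σ => by simp [RAM.storedIndex]
  · exact h.congr fun σ => by simp [RAM.storedIndex]

end Tests

/-! Sets of views are represented by numbers, with `0` for the set of all views. -/

open Classical in
noncomputable def encode {V : Type*} [Finite V] (W : Set V) : ℕ :=
  if W = Set.univ then 0 else Finite.equivFin (Set V) W + 1

-- As 0 denotes the full set, fresh memory means that no view has been excluded. Numbers out of
-- range also denote the full set, so `decode` is eventually constant and finitely many comparisons
-- determine it.
open Classical in
noncomputable def decode {V : Type*} [Finite V] : ℕ → Set V
  | 0 => Set.univ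
  | n + 1 => if h : n < Nat.card (Set V) then (Finite.equivFin (Set V)).symm ⟨n, h⟩ else Set.univ

theorem decode_encode {V : Type*} [Finite V] (W : Set V) : decode (encode W) = W := by
  unfold encode
  split_ifs with h
  · exact h.symm
  · simp [decode]

theorem IsExpr.finTest_decode {V : Type*} [Finite V] {e : State → ℕ} (he : IsExpr e) :
    FinTest (fun σ => (decode (e σ) : Set V)) := by
  intro W
  let M := Nat.card (Set V) + 1
  have hM : ∀ n, M ≤ n → (RAM.decode n : Set V) = Set.univ := by
    rintro (_ | n) hn
    · rfl
    · simp only [RAM.decode]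
      rw [dif_neg (by omega)]
  refine ((IsTest.exists fun k : Fin M =>
    (he.eq (.lit k)).and (IsTest.const (RAM.decode k = W))).or
    ((IsExpr.lt (.lit (Nat.card (Set V))) he).and (IsTest.const (Set.univ = W)))).congr fun σ => ?_
  beta_reduce
  by_cases h : e σ < M
  · constructor
    · rintro (⟨k, hk, h'⟩ | ⟨h', -⟩)
      · rwa [hk]
      · omega
    · exact fun h' => .inl ⟨⟨e σ, h⟩, rfl, h'⟩
  · rw [hM _ (not_lt.1 h)]
    constructor
    · rintro (⟨k, hk, h'⟩ | ⟨-, h'⟩)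
      · exact (h (hk ▸ k.2)).elim
      · exact h'
    · exact fun h' => .inr ⟨by omega, h'⟩

/-- The views that have not been excluded for the node with number `s`. -/
noncomputable def candidates (K : ℕ) (σ : State) (s : ℕ) : Set (View K) := decode (σ.arr 12 s)

/-- The constraints on the views at a node and its child, in terms of the stored data. -/
def StoredArc {K : ℕ} (σ : State) (s x : ℕ) (q q' : View K) : Prop :=
  q.Ok (storedLabel K σ s) ∧ q'.Ok (storedLabel K σ x) ∧
    q.Compat (storedIndex σ s x) (storedMatches K σ s x) q'

/-- Everything about the node with number `s` and its child `x` the constraints depend on. -/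
theorem IsExpr.finTest_edge {K : ℕ} {s x : State → ℕ} (hs : IsExpr s) (hx : IsExpr x) :
    FinTest fun σ => (storedLabel K σ (s σ), storedLabel K σ (x σ), storedIndex σ (s σ) (x σ),
      storedMatches K σ (s σ) (x σ), candidates K σ (s σ), candidates K σ (x σ)) :=
  hs.finTest_label.prod (hx.finTest_label.prod ((hs.finTest_index hx).prod
    ((hs.finTest_matches hx).prod ((IsExpr.arr 12 hs).finTest_decode.prod (IsExpr.arr 12 hx).finTest_decode))))

/-- Store the set `v` of views for the node whose number is in the register `r`. -/
noncomputable def store {K : ℕ} (r : ℕ) (v : State → Set (View K)) : State → State :=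
  putA 12 (fun σ => σ.reg r) fun σ => encode (v σ)

theorem ConstTime.store {K : ℕ} (r : ℕ) {v : State → Set (View K)} (hv : FinTest v) :
    ConstTime (store r v) :=
  ConstTime.switch hv (g := fun W => RAM.putA 12 (fun σ => σ.reg r) fun _ => encode W)
    fun _ => ConstTime.putA 12 (.reg r) (.lit _)

/-- The tables of multiples. -/
def mulBody : State → State :=
  setR 1 (fun σ => σ.reg 1 + 1) ∘
    putA 2 (fun σ => σ.reg 1 + 1) (fun σ => σ.arr 2 (σ.reg 1) + σ.reg 0)

theorem constTime_mulBody : ConstTime mulBody :=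
  (ConstTime.setR 1 (.add (.reg 1) (.lit 1))).comp
    (.putA 2 (.add (.reg 1) (.lit 1)) (.add (.arr 2 (.reg 1)) (.reg 0)))

/-- The number of the input at distance `i` from the current position. -/
def look (i : ℕ) (σ : State) : ℕ := σ.arr 0 (σ.reg 1 + i)

theorem IsExpr.look (i : ℕ) : IsExpr (look i) := .arr 0 (.add (.reg 1) (.lit i))

def skip (n : ℕ) : State → State := setR 1 fun σ => σ.reg 1 + n

theorem ConstTime.skip (n : ℕ) : ConstTime (skip n) := .setR 1 (.add (.reg 1) (.lit n))

def readPair (k : ℕ) : State → State :=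
  skip 3 ∘ putA k (fun σ => σ.arr 2 (look 1 σ) + look 2 σ) (fun _ => 1)

theorem ConstTime.readPair (k : ℕ) : ConstTime (readPair k) :=
  (ConstTime.skip 3).comp (.putA k (.add (.arr 2 (.look 1)) (.look 2)) (.lit 1))

def readRoot : State → State := skip 2 ∘ setR 2 (look 1)

theorem ConstTime.readRoot : ConstTime readRoot :=
  (ConstTime.skip 2).comp (.setR 2 (.look 1))

/-- Numbers of nodes are stored increased by one, which leaves 0 to mean that there is no child or
no parent. -/
def readChild (c : Bool) : State → State :=
  skip 3 ∘ putA 5 (look 1) (fun σ => look 2 σ + 1) ∘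
    putA (childArr c) (look 2) (fun σ => look 1 σ + 1)

theorem ConstTime.readChild (c : Bool) : ConstTime (readChild c) :=
  (ConstTime.skip 3).comp ((ConstTime.putA 5 (.look 1) (.add (.look 2) (.lit 1))).comp
    (.putA _ (.look 2) (.add (.look 1) (.lit 1))))

def readBag : State → State :=
  setR 1 (fun σ => σ.reg 1 + 4 + look 2 σ + look 3 σ) ∘ putA 8 (look 1) (fun σ => σ.reg 1 + 4) ∘
    putA 9 (look 1) (look 2) ∘ putA 10 (look 1) (look 3)

theorem ConstTime.readBag : ConstTime readBag :=
  (ConstTime.setR 1 (.add (.add (.add (.reg 1) (.lit 4)) (.look 2)) (.look 3))).comp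
    ((ConstTime.putA 8 (.look 1) (.add (.reg 1) (.lit 4))).comp
      ((ConstTime.putA 9 (.look 1) (.look 2)).comp (.putA 10 (.look 1) (.look 3))))

/-- Read an atom. -/
noncomputable def readBody : State → State :=
  branch (fun σ => look 0 σ = 2) (readPair 3) <|
  branch (fun σ => look 0 σ = 3) (readPair 4) <|
  branch (fun σ => look 0 σ = 4) readRoot <|
  branch (fun σ => look 0 σ = 6) (readChild false) <|
  branch (fun σ => look 0 σ = 7) (readChild true) <|
  branch (fun σ => look 0 σ = 8) readBag (skip 2)

theorem constTime_readBody : ConstTime readBody := by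
  have h : ∀ n, IsTest fun σ => look 0 σ = n := fun n => IsExpr.eq (.look 0) (.lit n)
  exact (ConstTime.readPair 3).branch (h 2) <| (ConstTime.readPair 4).branch (h 3) <|
    ConstTime.readRoot.branch (h 4) <| (ConstTime.readChild false).branch (h 6) <|
    (ConstTime.readChild true).branch (h 7) <| ConstTime.readBag.branch (h 8) (.skip 2)

/-- Append the child with index `c` of the node in register `5` to the list of nodes. -/
noncomputable def pushChild (c : Bool) : State → State :=
  branch (fun σ => σ.arr (childArr c) (σ.reg 5) ≠ 0)
    (setR 4 (fun σ => σ.reg 4 + 1) ∘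
      putA 11 (fun σ => σ.reg 4) (fun σ => σ.arr (childArr c) (σ.reg 5) - 1)) id

theorem ConstTime.pushChild (c : Bool) : ConstTime (pushChild c) :=
  .branch (IsExpr.arr _ (.reg 5)).ne_zero
    ((ConstTime.setR 4 (.add (.reg 4) (.lit 1))).comp
      (.putA 11 (.reg 4) (.sub (.arr _ (.reg 5)) (.lit 1)))) .id

/-- Load the node with index in register `3` into register `5`. -/
def loadNode : State → State := setR 5 fun σ => σ.arr 11 (σ.reg 3)

theorem ConstTime.loadNode : ConstTime loadNode := .setR 5 (.arr 11 (.reg 3))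

def nextNode : State → State := setR 3 fun σ => σ.reg 3 + 1

theorem ConstTime.nextNode : ConstTime nextNode := .setR 3 (.add (.reg 3) (.lit 1))

noncomputable def bfsBody : State → State :=
  nextNode ∘ pushChild true ∘ pushChild false ∘ loadNode

theorem constTime_bfsBody : ConstTime bfsBody :=
  ConstTime.nextNode.comp ((ConstTime.pushChild true).comp
    ((ConstTime.pushChild false).comp .loadNode))

/-- Load the parent of the node in register `5` into register `6`. -/
def loadParent : State → State := setR 6 fun σ => σ.arr 5 (σ.reg 5) - 1

theorem ConstTime.loadParent : ConstTime loadParent :=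
  .setR 6 (.sub (.arr 5 (.reg 5)) (.lit 1))

noncomputable def reviseUpOp (K : ℕ) : State → State :=
  store 6 fun σ => {q ∈ candidates K σ (σ.reg 6) | ∃ q' ∈ candidates K σ (σ.reg 5),
    StoredArc σ (σ.reg 6) (σ.reg 5) q q'}

/-- The new set is a function of finitely-valued data about the two nodes, so it is selected by a
fixed case distinction. -/
theorem ConstTime.reviseUpOp (K : ℕ) : ConstTime (reviseUpOp K) :=
  .store 6 <| ((IsExpr.reg 6).finTest_edge (.reg 5)).comp fun y => {q ∈ y.2.2.2.2.1 | ∃ q' ∈ y.2.2.2.2.2,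
    q.Ok y.1 ∧ q'.Ok y.2.1 ∧ q.Compat y.2.2.1 y.2.2.2.1 q'}

noncomputable def reviseDownOp (K : ℕ) : State → State :=
  store 5 fun σ => {q' ∈ candidates K σ (σ.reg 5) | ∃ q ∈ candidates K σ (σ.reg 6),
    StoredArc σ (σ.reg 6) (σ.reg 5) q q'}

theorem ConstTime.reviseDownOp (K : ℕ) : ConstTime (reviseDownOp K) :=
  .store 5 <| ((IsExpr.reg 6).finTest_edge (.reg 5)).comp fun y => {q' ∈ y.2.2.2.2.2 | ∃ q ∈ y.2.2.2.2.1,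
    q.Ok y.1 ∧ q'.Ok y.2.1 ∧ q.Compat y.2.2.1 y.2.2.2.1 q'}

def previousNode : State → State := setR 3 fun σ => σ.reg 3 - 1

theorem ConstTime.previousNode : ConstTime previousNode := .setR 3 (.sub (.reg 3) (.lit 1))

noncomputable def upBody (K : ℕ) : State → State :=
  previousNode ∘ reviseUpOp K ∘ loadParent ∘ loadNode

theorem constTime_upBody (K : ℕ) : ConstTime (upBody K) :=
  ConstTime.previousNode.comp ((ConstTime.reviseUpOp K).comp
    (ConstTime.loadParent.comp .loadNode))

noncomputable def downBody (K : ℕ) : State → State :=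
  nextNode ∘ reviseDownOp K ∘ loadParent ∘ loadNode

theorem constTime_downBody (K : ℕ) : ConstTime (downBody K) :=
  ConstTime.nextNode.comp ((ConstTime.reviseDownOp K).comp
    (ConstTime.loadParent.comp .loadNode))

/-- The positions of the attributes marked in one of the remaining views. -/
def markedPositions (K : ℕ) (σ : State) (s : ℕ) : Set (Fin K) :=
  {i | ∃ q ∈ candidates K σ s, q.Ok (storedLabel K σ s) ∧ q.Marks i}

/-- Output the elements at the positions in `W` of the bag of the node in register `5`. -/
noncomputable def writePositions {K : ℕ} (W : Set (Fin K)) (σ : State) : State :=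
  (Set.toFinite W).toFinset.toList.foldl
    (fun τ (i : Fin K) => putA 1 (fun τ => elemAt τ (τ.reg 5) i) (fun _ => 1) τ) σ

theorem ConstTime.writePositions {K : ℕ} (W : Set (Fin K)) : ConstTime (writePositions W) := by
  have h := ConstTime.foldl
    (fun i : Fin K => ConstTime.putA 1 (IsExpr.elemAt (.reg 5) i) (.lit 1))
    (Set.toFinite W).toFinset.toList
  unfold RAM.writePositions
  exact h

noncomputable def writeBody (K : ℕ) : State → State :=
  nextNode ∘ (fun σ => writePositions (markedPositions K σ (σ.reg 5)) σ) ∘ loadNode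

theorem constTime_writeBody (K : ℕ) : ConstTime (writeBody K) := by
  refine ConstTime.nextNode.comp (ConstTime.comp (ConstTime.switch ?_ .writePositions) .loadNode)
  exact ((IsExpr.finTest_label (.reg 5)).prod (IsExpr.arr 12 (.reg 5)).finTest_decode).comp fun y =>
    {i : Fin K | ∃ q ∈ y.2, View.Ok y.1 q ∧ View.Marks q i}

/-- The result of executing `f` as long as `P` holds, if this takes at most `n` iterations. -/
def LoopRel (P : State → Prop) (f : State → State) (n : ℕ) (σ τ : State) : Prop :=
  ∃ k ≤ n, (∀ i < k, P (f^[i] σ)) ∧ ¬ P (f^[k] σ) ∧ τ = f^[k] σ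

/-- The memory before and after the whole computation, together with the intermediate states. -/
def Computes (K n : ℕ) (σ τ : State) : Prop :=
  ∃ σ₁, LoopRel (fun σ => σ.reg 1 < σ.reg 0) mulBody n σ σ₁ ∧
  ∃ σ₂, LoopRel (fun σ => σ.reg 1 < σ.reg 0) readBody n (setR 1 (fun _ => 0) σ₁) σ₂ ∧
  ∃ σ₃, LoopRel (fun σ => σ.reg 3 < σ.reg 4) bfsBody n
    (setR 4 (fun _ => 1) (putA 11 (fun _ => 0) (fun σ => σ.reg 2) σ₂)) σ₃ ∧
  -- After the search, register 3 equals the number of nodes, hence the decrement to the last index.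
  -- Index 0 is left out in both passes, as the root has no parent.
  ∃ σ₄, LoopRel (fun σ => σ.reg 3 ≠ 0) (upBody K) n (previousNode σ₃) σ₄ ∧
  ∃ σ₅, LoopRel (fun σ => σ.reg 3 < σ.reg 4) (downBody K) n (setR 3 (fun _ => 1) σ₄) σ₅ ∧
  LoopRel (fun σ => σ.reg 3 < σ.reg 4) (writeBody K) n (setR 3 (fun _ => 0) σ₅) τ

theorem linear_computes (K : ℕ) : Linear (Computes K) := by
  have hlt : ∀ r r', IsTest fun σ => σ.reg r < σ.reg r' := fun r r' => IsExpr.lt (.reg r) (.reg r')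
  have pre : ∀ {P f g}, IsTest P → ConstTime f → ConstTime g →
      Linear fun n σ τ => LoopRel P f n (g σ) τ := by
    intro P f g hP hf hg
    obtain ⟨p, c, h⟩ := hg.linear.comp (Linear.loop hP hf)
    exact ⟨p, c, fun n σ τ hR => h n σ τ ⟨_, rfl, hR⟩⟩
  exact (Linear.loop (hlt 1 0) constTime_mulBody).comp <|
    (pre (hlt 1 0) constTime_readBody (.setR 1 (.lit 0))).comp <|
    (pre (hlt 3 4) constTime_bfsBody
      ((ConstTime.setR 4 (.lit 1)).comp (.putA 11 (.lit 0) (.reg 2)))).comp <|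
    (pre (IsExpr.reg 3).ne_zero (constTime_upBody K) .previousNode).comp <|
    (pre (hlt 3 4) (constTime_downBody K) (.setR 3 (.lit 1))).comp <|
    pre (hlt 3 4) (constTime_writeBody K) (.setR 3 (.lit 0))

end PrimeAttr.RAM

namespace PrimeAttr.RAM

/-! ### Reading the input -/

@[simp]
theorem setR_reg (r : ℕ) (e : State → ℕ) (σ : State) (r' : ℕ) :
    (setR r e σ).reg r' = if r' = r then e σ else σ.reg r' := setReg_reg ..

@[simp]
theorem setR_arr (r : ℕ) (e : State → ℕ) (σ : State) : (setR r e σ).arr = σ.arr := rfl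

@[simp]
theorem putA_reg (k : ℕ) (i e : State → ℕ) (σ : State) : (putA k i e σ).reg = σ.reg := rfl

@[simp]
theorem putA_arr (k : ℕ) (i e : State → ℕ) (σ : State) (k' i' : ℕ) :
    (putA k i e σ).arr k' i' = if k' = k ∧ i' = i σ then e σ else σ.arr k' i' := putArr_arr ..

@[simp]
theorem look_putA {k : ℕ} (hk : k ≠ 0) (a e : State → ℕ) (i : ℕ) (σ : State) :
    look i (putA k a e σ) = look i σ := by
  simp [look, hk.symm]

@[simp]
theorem elemAt_putA {k : ℕ} (hk : k ≠ 0) (hk' : k ≠ 8) (a e : State → ℕ) (σ : State) (s i : ℕ) :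
    elemAt (putA k a e σ) s i = elemAt σ s i := by
  simp [elemAt, hk.symm, hk'.symm]

theorem iterate_mulBody (u : List ℕ) (k : ℕ) :
    (mulBody^[k] (init u)).reg 1 = k ∧
    (∀ r, r ≠ 1 → (mulBody^[k] (init u)).reg r = (init u).reg r) ∧
    (∀ i ≤ k, (mulBody^[k] (init u)).arr 2 i = i * u.length) ∧
    ∀ a, a ≠ 2 → ∀ i, (mulBody^[k] (init u)).arr a i = (init u).arr a i := by
  induction k with
  | zero => simp [init]
  | succ k ih =>
    rw [Function.iterate_succ_apply']
    generalize mulBody^[k] (init u) = σ at ih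
    obtain ⟨h₁, h₂, h₃, h₄⟩ := ih
    refine ⟨by simp [mulBody, h₁], fun r hr => by simp [mulBody, hr, h₂], fun i hi => ?_,
      fun a ha i => by simp [mulBody, ha, h₄]⟩
    have h₀ : σ.reg 0 = u.length := by rw [h₂ 0 (by simp)]; rfl
    rcases Nat.le_succ_iff_eq_or_le.1 hi with rfl | hi
    · simp [mulBody, h₁, h₃ k le_rfl, h₀, Nat.succ_mul]
    · have : i ≠ k + 1 := by omega
      simp [mulBody, h₁, this, h₃ i hi]

variable {A F T : Type*} {S : RelSchema A F}

/-- The number of an element of a bag. -/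
def elemCode (num : A ⊕ F ⊕ T → ℕ) : A ⊕ F → ℕ := Sum.elim (num ∘ .inl) (num ∘ .inr ∘ .inl)

/-- The elements of a bag. -/
def bagList (as : List A) (fs : List F) : List (A ⊕ F) := as.map .inl ++ fs.map .inr

/-- The memory after the atoms in `P` have been read. -/
structure Reading [DecidableEq A] [DecidableEq F] (D : TreeDecomposition S T)
    (num : A ⊕ F ⊕ T → ℕ) (n : ℕ) (P : Set (Atom A F T)) (σ : State) : Prop where
  holds : ∀ x ∈ P, D.Holds x
  mul : ∀ i ≤ n, σ.arr 2 i = i * n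
  lh : ∀ b f, σ.arr 3 (num (.inl b) * n + num (.inr (.inl f))) ≠ 0 ↔ .lh b f ∈ P
  rh : ∀ b f, σ.arr 4 (num (.inl b) * n + num (.inr (.inl f))) ≠ 0 ↔ .rh b f ∈ P
  root : ∀ s, .root s ∈ P → σ.reg 2 = num (.inr (.inr s))
  child₁ : ∀ x s, .child₁ x s ∈ P → σ.arr 6 (num (.inr (.inr s))) = num (.inr (.inr x)) + 1
  child₂ : ∀ x s, .child₂ x s ∈ P → σ.arr 7 (num (.inr (.inr s))) = num (.inr (.inr x)) + 1
  of_child₁ : ∀ s, σ.arr 6 (num (.inr (.inr s))) ≠ 0 → ∃ x, .child₁ x s ∈ P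
  of_child₂ : ∀ s, σ.arr 7 (num (.inr (.inr s))) ≠ 0 → ∃ x, .child₂ x s ∈ P
  parent : ∀ x s, .child₁ x s ∈ P ∨ .child₂ x s ∈ P →
    σ.arr 5 (num (.inr (.inr x))) = num (.inr (.inr s)) + 1
  bag : ∀ s B C, .bag s B C ∈ P → ∃ (as : List A) (fs : List F), as.Nodup ∧ as.toFinset = B ∧
    fs.Nodup ∧ fs.toFinset = C ∧ σ.arr 9 (num (.inr (.inr s))) = as.length ∧
    σ.arr 10 (num (.inr (.inr s))) = fs.length ∧
    ∀ i e, (bagList as fs)[i]? = some e → elemAt σ (num (.inr (.inr s))) i = elemCode num e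
  clean : σ.reg 3 = 0 ∧ (∀ i, σ.arr 1 i = 0) ∧ ∀ i, σ.arr 12 i = 0

variable [DecidableEq A] [DecidableEq F] {D : TreeDecomposition S T} {num : A ⊕ F ⊕ T → ℕ} {n : ℕ}
  {P : Set (Atom A F T)} {σ : State}

theorem Reading.skip (h : Reading D num n P σ) (k : ℕ) : Reading D num n P (skip k σ) := by
  exact ⟨h.holds, h.mul, h.lh, h.rh, by simpa [RAM.skip] using h.root, h.child₁, h.child₂,
    h.of_child₁, h.of_child₂, h.parent, h.bag, by simpa [RAM.skip] using h.clean⟩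

theorem pair_eq_iff {a b a' b' : ℕ} (hb : b < n) (hb' : b' < n) :
    a * n + b = a' * n + b' ↔ a = a' ∧ b = b' := by
  constructor
  · intro h
    have h₁ : b = b' := by
      have := congrArg (· % n) h
      simpa [Nat.mul_add_mod_self_right, Nat.mod_eq_of_lt hb, Nat.mod_eq_of_lt hb'] using this
    subst h₁
    exact ⟨Nat.eq_of_mul_eq_mul_right (by omega) (Nat.add_right_cancel h), rfl⟩
  · rintro ⟨rfl, rfl⟩
    rfl

/-- Injectivity of `num` keeps the records of other elements intact. Where a cell is overwritten,
uniqueness of the root, of children and parents, and of the bag of a node shows that the new record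
is also right for the atoms read before; this is why `Reading` includes `holds`. -/
theorem Reading.insert (h : Reading D num n P σ) (hnum : Function.Injective num)
    (hlt : ∀ y, num y < n) {x : Atom A F T} (hx : D.Holds x) {v : List ℕ} (hw : x.Written num v)
    (hv : ∀ i w, v[i]? = some w → look i σ = w) :
    Reading D num n (insert x P) (readBody σ) ∧ (readBody σ).reg 1 = σ.reg 1 + v.length ∧
      (readBody σ).reg 0 = σ.reg 0 ∧ ∀ i, (readBody σ).arr 0 i = σ.arr 0 i := by
  have hholds : ∀ y ∈ Insert.insert x P, D.Holds y := by
    rintro y (rfl | hy)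
    · exact hx
    · exact h.holds y hy
  have inj : ∀ {y z}, num y = num z ↔ y = z := hnum.eq_iff
  unfold readBody
  cases x with
  | att a =>
    obtain rfl := hw
    have h₀ := hv 0 _ rfl
    simp only [branch, h₀]
    refine ⟨Reading.skip ?_ 2, by simp [RAM.skip], by simp [RAM.skip], fun _ => rfl⟩
    exact ⟨hholds, h.mul, by simpa using h.lh, by simpa using h.rh, by simpa using h.root,
      by simpa using h.child₁, by simpa using h.child₂, by simpa using h.of_child₁,
      by simpa using h.of_child₂, by simpa using h.parent, by simpa using h.bag, h.clean⟩
  | fd f =>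
    obtain rfl := hw
    have h₀ := hv 0 _ rfl
    simp only [branch, h₀]
    refine ⟨Reading.skip ?_ 2, by simp [RAM.skip], by simp [RAM.skip], fun _ => rfl⟩
    exact ⟨hholds, h.mul, by simpa using h.lh, by simpa using h.rh, by simpa using h.root,
      by simpa using h.child₁, by simpa using h.child₂, by simpa using h.of_child₁,
      by simpa using h.of_child₂, by simpa using h.parent, by simpa using h.bag, h.clean⟩
  | leaf s =>
    obtain rfl := hw
    have h₀ := hv 0 _ rfl
    simp only [branch, h₀]
    refine ⟨Reading.skip ?_ 2, by simp [RAM.skip], by simp [RAM.skip], fun _ => rfl⟩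
    exact ⟨hholds, h.mul, by simpa using h.lh, by simpa using h.rh, by simpa using h.root,
      by simpa using h.child₁, by simpa using h.child₂, by simpa using h.of_child₁,
      by simpa using h.of_child₂, by simpa using h.parent, by simpa using h.bag, h.clean⟩
  | lh b f =>
    obtain rfl := hw
    have h₀ := hv 0 _ rfl
    have h₁ := hv 1 _ rfl
    have h₂ := hv 2 _ rfl
    simp only [branch, h₀]
    refine ⟨Reading.skip ?_ 3, by simp [RAM.skip, readPair], by simp [RAM.skip, readPair],
      fun _ => by simp [RAM.skip, readPair]⟩
    refine ⟨hholds, by simpa using h.mul, fun b' f' => ?_, by simpa using h.rh,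
      by simpa using h.root, by simpa using h.child₁, by simpa using h.child₂,
      by simpa using h.of_child₁, by simpa using h.of_child₂, by simpa using h.parent,
      by simpa [elemAt] using h.bag, by simpa using h.clean⟩
    have := h.lh b' f'
    simp only [putA_arr, h₁, h₂, h.mul _ (hlt _).le, pair_eq_iff (hlt _) (hlt _), inj, true_and,
      Set.mem_insert_iff, Atom.lh.injEq, Sum.inl.injEq, Sum.inr.injEq]
    split_ifs with h' <;> simp [h', this]
  | rh b f =>
    obtain rfl := hw
    have h₀ := hv 0 _ rfl
    have h₁ := hv 1 _ rfl
    have h₂ := hv 2 _ rfl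
    simp only [branch, h₀]
    refine ⟨Reading.skip ?_ 3, by simp [RAM.skip, readPair], by simp [RAM.skip, readPair],
      fun _ => by simp [RAM.skip, readPair]⟩
    refine ⟨hholds, by simpa using h.mul, by simpa using h.lh, fun b' f' => ?_,
      by simpa using h.root, by simpa using h.child₁, by simpa using h.child₂,
      by simpa using h.of_child₁, by simpa using h.of_child₂, by simpa using h.parent,
      by simpa [elemAt] using h.bag, by simpa using h.clean⟩
    have := h.rh b' f'
    simp only [putA_arr, h₁, h₂, h.mul _ (hlt _).le, pair_eq_iff (hlt _) (hlt _), inj, true_and,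
      Set.mem_insert_iff, Atom.rh.injEq, Sum.inl.injEq, Sum.inr.injEq]
    split_ifs with h' <;> simp [h', this]
  | root s =>
    obtain rfl := hw
    have h₀ := hv 0 _ rfl
    have h₁ := hv 1 _ rfl
    simp only [branch, h₀]
    refine ⟨Reading.skip ?_ 2, by simp [RAM.skip, readRoot], by simp [RAM.skip, readRoot],
      fun _ => by simp [RAM.skip, readRoot]⟩
    refine ⟨hholds, by simpa using h.mul, by simpa using h.lh, by simpa using h.rh,
      fun s' hs' => ?_, by simpa using h.child₁, by simpa using h.child₂,
      by simpa using h.of_child₁, by simpa using h.of_child₂, by simpa using h.parent,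
      by simpa [elemAt] using h.bag, by simpa using h.clean⟩
    obtain rfl : s = s' := Eq.trans hx (hholds _ hs').symm
    simpa using h₁
  | child₁ x s =>
    obtain rfl := hw
    have h₀ := hv 0 _ rfl
    have h₁ := hv 1 _ rfl
    have h₂ := hv 2 _ rfl
    simp only [branch, h₀]
    refine ⟨Reading.skip ?_ 3, by simp [RAM.skip, readChild], by simp [RAM.skip, readChild],
      fun _ => by simp [RAM.skip, readChild, childArr]⟩
    refine ⟨hholds, by simpa [childArr] using h.mul, by simpa [childArr] using h.lh,
      by simpa [childArr] using h.rh, by simpa [childArr] using h.root, fun x' s' hs' => ?_,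
      by simpa [childArr] using h.child₂, fun s' hs' => ?_, by simpa [childArr] using h.of_child₂,
      fun x' s' hs' => ?_, by simpa [elemAt, childArr] using h.bag,
      by simpa [childArr] using h.clean⟩
    · by_cases hs : s' = s
      · subst hs
        obtain rfl : x' = x := D.child₁_unique (hholds _ hs') hx
        simp [childArr, h₁, h₂]
      · have := h.child₁ x' s' (by simpa [hs] using hs')
        simpa [childArr, h₂, inj, hs] using this
    · by_cases hs : s' = s
      · exact ⟨x, by simp [hs]⟩
      · obtain ⟨x', hx'⟩ := h.of_child₁ s' (by simpa [childArr, h₂, inj, hs] using hs')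
        exact ⟨x', .inr hx'⟩
    · by_cases hx' : x' = x
      · subst hx'
        obtain rfl : s = s' := D.parent_unique (.inl hx) (hs'.imp (hholds _) (hholds _))
        simp [childArr, h₁, h₂]
      · have := h.parent x' s' (by simpa [hx'] using hs')
        simpa [childArr, h₁, inj, hx'] using this
  | child₂ x s =>
    obtain rfl := hw
    have h₀ := hv 0 _ rfl
    have h₁ := hv 1 _ rfl
    have h₂ := hv 2 _ rfl
    simp only [branch, h₀]
    refine ⟨Reading.skip ?_ 3, by simp [RAM.skip, readChild], by simp [RAM.skip, readChild],
      fun _ => by simp [RAM.skip, readChild, childArr]⟩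
    refine ⟨hholds, by simpa [childArr] using h.mul, by simpa [childArr] using h.lh,
      by simpa [childArr] using h.rh, by simpa [childArr] using h.root,
      by simpa [childArr] using h.child₁, fun x' s' hs' => ?_, by simpa [childArr] using h.of_child₁,
      fun s' hs' => ?_, fun x' s' hs' => ?_, by simpa [elemAt, childArr] using h.bag,
      by simpa [childArr] using h.clean⟩
    · by_cases hs : s' = s
      · subst hs
        obtain rfl : x' = x := D.child₂_unique (hholds _ hs') hx
        simp [childArr, h₁, h₂]
      · have := h.child₂ x' s' (by simpa [hs] using hs')
        simpa [childArr, h₂, inj, hs] using this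
    · by_cases hs : s' = s
      · exact ⟨x, by simp [hs]⟩
      · obtain ⟨x', hx'⟩ := h.of_child₂ s' (by simpa [childArr, h₂, inj, hs] using hs')
        exact ⟨x', .inr hx'⟩
    · by_cases hx' : x' = x
      · subst hx'
        obtain rfl : s = s' := D.parent_unique (.inr hx) (hs'.imp (hholds _) (hholds _))
        simp [childArr, h₁, h₂]
      · have := h.parent x' s' (by simpa [hx'] using hs')
        simpa [childArr, h₁, inj, hx'] using this
  | bag s B C =>
    obtain ⟨as, fs, has, hB, hfs, hC, rfl⟩ := hw
    have h₀ := hv 0 _ rfl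
    have h₁ := hv 1 _ rfl
    have h₂ := hv 2 _ rfl
    have h₃ := hv 3 _ rfl
    have hl : ∀ i e, (bagList as fs)[i]? = some e →
        σ.arr 0 (σ.reg 1 + 4 + i) = elemCode num e := by
      intro i e he
      -- The elements follow a header of four numbers: the predicate, the node, and the two
      -- cardinalities.
      have := hv (4 + i) (elemCode num e) (by
        have hm : as.map (fun a => num (.inl a)) ++ fs.map (fun f => num (.inr (.inl f))) =
            (bagList as fs).map (elemCode num) := by
          simp [bagList, elemCode, Function.comp_def]
        rw [List.append_assoc, hm, List.getElem?_append_right (by simp)]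
        simp [he])
      rwa [look, ← add_assoc] at this
    simp only [branch, h₀]
    refine ⟨?_, ?_, ?_, fun i => ?_⟩
    · refine ⟨hholds, by simpa [readBag] using h.mul, by simpa [readBag] using h.lh,
        by simpa [readBag] using h.rh, by simpa [readBag] using h.root,
        by simpa [readBag] using h.child₁, by simpa [readBag] using h.child₂,
        by simpa [readBag] using h.of_child₁, by simpa [readBag] using h.of_child₂,
        by simpa [readBag] using h.parent, fun s' B' C' hs' => ?_,
        by simpa [readBag] using h.clean⟩
      by_cases hs : s' = s
      · subst hs
        obtain ⟨rfl, rfl⟩ : B' = B ∧ C' = C :=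
          ⟨(hholds _ hs').1.trans hx.1.symm, (hholds _ hs').2.trans hx.2.symm⟩
        refine ⟨as, fs, has, hB, hfs, hC, ?_, ?_, fun i e he => ?_⟩
        · simp [readBag, h₁, h₂]
        · simp [readBag, h₁, h₃]
        · rw [← hl i e he]
          simp [readBag, elemAt, h₁]
      · obtain ⟨as', fs', h₄, h₅, h₆, h₇, h₈, h₉, h₁₀⟩ := h.bag s' B' C' (by simpa [hs] using hs')
        refine ⟨as', fs', h₄, h₅, h₆, h₇, ?_, ?_, fun i e he => ?_⟩
        · simpa [readBag, h₁, inj, hs] using h₈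
        · simpa [readBag, h₁, inj, hs] using h₉
        · rw [← h₁₀ i e he]
          simp [readBag, elemAt, h₁, inj, hs]
    · simp [readBag, h₂, h₃]
      omega
    · simp [readBag]
    · simp [readBag]

end PrimeAttr.RAM

/-! ### The stored structure after all atoms have been read -/

namespace PrimeAttr.RAM

open PrimeAttr.RootedTree

variable {A F T : Type*} {S : RelSchema A F}
  {D : TreeDecomposition S T} {num : A ⊕ F ⊕ T → ℕ} {n K : ℕ}

theorem written_length_pos [DecidableEq A] [DecidableEq F] {x : Atom A F T} {v : List ℕ}
    (h : x.Written num v) : 0 < v.length := by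
  cases x <;> simp only [Atom.Written] at h
  case bag => obtain ⟨as, fs, -, -, -, -, rfl⟩ := h; simp
  all_goals subst h; simp

/-- Every written atom is nonempty, so the reading position stays inside the input until the last
atom has been read and is at its end afterwards. -/
theorem Reading.iterate [DecidableEq A] [DecidableEq F]
    (hnum : Function.Injective num) (hlt : ∀ y, num y < n)
    {atoms : List (Atom A F T)} {parts : List (List ℕ)}
    (hw : List.Forall₂ (fun x v => x.Written num v) atoms parts) (hx : ∀ x ∈ atoms, D.Holds x)
    {P : Set (Atom A F T)} {σ : State} (h : Reading D num n P σ)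
    (hv : ∀ i w, parts.flatten[i]? = some w → look i σ = w)
    (hl : σ.reg 0 = σ.reg 1 + parts.flatten.length) :
    (∀ i < atoms.length, (readBody^[i] σ).reg 1 < (readBody^[i] σ).reg 0) ∧
      ¬ (readBody^[atoms.length] σ).reg 1 < (readBody^[atoms.length] σ).reg 0 ∧
      Reading D num n (P ∪ {x | x ∈ atoms}) (readBody^[atoms.length] σ) := by
  induction hw generalizing P σ with
  | nil => simpa [hl] using h
  | @cons x v atoms parts hxv _ ih =>
    simp only [List.flatten_cons, List.length_append] at hl hv
    have hpos := written_length_pos hxv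
    obtain ⟨h₁, h₂, h₃, h₄⟩ := h.insert hnum hlt (hx x (by simp)) hxv fun i w hi => hv i w (by
      rw [List.getElem?_append_left, hi]
      exact (List.getElem?_eq_some_iff.1 hi).1)
    obtain ⟨h₅, h₆, h₇⟩ := ih (fun y hy => hx y (by simp [hy])) h₁ (fun i w hi => by
      rw [← hv (v.length + i) w (by
        rw [List.getElem?_append_right (by omega)]
        simpa using hi)]
      simp [look, h₂, h₄, add_assoc]) (by omega)
    refine ⟨fun i hi => ?_, h₆, ?_⟩
    · cases i with
      | zero =>
        simp only [Function.iterate_zero, id_eq]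
        omega
      | succ i => exact h₅ i (by simpa using hi)
    · have hP : P ∪ {y | y ∈ x :: atoms} = Insert.insert x P ∪ {y | y ∈ atoms} := by
        ext y
        simp [or_assoc, or_left_comm]
      rw [hP]
      exact h₇

/-- The memory holds the structure that represents the schema and the decomposition, with the bag
of `s` listed in the order `as s`, `fs s`. -/
structure Stored (D : TreeDecomposition S T) (num : A ⊕ F ⊕ T → ℕ) (as : T → List A)
    (fs : T → List F) (σ : State) : Prop where
  lh : ∀ b f, σ.arr 3 (σ.arr 2 (num (.inl b)) + num (.inr (.inl f))) ≠ 0 ↔ b ∈ S.lhs f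
  rh : ∀ b f, σ.arr 4 (σ.arr 2 (num (.inl b)) + num (.inr (.inl f))) ≠ 0 ↔ b = S.rhs f
  root : σ.reg 2 = num (.inr (.inr D.root))
  child : ∀ c x s, D.IsChildAt c x s →
    σ.arr (childArr c) (num (.inr (.inr s))) = num (.inr (.inr x)) + 1
  of_child : ∀ c s, σ.arr (childArr c) (num (.inr (.inr s))) ≠ 0 → ∃ x, D.IsChildAt c x s
  parent : ∀ x s, D.IsChild x s → σ.arr 5 (num (.inr (.inr x))) = num (.inr (.inr s)) + 1
  atts : ∀ s, σ.arr 9 (num (.inr (.inr s))) = (as s).length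
  fds : ∀ s, σ.arr 10 (num (.inr (.inr s))) = (fs s).length
  elem : ∀ s i e, (bagList (as s) (fs s))[i]? = some e →
    elemAt σ (num (.inr (.inr s))) i = elemCode num e

/-- The lists `as s` and `fs s` list the attributes and FDs in the bag of `s`. -/
structure ListsBags [DecidableEq A] [DecidableEq F] (D : TreeDecomposition S T)
    (as : T → List A) (fs : T → List F) : Prop where
  nodup_atts : ∀ s, (as s).Nodup
  nodup_fds : ∀ s, (fs s).Nodup
  atts : ∀ s, (as s).toFinset = D.At s
  fds : ∀ s, (fs s).toFinset = D.Fd s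

theorem Reading.stored [DecidableEq A] [DecidableEq F] (hlt : ∀ y, num y < n)
    {P : Set (Atom A F T)} {σ : State}
    (h : Reading D num n P σ) (hP : ∀ x, x ∈ P ↔ D.Holds x) :
    ∃ as fs, ListsBags D as fs ∧ Stored D num as fs σ := by
  choose as fs h₁ h₂ h₃ h₄ h₅ h₆ h₇ using fun s =>
    h.bag s (D.At s) (D.Fd s) ((hP _).2 ⟨rfl, rfl⟩)
  refine ⟨as, fs, ⟨h₁, h₃, h₂, h₄⟩, fun b f => ?_, fun b f => ?_, h.root _ ((hP _).2 rfl), ?_, ?_,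
    fun x s hx => h.parent x s ?_, h₅, h₆, h₇⟩
  · rw [h.mul _ (hlt _).le, h.lh, hP]
    rfl
  · rw [h.mul _ (hlt _).le, h.rh, hP]
    rfl
  · rintro (_ | _) x s hx
    · exact h.child₁ x s ((hP _).2 hx)
    · exact h.child₂ x s ((hP _).2 hx)
  · rintro (_ | _) s hs
    · obtain ⟨x, hx⟩ := h.of_child₁ s hs
      exact ⟨x, (hP _).1 hx⟩
    · obtain ⟨x, hx⟩ := h.of_child₂ s hs
      exact ⟨x, (hP _).1 hx⟩
  · rwa [hP, hP]

/-- The part of the memory that holds the input structure has not been changed. -/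
structure Unchanged (σ τ : State) : Prop where
  reg : τ.reg 2 = σ.reg 2
  arr : ∀ k ≤ 10, k ≠ 1 → ∀ i, τ.arr k i = σ.arr k i

theorem Unchanged.refl (σ : State) : Unchanged σ σ := ⟨rfl, fun _ _ _ _ => rfl⟩

theorem Unchanged.trans {ρ σ τ : State} (h : Unchanged ρ σ) (h' : Unchanged σ τ) :
    Unchanged ρ τ :=
  ⟨h'.reg.trans h.reg, fun k hk hk' i => (h'.arr k hk hk' i).trans (h.arr k hk hk' i)⟩

theorem unchanged_setR {r : ℕ} (hr : r ≠ 2) (e : State → ℕ) (σ : State) :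
    Unchanged σ (setR r e σ) := ⟨by simp [hr.symm], fun _ _ _ _ => rfl⟩

theorem unchanged_putA {k : ℕ} (hk : k = 1 ∨ 10 < k) (i e : State → ℕ) (σ : State) :
    Unchanged σ (putA k i e σ) := by
  refine ⟨rfl, fun k' h h' j => ?_⟩
  have : k' ≠ k := by omega
  simp [this]

variable {as : T → List A} {fs : T → List F} {σ τ : State}

theorem Unchanged.elemAt (h : Unchanged σ τ) (s i : ℕ) : elemAt τ s i = elemAt σ s i := by
  simp [RAM.elemAt, h.arr]

theorem childArr_le (c : Bool) : childArr c ≤ 10 := by cases c <;> simp [childArr]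

theorem childArr_ne (c : Bool) : childArr c ≠ 1 := by cases c <;> simp [childArr]

theorem Stored.of_unchanged (h : Stored D num as fs σ) (hu : Unchanged σ τ) :
    Stored D num as fs τ := by
  refine ⟨fun b f => ?_, fun b f => ?_, hu.reg.trans h.root, fun c x s hx => ?_, fun c s => ?_,
    fun x s hx => ?_, fun s => ?_, fun s => ?_, fun s i e he => ?_⟩
  · rw [hu.arr 3 (by simp) (by simp), hu.arr 2 (by simp) (by simp), h.lh]
  · rw [hu.arr 4 (by simp) (by simp), hu.arr 2 (by simp) (by simp), h.rh]
  · rw [hu.arr _ (childArr_le c) (childArr_ne c), h.child c x s hx]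
  · rw [hu.arr _ (childArr_le c) (childArr_ne c)]
    exact h.of_child c s
  · rw [hu.arr 5 (by simp) (by simp), h.parent x s hx]
  · rw [hu.arr 9 (by simp) (by simp), h.atts]
  · rw [hu.arr 10 (by simp) (by simp), h.fds]
  · rw [hu.elemAt, h.elem s i e he]

/-! ### The stored data of nodes and edges -/

/-- The element at a position of a bag. -/
def slot (K : ℕ) (as : T → List A) (fs : T → List F) (s : T) (i : Fin K) : Option (A ⊕ F) :=
  (bagList (as s) (fs s))[(i : ℕ)]?

theorem bagList_eq_inl {as : List A} {fs : List F} {i : ℕ} {b : A} :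
    (bagList as fs)[i]? = some (.inl b) ↔ as[i]? = some b := by
  rw [bagList, List.getElem?_append]
  split_ifs with h
  · simp
  · simp only [List.length_map, not_lt] at h
    simp [List.getElem?_eq_none h]

theorem bagList_eq_inr {as : List A} {fs : List F} {i : ℕ} {f : F} :
    (bagList as fs)[i]? = some (.inr f) ↔ as.length ≤ i ∧ fs[i - as.length]? = some f := by
  rw [bagList, List.getElem?_append]
  split_ifs with h
  · simp only [List.length_map] at h
    simp [h]
  · simp only [List.length_map, not_lt] at h
    simp [h]

theorem ListsBags.isIndexing [DecidableEq A] [DecidableEq F] (h : ListsBags D as fs)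
    (hK : ∀ s, (D.At s).card + (D.Fd s).card ≤ K) :
    D.IsIndexing (slot K as fs) := by
  have hlen : ∀ s, (as s).length + (fs s).length ≤ K := by
    intro s
    have := hK s
    rwa [← h.atts, ← h.fds, List.toFinset_card_of_nodup (h.nodup_atts s),
      List.toFinset_card_of_nodup (h.nodup_fds s)] at this
  refine ⟨fun s i j e hi hj => ?_, fun s b => ?_, fun s f => ?_⟩
  · have hn : (bagList (as s) (fs s)).Nodup := by
      refine List.nodup_append.2 ⟨(h.nodup_atts s).map Sum.inl_injective,
        (h.nodup_fds s).map Sum.inr_injective, ?_⟩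
      simp
    obtain ⟨hi', hi⟩ := List.getElem?_eq_some_iff.1 hi
    obtain ⟨hj', hj⟩ := List.getElem?_eq_some_iff.1 hj
    exact Fin.ext ((hn.getElem_inj_iff).1 (hi.trans hj.symm))
  · simp only [slot, bagList_eq_inl]
    rw [← h.atts, List.mem_toFinset, List.mem_iff_getElem?]
    constructor
    · rintro ⟨i, hi⟩
      have := (List.getElem?_eq_some_iff.1 hi).1
      exact ⟨⟨i, by have := hlen s; omega⟩, hi⟩
    · rintro ⟨i, hi⟩
      exact ⟨i, hi⟩
  · simp only [slot, bagList_eq_inr]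
    rw [← h.fds, List.mem_toFinset, List.mem_iff_getElem?]
    constructor
    · rintro ⟨i, hi⟩
      have := (List.getElem?_eq_some_iff.1 hi).1
      exact ⟨⟨(as s).length + i, by have := hlen s; omega⟩, by simp [hi]⟩
    · rintro ⟨i, -, hi⟩
      exact ⟨_, hi⟩

namespace Stored

theorem isAttAt_iff (h : Stored D num as fs σ) {s : T} {i : ℕ} :
    IsAttAt σ (num (.inr (.inr s))) i ↔ ∃ b, (bagList (as s) (fs s))[i]? = some (.inl b) := by
  simp only [IsAttAt, h.atts, bagList_eq_inl]
  simp [List.getElem?_eq_some_iff]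

theorem isFdAt_iff (h : Stored D num as fs σ) {s : T} {i : ℕ} :
    IsFdAt σ (num (.inr (.inr s))) i ↔ ∃ f, (bagList (as s) (fs s))[i]? = some (.inr f) := by
  simp only [IsFdAt, h.atts, h.fds, bagList_eq_inr]
  simp only [List.getElem?_eq_some_iff]
  constructor
  · rintro ⟨h₁, h₂⟩
    exact ⟨_, by omega, by omega, rfl⟩
  · rintro ⟨f, h₁, h₂, -⟩
    omega

theorem isElemAt_iff (h : Stored D num as fs σ) {s : T} {i : ℕ} :
    IsElemAt σ (num (.inr (.inr s))) i ↔ ∃ e, (bagList (as s) (fs s))[i]? = some e := by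
  simp only [IsElemAt, h.atts, h.fds, ← Option.isSome_iff_exists]
  simp [bagList]

theorem relatedAt_iff (h : Stored D num as fs σ) {k : ℕ} {R : A → F → Prop}
    (hR : ∀ b f, σ.arr k (σ.arr 2 (num (.inl b)) + num (.inr (.inl f))) ≠ 0 ↔ R b f) {s : T}
    {i j : ℕ} : RelatedAt k σ (num (.inr (.inr s))) i j ↔
      ∃ b f, (bagList (as s) (fs s))[i]? = some (.inl b) ∧
        (bagList (as s) (fs s))[j]? = some (.inr f) ∧ R b f := by
  rw [RelatedAt, h.isAttAt_iff, h.isFdAt_iff]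
  constructor
  · rintro ⟨⟨b, hb⟩, ⟨f, hf⟩, hbf⟩
    rw [h.elem s _ _ hb, h.elem s _ _ hf] at hbf
    exact ⟨b, f, hb, hf, (hR b f).1 hbf⟩
  · rintro ⟨b, f, hb, hf, hbf⟩
    refine ⟨⟨b, hb⟩, ⟨f, hf⟩, ?_⟩
    rw [h.elem s _ _ hb, h.elem s _ _ hf]
    exact (hR b f).2 hbf

theorem label_eq (hnum : Function.Injective num) (h : Stored D num as fs σ) (s : T) :
    storedLabel K σ (num (.inr (.inr s))) = D.label (slot K as fs) s := by
  unfold storedLabel TreeDecomposition.label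
  congr 1
  · exact funext fun i => propext h.isAttAt_iff
  · exact funext fun i => funext fun j => propext (h.relatedAt_iff h.lh)
  · exact funext fun i => funext fun j => propext (h.relatedAt_iff h.rh)
  · refine funext fun c => propext ⟨h.of_child c s, ?_⟩
    rintro ⟨x, hx⟩
    simp [h.child c x s hx]
  · rw [h.root, hnum.eq_iff]
    simp

theorem elemCode_injective (hnum : Function.Injective num) : Function.Injective (elemCode num) := by
  rintro (b | f) (b' | f') h <;> simp_all [elemCode, hnum.eq_iff]

theorem matches_eq (hnum : Function.Injective num) (h : Stored D num as fs σ) (s x : T) :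
    storedMatches K σ (num (.inr (.inr s))) (num (.inr (.inr x))) =
      TreeDecomposition.Matches (slot K as fs) s x := by
  refine funext fun i => funext fun j => propext ?_
  rw [storedMatches, h.isElemAt_iff, h.isElemAt_iff]
  constructor
  · rintro ⟨⟨e, he⟩, ⟨e', he'⟩, h'⟩
    rw [h.elem s _ _ he, h.elem x _ _ he', (elemCode_injective hnum).eq_iff] at h'
    exact ⟨e, he, h' ▸ he'⟩
  · rintro ⟨e, he, he'⟩
    exact ⟨⟨e, he⟩, ⟨e, he'⟩, by rw [h.elem s _ _ he, h.elem x _ _ he']⟩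

theorem index_eq (hnum : Function.Injective num) (h : Stored D num as fs σ) {s x : T} {c : Bool}
    (hx : D.IsChildAt c x s) : storedIndex σ (num (.inr (.inr s))) (num (.inr (.inr x))) = c := by
  unfold storedIndex
  cases c with
  | false => simpa [childArr] using h.child false x s hx
  | true =>
    simp only [decide_eq_true_eq]
    obtain ⟨y, hy, hne⟩ := D.first_of_second hx
    rw [show σ.arr 6 _ = _ from h.child false y s hy]
    simpa [hnum.eq_iff] using hne

end Stored

/-- The constraint on the views at a node and its child. -/
def EdgeOk (D : TreeDecomposition S T) (el : T → Fin K → Option (A ⊕ F)) (s x : T)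
    (q q' : View K) : Prop :=
  ∀ c, D.IsChildAt c x s → q.Compat c (TreeDecomposition.Matches el s x) q'

theorem Stored.arc_iff (hnum : Function.Injective num) (h : Stored D num as fs σ) {s x : T}
    (hx : D.IsChild x s) {q q' : View K} :
    StoredArc σ (num (.inr (.inr s))) (num (.inr (.inr x))) q q' ↔
      Arc (fun s q => q.Ok (D.label (slot K as fs) s)) (EdgeOk D (slot K as fs)) s x q q' := by
  obtain ⟨c, hc⟩ := isChild_iff.1 hx
  rw [StoredArc, h.label_eq hnum, h.label_eq hnum, h.matches_eq hnum, h.index_eq hnum hc]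
  refine and_congr_right fun _ => and_congr_right fun _ => ⟨fun h' c' hc' => ?_, fun h' => h' c hc⟩
  rwa [← hc.index_unique hc']

end PrimeAttr.RAM

namespace PrimeAttr

namespace RootedTree

/-! ### Breadth-first search -/

variable {T : Type*} (B : RootedTree T)

open Classical in
/-- The list of the children of `s` with index `c`. -/
noncomputable def kid (c : Bool) (s : T) : List T :=
  if h : ∃ x, B.IsChildAt c x s then [h.choose] else []

/-- The state of the search when the first `h` nodes of the list `L` have been expanded. -/
structure Frontier (h : ℕ) (L : List T) : Prop where
  nodup : L.Nodup
  le : h ≤ L.length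
  zero : L[0]? = some B.root
  mem : ∀ x s, B.IsChild x s → (x ∈ L ↔ s ∈ L.take h)
  order : ∀ (i j : ℕ) (x s : T), L[i]? = some x → L[j]? = some s → B.IsChild x s → j < i

variable {B}

theorem kid_of_isChildAt {c : Bool} {x s : T} (h : B.IsChildAt c x s) : B.kid c s = [x] := by
  have h' : ∃ x, B.IsChildAt c x s := ⟨x, h⟩
  rw [kid, dif_pos h', h.unique h'.choose_spec]

theorem kid_of_forall_not {c : Bool} {s : T} (h : ¬ ∃ x, B.IsChildAt c x s) : B.kid c s = [] :=
  dif_neg h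

theorem mem_kid {c : Bool} {x s : T} : x ∈ B.kid c s ↔ B.IsChildAt c x s := by
  by_cases h : ∃ x, B.IsChildAt c x s
  · obtain ⟨y, hy⟩ := h
    rw [kid_of_isChildAt hy, List.mem_singleton]
    exact ⟨fun h => h ▸ hy, fun h => h.unique hy⟩
  · rw [kid_of_forall_not h]
    simpa using fun hx => h ⟨x, hx⟩

theorem mem_kids {x s : T} : x ∈ B.kid false s ++ B.kid true s ↔ B.IsChild x s := by
  simp [mem_kid, IsChild, IsChildAt]

theorem nodup_kids (s : T) : (B.kid false s ++ B.kid true s).Nodup := by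
  have h : ∀ c, (B.kid c s).Nodup := by
    intro c
    unfold kid
    split_ifs <;> simp
  refine List.nodup_append.2 ⟨h _, h _, ?_⟩
  rintro x hx y hy rfl
  simpa using (mem_kid.1 hx).index_unique (mem_kid.1 hy)

namespace Frontier

variable {h : ℕ} {L : List T}

theorem init : B.Frontier 0 [B.root] := by
  refine ⟨by simp, by simp, rfl, fun x s hx => ?_, fun i j x s hi hj hx => ?_⟩
  · simp only [List.mem_singleton, List.take_zero, List.not_mem_nil, iff_false]
    rintro rfl
    exact not_isChild_root s hx
  · have : x = B.root := by simpa using List.mem_of_getElem? hi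
    subst this
    exact (not_isChild_root s hx).elim

/-- The appended children are new: by `mem`, a child already listed would put its parent `L[h]`
among the first `h` entries, against `nodup`. -/
theorem step (hL : B.Frontier h L) {s : T} (hs : L[h]? = some s) :
    B.Frontier (h + 1) (L ++ (B.kid false s ++ B.kid true s)) := by
  obtain ⟨hlt, rfl⟩ := List.getElem?_eq_some_iff.1 hs
  have hnot : L[h] ∉ L.take h := by
    intro hmem
    obtain ⟨i, hi⟩ := List.mem_iff_getElem?.1 hmem
    obtain ⟨hi', he⟩ := List.getElem?_eq_some_iff.1 hi
    rw [List.getElem_take] at he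
    have := hL.nodup.getElem_inj_iff.1 he
    simp at hi'
    omega
  have hkid : ∀ x, B.IsChild x L[h] → x ∉ L := fun x hx hxL => hnot ((hL.mem x _ hx).1 hxL)
  refine ⟨?_, ?_, ?_, fun x s hx => ?_, fun i j x s hi hj hx => ?_⟩
  · refine List.nodup_append.2 ⟨hL.nodup, nodup_kids _, ?_⟩
    rintro x hx y hy rfl
    exact hkid x (mem_kids.1 hy) hx
  · rw [List.length_append]
    omega
  · rw [List.getElem?_append_left (by omega), hL.zero]
  · rw [List.mem_append, mem_kids, List.take_append_of_le_length (by omega), List.take_add_one,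
      hs, List.mem_append, hL.mem x s hx]
    simp only [Option.toList_some, List.mem_singleton]
    exact or_congr_right ⟨fun h' => hx.parent_unique h', fun h' => h' ▸ hx⟩
  · have hjlt : ∀ {j : ℕ}, (L ++ (B.kid false L[h] ++ B.kid true L[h]))[j]? = some s → s ∈ L →
        L[j]? = some s := by
      intro j hj hsL
      by_cases hjL : j < L.length
      · rwa [List.getElem?_append_left hjL] at hj
      · rw [List.getElem?_append_right (by omega)] at hj
        exact (hkid s (mem_kids.1 (List.mem_of_getElem? hj)) hsL).elim
    by_cases hiL : i < L.length
    · rw [List.getElem?_append_left hiL] at hi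
      have hsL := List.mem_of_mem_take ((hL.mem x s hx).1 (List.mem_of_getElem? hi))
      exact hL.order i j x s hi (hjlt hj hsL) hx
    · rw [List.getElem?_append_right (by omega)] at hi
      obtain rfl := hx.parent_unique (mem_kids.1 (List.mem_of_getElem? hi))
      have := (List.getElem?_eq_some_iff.1 (hjlt hj (List.getElem_mem hlt))).1
      omega

theorem mem_of_eq_length (hL : B.Frontier L.length L) (t : T) : t ∈ L := by
  have ht := B.reaches_root t
  induction ht using Relation.ReflTransGen.head_induction_on with
  | refl => exact List.mem_of_getElem? hL.zero
  | head hx _ ih => exact (hL.mem _ _ hx).2 (by rwa [List.take_length])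

/-- A queue whose nodes have all been expanded is closed under children and contains the root, hence
contains every node; so it cannot run empty early. -/
theorem lt_length [Fintype T] (hL : B.Frontier h L) (hh : h < Fintype.card T) : h < L.length := by
  refine lt_of_le_of_ne hL.le ?_
  rintro rfl
  classical
  have := List.toFinset_card_le L
  rw [Finset.eq_univ_of_forall (s := L.toFinset) fun t => by simpa using hL.mem_of_eq_length t,
    Finset.card_univ] at this
  omega

theorem length_eq [Fintype T] (hL : B.Frontier (Fintype.card T) L) : L.length = Fintype.card T :=
  le_antisymm hL.nodup.length_le_card hL.le

theorem isTopDown [Fintype T] (hL : B.Frontier (Fintype.card T) L) :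
    B.IsTopDown (Fintype.card T) fun i => L.getD i B.root := by
  have hlen := hL.length_eq
  have hget : ∀ i < Fintype.card T, L[i]? = some (L.getD i B.root) := by
    intro i hi
    rw [← hlen] at hi
    simp [List.getElem?_eq_getElem hi]
  refine ⟨fun i hi j hj h => ?_, fun t => ?_, by simp [hL.zero], fun i hi j hj h => ?_⟩
  · have h' := (hget i hi).trans ((congrArg some h).trans (hget j hj).symm)
    exact (List.getElem?_inj (by omega) hL.nodup).1 h'
  · have hL' : B.Frontier L.length L := by rwa [hlen]
    obtain ⟨i, hi⟩ := List.mem_iff_getElem?.1 (hL'.mem_of_eq_length t)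
    exact ⟨i, hlen ▸ (List.getElem?_eq_some_iff.1 hi).1, by simp [hi]⟩
  · exact hL.order i j _ _ (hget i hi) (hget j hj) h

end Frontier

end RootedTree

namespace RAM

open PrimeAttr.RootedTree

variable {A F T : Type*} {S : RelSchema A F} {D : TreeDecomposition S T}
  {num : A ⊕ F ⊕ T → ℕ} {n K : ℕ} {as : T → List A} {fs : T → List F} {σ : State}

/-- The list `L` is stored in array `11`, and its length in register `4`. -/
def Queue (num : A ⊕ F ⊕ T → ℕ) (σ : State) (L : List T) : Prop :=
  σ.reg 4 = L.length ∧ ∀ i t, L[i]? = some t → σ.arr 11 i = num (.inr (.inr t))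

/-- Nothing has been written to the output, and no views have been excluded. -/
def Blank (σ : State) : Prop := (∀ i, σ.arr 1 i = 0) ∧ ∀ i, σ.arr 12 i = 0

theorem pushChild_spec (h : Stored D num as fs σ) {s : T} (hs : σ.reg 5 = num (.inr (.inr s)))
    (c : Bool) {L : List T} (hL : Queue num σ L) :
    Queue num (pushChild c σ) (L ++ D.kid c s) ∧ Unchanged σ (pushChild c σ) ∧
      (pushChild c σ).reg 3 = σ.reg 3 ∧ (pushChild c σ).reg 5 = σ.reg 5 ∧
      (Blank σ → Blank (pushChild c σ)) := by
  by_cases hx : ∃ x, D.IsChildAt c x s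
  · obtain ⟨x, hx⟩ := hx
    have hval := h.child c x s hx
    rw [kid_of_isChildAt hx, pushChild, branch_pos (by simp [hs, hval])]
    refine ⟨⟨by simp [hL.1], fun i t hi => ?_⟩, ?_, by simp, by simp,
      fun hb => ⟨by simpa using hb.1, by simpa using hb.2⟩⟩
    · by_cases hiL : i < L.length
      · rw [List.getElem?_append_left hiL] at hi
        simp [hL.1, hiL.ne, hL.2 i t hi]
      · rw [List.getElem?_append_right (by omega), List.getElem?_singleton] at hi
        split_ifs at hi with hi'
        · obtain rfl : i = L.length := by omega
          obtain rfl : x = t := by simpa using hi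
          simp [hL.1, hs, hval]
    · exact (unchanged_putA (.inr (by simp)) _ _ _).trans (unchanged_setR (by simp) _ _)
  · rw [kid_of_forall_not hx, pushChild,
      branch_neg (fun h' => hx (h.of_child c s (by simpa [hs] using h')))]
    exact ⟨by simpa using hL, .refl _, rfl, rfl, id⟩

/-- The memory during the search. -/
structure Searching (D : TreeDecomposition S T) (num : A ⊕ F ⊕ T → ℕ) (as : T → List A)
    (fs : T → List F) (h : ℕ) (σ : State) : Prop where
  stored : Stored D num as fs σ
  blank : Blank σ
  pos : σ.reg 3 = h
  queue : ∃ L, D.Frontier h L ∧ Queue num σ L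

theorem Searching.step [Fintype T] {h : ℕ} (hσ : Searching D num as fs h σ)
    (hh : h < Fintype.card T) :
    σ.reg 3 < σ.reg 4 ∧ Searching D num as fs (h + 1) (bfsBody σ) := by
  obtain ⟨hst, hb, hpos, L, hL, hq⟩ := hσ
  have hlt := hL.lt_length hh
  refine ⟨by rw [hpos, hq.1]; exact hlt, ?_⟩
  have hget : L[h]? = some L[h] := List.getElem?_eq_getElem hlt
  have hu₁ : Unchanged σ (loadNode σ) := unchanged_setR (by simp) _ _
  have hst₁ := hst.of_unchanged hu₁
  obtain ⟨hq₂, hu₂, hr₂, hs₂, hb₂⟩ := pushChild_spec hst₁ (s := L[h])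
    (by simp [loadNode, hpos, hq.2 h _ hget]) false (L := L) (by simpa [Queue, loadNode] using hq)
  have hst₂ := hst₁.of_unchanged hu₂
  obtain ⟨hq₃, hu₃, hr₃, hs₃, hb₃⟩ := pushChild_spec hst₂ (s := L[h])
    (by rw [hs₂]; simp [loadNode, hpos, hq.2 h _ hget]) true hq₂
  have hst₃ := hst₂.of_unchanged hu₃
  refine ⟨hst₃.of_unchanged (unchanged_setR (r := 3) (by simp) (fun σ => σ.reg 3 + 1) _), hb₃ (hb₂ hb), ?_, _, hL.step hget, ?_⟩
  · simp only [bfsBody, nextNode, Function.comp_apply, setR_reg, if_true, hr₃, hr₂]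
    simp [loadNode, hpos]
  · rw [← List.append_assoc]
    simpa [Queue, bfsBody, nextNode] using hq₃

theorem Searching.iterate [Fintype T] (hσ : Searching D num as fs 0 σ) {h : ℕ}
    (hh : h ≤ Fintype.card T) : Searching D num as fs h (bfsBody^[h] σ) := by
  induction h with
  | zero => exact hσ
  | succ h ih =>
    rw [Function.iterate_succ_apply']
    exact ((ih (by omega)).step (by omega)).2

/-! ### The passes over the tree -/

/-- The memory during the passes over the list of nodes; `i` is the index of the current node. -/
structure Passing (D : TreeDecomposition S T) (num : A ⊕ F ⊕ T → ℕ) (as : T → List A)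
    (fs : T → List F) (n : ℕ) (node : ℕ → T) (i : ℕ) (σ : State) : Prop where
  stored : Stored D num as fs σ
  pos : σ.reg 3 = i
  count : σ.reg 4 = n
  queue : ∀ i < n, σ.arr 11 i = num (.inr (.inr (node i)))

/-- The sets of views that are stored for the nodes. -/
noncomputable def views (K : ℕ) (num : A ⊕ F ⊕ T → ℕ) (σ : State) (t : T) : Set (View K) :=
  candidates K σ (num (.inr (.inr t)))

theorem candidates_store (r : ℕ) (v : State → Set (View K)) (σ : State) (s : ℕ) :
    candidates K (store r v σ) s = if s = σ.reg r then v σ else candidates K σ s := by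
  unfold candidates store
  rw [putA_arr]
  split_ifs <;> simp_all [decode_encode]

/-- The memory after loading a node and its parent. -/
theorem Passing.load {node : ℕ → T} {i : ℕ} (h : Passing D num as fs n node i σ) (hi : i < n)
    {s : T} (hs : D.IsChild (node i) s) :
    let τ := loadParent (loadNode σ)
    Passing D num as fs n node i τ ∧ τ.reg 5 = num (.inr (.inr (node i))) ∧
      τ.reg 6 = num (.inr (.inr s)) ∧ τ.arr = σ.arr := by
  intro τ
  have h₅ : (loadNode σ).reg 5 = num (.inr (.inr (node i))) := by
    simp [loadNode, h.pos, h.queue i hi]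
  refine ⟨⟨h.stored.of_unchanged ((unchanged_setR (by simp) _ _).trans
    (unchanged_setR (by simp) _ _)), ?_, ?_, h.queue⟩, ?_, ?_, rfl⟩
  · simpa [τ, loadParent, loadNode] using h.pos
  · simpa [τ, loadParent, loadNode] using h.count
  · simpa [τ, loadParent] using h₅
  · simp only [τ, loadParent, setR_reg, if_true, h₅]
    simp [loadNode, h.stored.parent _ _ hs]

theorem Passing.store {node : ℕ → T} {i : ℕ} (h : Passing D num as fs n node i σ) (r : ℕ)
    (v : State → Set (View K)) : Passing D num as fs n node i (store r v σ) :=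
  ⟨h.stored.of_unchanged (unchanged_putA (.inr (by simp)) _ _ _), h.pos, h.count,
    by simpa [RAM.store] using h.queue⟩

theorem Passing.move {node : ℕ → T} {i : ℕ} (h : Passing D num as fs n node i σ)
    {e : State → ℕ} {j : ℕ} (he : e σ = j) : Passing D num as fs n node j (setR 3 e σ) :=
  ⟨h.stored.of_unchanged (unchanged_setR (by simp) _ _), by simpa using he, by simpa using h.count, h.queue⟩

theorem arr_reviseUpOp {k i : ℕ} (hk : k ≠ 12) : (reviseUpOp K σ).arr k i = σ.arr k i := by
  simp [reviseUpOp, store, hk]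

theorem arr_reviseDownOp {k i : ℕ} (hk : k ≠ 12) : (reviseDownOp K σ).arr k i = σ.arr k i := by
  simp [reviseDownOp, store, hk]

theorem views_reviseUpOp [DecidableEq T] (hnum : Function.Injective num)
    (h : Stored D num as fs σ) {s x : T} (hx : D.IsChild x s)
    (h₅ : σ.reg 5 = num (.inr (.inr x))) (h₆ : σ.reg 6 = num (.inr (.inr s))) :
    views K num (reviseUpOp K σ) = reviseUp (fun s q => q.Ok (D.label (slot K as fs) s))
      (EdgeOk D (slot K as fs)) s x (views K num σ) := by
  funext t
  by_cases ht : t = s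
  · subst ht
    simp only [views, reviseUpOp, reviseUp, candidates_store, h₆, h₅, if_true,
      Function.update_self, h.arc_iff hnum hx]
  · simp [views, reviseUpOp, reviseUp, candidates_store, h₆, hnum.eq_iff, ht]

theorem views_reviseDownOp [DecidableEq T] (hnum : Function.Injective num)
    (h : Stored D num as fs σ) {s x : T} (hx : D.IsChild x s)
    (h₅ : σ.reg 5 = num (.inr (.inr x))) (h₆ : σ.reg 6 = num (.inr (.inr s))) :
    views K num (reviseDownOp K σ) = reviseDown (fun s q => q.Ok (D.label (slot K as fs) s))
      (EdgeOk D (slot K as fs)) s x (views K num σ) := by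
  funext t
  by_cases ht : t = x
  · subst ht
    simp only [views, reviseDownOp, reviseDown, candidates_store, h₆, h₅, if_true,
      Function.update_self, h.arc_iff hnum hx]
  · simp [views, reviseDownOp, reviseDown, candidates_store, h₅, hnum.eq_iff, ht]

theorem IsTopDown.exists_parent {n : ℕ} {node : ℕ → T} {i : ℕ} (hn : D.IsTopDown n node) (h0 : 0 < i)
    (hi : i < n) : ∃ s, D.IsChild (node i) s := by
  refine RootedTree.exists_parent fun h => ?_
  have := hn.inj i hi 0 (by omega) (h.trans hn.zero.symm)
  omega

variable {node : ℕ → T}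

/-- While `node i` is current, the edges above nodes of larger index are already consistent, which
explains `i + 1` in the hypothesis. -/
theorem Passing.upBody (hnum : Function.Injective num) (hn : D.IsTopDown n node) {i : ℕ}
    (h0 : 0 < i) (hi : i < n) (h : Passing D num as fs n node i σ)
    (hG : UpInv D.toRootedTree (fun s q => q.Ok (D.label (slot K as fs) s))
      (EdgeOk D (slot K as fs)) n node (i + 1) (views K num σ)) :
    Passing D num as fs n node (i - 1) (upBody K σ) ∧
      UpInv D.toRootedTree (fun s q => q.Ok (D.label (slot K as fs) s))
        (EdgeOk D (slot K as fs)) n node i (views K num (upBody K σ)) ∧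
      ∀ m, (upBody K σ).arr 1 m = σ.arr 1 m := by
  classical
  obtain ⟨s, hs⟩ := IsTopDown.exists_parent hn h0 hi
  obtain ⟨h', h₅, h₆, ha⟩ := h.load hi hs
  have hv : views K num (loadParent (loadNode σ)) = views K num σ := rfl
  refine ⟨?_, ?_, fun m => ?_⟩
  · have h'' : Passing D num as fs n node i (reviseUpOp K (loadParent (loadNode σ))) :=
      h'.store 6 _
    exact h''.move (e := fun σ => σ.reg 3 - 1) (congrArg (· - 1) h'.pos)
  · have := hG.step hn hi hs
    rwa [← hv, ← views_reviseUpOp hnum h'.stored hs h₅ h₆] at this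
  · exact arr_reviseUpOp (K := K) (k := 1) (σ := loadParent (loadNode σ)) (by simp)

theorem Passing.downBody (hnum : Function.Injective num) (hn : D.IsTopDown n node) {i : ℕ}
    (h0 : 0 < i) (hi : i < n) (h : Passing D num as fs n node i σ)
    (hG : DownInv D.toRootedTree (fun s q => q.Ok (D.label (slot K as fs) s))
      (EdgeOk D (slot K as fs)) node i (views K num σ)) :
    Passing D num as fs n node (i + 1) (downBody K σ) ∧
      DownInv D.toRootedTree (fun s q => q.Ok (D.label (slot K as fs) s))
        (EdgeOk D (slot K as fs)) node (i + 1) (views K num (downBody K σ)) ∧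
      ∀ m, (downBody K σ).arr 1 m = σ.arr 1 m := by
  classical
  obtain ⟨s, hs⟩ := IsTopDown.exists_parent hn h0 hi
  obtain ⟨h', h₅, h₆, ha⟩ := h.load hi hs
  have hv : views K num (loadParent (loadNode σ)) = views K num σ := rfl
  refine ⟨?_, ?_, fun m => ?_⟩
  · have h'' : Passing D num as fs n node i (reviseDownOp K (loadParent (loadNode σ))) :=
      h'.store 5 _
    exact h''.move (e := fun σ => σ.reg 3 + 1) (congrArg (· + 1) h'.pos)
  · have := hG.step hn hi hs
    rwa [← hv, ← views_reviseDownOp hnum h'.stored hs h₅ h₆] at this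
  · exact arr_reviseDownOp (K := K) (k := 1) (σ := loadParent (loadNode σ)) (by simp)

/-! ### The output -/

/-- The target addresses are read from arrays 0 and 8 and register 5, none of which is affected by
writing to array 1. -/
theorem foldl_write (l : List (Fin K)) (σ : State) :
    let τ := l.foldl (fun τ (i : Fin K) => putA 1 (fun τ => elemAt τ (τ.reg 5) i) (fun _ => 1) τ) σ
    τ.reg = σ.reg ∧ (∀ k ≠ 1, ∀ m, τ.arr k m = σ.arr k m) ∧
      ∀ m, τ.arr 1 m ≠ 0 ↔ σ.arr 1 m ≠ 0 ∨ ∃ i ∈ l, elemAt σ (σ.reg 5) i = m := by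
  induction l generalizing σ with
  | nil => simp
  | cons i l ih =>
    obtain ⟨h₁, h₂, h₃⟩ := ih (putA 1 (fun τ => elemAt τ (τ.reg 5) i) (fun _ => 1) σ)
    refine ⟨h₁, fun k hk m => ?_, fun m => ?_⟩
    · rw [List.foldl_cons, h₂ k hk]
      simp [hk]
    · rw [List.foldl_cons, h₃]
      by_cases hm : m = elemAt σ (σ.reg 5) i
      · simp [hm]
      · simp [hm, Ne.symm hm]

/-- The elements of the bag of `t` that are marked in one of the remaining views. -/
def Marked (K : ℕ) (num : A ⊕ F ⊕ T → ℕ) (σ : State) (t : T) (m : ℕ) : Prop :=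
  ∃ i ∈ markedPositions K σ (num (.inr (.inr t))), elemAt σ (num (.inr (.inr t))) i = m

theorem Passing.writeBody {i : ℕ} (hi : i < n) (h : Passing D num as fs n node i σ) :
    Passing D num as fs n node (i + 1) (writeBody K σ) ∧ Unchanged σ (writeBody K σ) ∧
      (∀ m, (writeBody K σ).arr 12 m = σ.arr 12 m) ∧
      ∀ m, (writeBody K σ).arr 1 m ≠ 0 ↔ σ.arr 1 m ≠ 0 ∨ Marked K num σ (node i) m := by
  have h₅ : (loadNode σ).reg 5 = num (.inr (.inr (node i))) := by
    simp [loadNode, h.pos, h.queue i hi]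
  obtain ⟨h₁, h₂, h₃⟩ := foldl_write
    (Set.toFinite (markedPositions K (loadNode σ) ((loadNode σ).reg 5))).toFinset.toList
    (loadNode σ)
  have hu : Unchanged σ (RAM.writeBody K σ) := by
    have hu₁ : Unchanged σ (loadNode σ) := unchanged_setR (by simp) _ _
    have hu₂ : Unchanged (loadNode σ)
        (writePositions (markedPositions K (loadNode σ) ((loadNode σ).reg 5)) (loadNode σ)) :=
      ⟨congrFun h₁ 2, fun k _ hk m => h₂ k hk m⟩
    exact (hu₁.trans hu₂).trans (unchanged_setR (r := 3) (by simp) (fun σ => σ.reg 3 + 1) _)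
  refine ⟨⟨h.stored.of_unchanged hu, ?_, ?_, fun j hj => ?_⟩, hu, fun m => ?_, fun m => ?_⟩
  · simp only [RAM.writeBody, nextNode, Function.comp_apply, setR_reg, if_true, writePositions, h₁]
    simp [loadNode, h.pos]
  · simp only [RAM.writeBody, nextNode, Function.comp_apply, setR_reg, writePositions, h₁]
    simp [loadNode, h.count]
  · exact (h₂ 11 (by simp) j).trans (h.queue j hj)
  · exact h₂ 12 (by simp) m
  · refine (h₃ m).trans (or_congr_right ?_)
    rw [h₅]
    simp only [Finset.mem_toList, Set.Finite.mem_toFinset]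
    rfl

theorem Marked.congr {τ : State} (hu : Unchanged σ τ) (ha : ∀ m, τ.arr 12 m = σ.arr 12 m)
    {t : T} {m : ℕ} : Marked K num τ t m ↔ Marked K num σ t m := by
  have h₁ : ∀ s i, elemAt τ s i = elemAt σ s i := hu.elemAt
  have h₂ : ∀ k ≤ 10, k ≠ 1 → ∀ i, τ.arr k i = σ.arr k i := hu.arr
  have h₃ : ∀ s, storedLabel K τ s = storedLabel K σ s := by
    intro s
    simp only [storedLabel, RelatedAt, IsAttAt, IsFdAt, h₁, hu.reg, h₂ 9 (by simp) (by simp),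
      h₂ 10 (by simp) (by simp), h₂ 3 (by simp) (by simp), h₂ 4 (by simp) (by simp),
      h₂ 2 (by simp) (by simp), h₂ _ (childArr_le _) (childArr_ne _)]
  simp only [Marked, markedPositions, candidates, h₁, h₃, ha]

end RAM

end PrimeAttr

/-! ### The complete run of the program -/

namespace PrimeAttr.RAM

open PrimeAttr.RootedTree

variable {A F T : Type*} {S : RelSchema A F} {D : TreeDecomposition S T}
  {num : A ⊕ F ⊕ T → ℕ} {n K : ℕ} {as : T → List A} {fs : T → List F} {node : ℕ → T} {σ : State}

theorem Passing.iterate_upBody (hnum : Function.Injective num) (hn : D.IsTopDown n node)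
    (h : Passing D num as fs n node (n - 1) σ)
    (hG : UpInv D.toRootedTree (fun s q => q.Ok (D.label (slot K as fs) s))
      (EdgeOk D (slot K as fs)) n node n (views K num σ)) (j : ℕ) (hj : j < n) :
    Passing D num as fs n node (n - 1 - j) ((RAM.upBody K)^[j] σ) ∧
      UpInv D.toRootedTree (fun s q => q.Ok (D.label (slot K as fs) s))
        (EdgeOk D (slot K as fs)) n node (n - j) (views K num ((RAM.upBody K)^[j] σ)) ∧
      ∀ m, ((RAM.upBody K)^[j] σ).arr 1 m = σ.arr 1 m := by
  induction j with
  | zero => exact ⟨h, hG, fun _ => rfl⟩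
  | succ j ih =>
    obtain ⟨h₁, h₂, h₃⟩ := ih (by omega)
    rw [Function.iterate_succ_apply']
    have := h₁.upBody (K := K) hnum hn (by omega) (by omega)
      (by rwa [show n - 1 - j + 1 = n - j by omega])
    rw [show n - (j + 1) = n - 1 - j by omega, show n - 1 - (j + 1) = n - 1 - j - 1 by omega]
    exact ⟨this.1, this.2.1, fun m => (this.2.2 m).trans (h₃ m)⟩

theorem Passing.iterate_downBody (hnum : Function.Injective num) (hn : D.IsTopDown n node)
    (h : Passing D num as fs n node 1 σ)
    (hG : DownInv D.toRootedTree (fun s q => q.Ok (D.label (slot K as fs) s))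
      (EdgeOk D (slot K as fs)) node 1 (views K num σ)) (j : ℕ) (hj : j < n) :
    Passing D num as fs n node (j + 1) ((RAM.downBody K)^[j] σ) ∧
      DownInv D.toRootedTree (fun s q => q.Ok (D.label (slot K as fs) s))
        (EdgeOk D (slot K as fs)) node (j + 1) (views K num ((RAM.downBody K)^[j] σ)) ∧
      ∀ m, ((RAM.downBody K)^[j] σ).arr 1 m = σ.arr 1 m := by
  induction j with
  | zero => exact ⟨h, hG, fun _ => rfl⟩
  | succ j ih =>
    obtain ⟨h₁, h₂, h₃⟩ := ih (by omega)
    rw [Function.iterate_succ_apply']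
    have := h₁.downBody (K := K) hnum hn (by omega) (by omega) h₂
    exact ⟨this.1, this.2.1, fun m => (this.2.2 m).trans (h₃ m)⟩

theorem Passing.iterate_writeBody (h : Passing D num as fs n node 0 σ) (h0 : ∀ m, σ.arr 1 m = 0)
    (j : ℕ) (hj : j ≤ n) :
    Passing D num as fs n node j ((RAM.writeBody K)^[j] σ) ∧ Unchanged σ ((RAM.writeBody K)^[j] σ) ∧
      (∀ m, ((RAM.writeBody K)^[j] σ).arr 12 m = σ.arr 12 m) ∧
      ∀ m, ((RAM.writeBody K)^[j] σ).arr 1 m ≠ 0 ↔ ∃ i < j, Marked K num σ (node i) m := by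
  induction j with
  | zero => exact ⟨h, .refl _, fun _ => rfl, by simp [h0]⟩
  | succ j ih =>
    obtain ⟨h₁, h₂, h₃, h₄⟩ := ih (by omega)
    rw [Function.iterate_succ_apply']
    obtain ⟨h₅, h₆, h₇, h₈⟩ := h₁.writeBody (K := K) (by omega)
    refine ⟨h₅, h₂.trans h₆, fun m => (h₇ m).trans (h₃ m), fun m => ?_⟩
    rw [h₈, h₄, Marked.congr h₂ h₃]
    constructor
    · rintro (⟨i, hi, h⟩ | h)
      · exact ⟨i, by omega, h⟩
      · exact ⟨j, by omega, h⟩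
    · rintro ⟨i, hi, h⟩
      rcases Nat.lt_succ_iff_lt_or_eq.1 hi with hi | rfl
      · exact .inl ⟨i, hi, h⟩
      · exact .inr h

theorem isSolution_iff {el : T → Fin K → Option (A ⊕ F)} {v : T → View K} :
    D.IsSolution (fun s q => q.Ok (D.label el s)) (EdgeOk D el) v ↔ D.IsCertificate el v :=
  ⟨fun h => ⟨h.node, fun c x s hx => h.edge x s hx.isChild c hx⟩,
    fun h => ⟨h.ok, fun x s _ c hc => h.compat c x s hc⟩⟩

/-- After both passes the remaining views at `t` that satisfy `Ok` are exactly those belonging to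
certificates, by `DownInv.mem_iff`. -/
theorem marked_iff [Finite T] (hnum : Function.Injective num) (hst : Stored D num as fs σ)
    (hn : D.IsTopDown n node)
    (hG : DownInv D.toRootedTree (fun s q => q.Ok (D.label (slot K as fs) s))
      (EdgeOk D (slot K as fs)) node n (views K num σ)) {t : T} {m : ℕ} :
    Marked K num σ t m ↔ ∃ a i v, num (.inl a) = m ∧ slot K as fs t i = some (.inl a) ∧
      D.IsCertificate (slot K as fs) v ∧ (v t).Marks i := by
  simp only [Marked, markedPositions, Set.mem_ofPred_eq, hst.label_eq hnum]
  constructor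
  · rintro ⟨i, ⟨q, hq, hok, hm⟩, he⟩
    obtain ⟨v, hv, rfl⟩ := (hG.mem_iff hn).1 ⟨hq, hok⟩
    obtain ⟨⟨a, ha⟩, -⟩ := hok.marks i hm
    refine ⟨a, i, v, ?_, ha, isSolution_iff.1 hv, hm⟩
    rw [hst.elem t i _ ha] at he
    exact he
  · rintro ⟨a, i, v, ha, hi, hv, hm⟩
    obtain ⟨hq, hok⟩ := (hG.mem_iff hn).2 ⟨v, isSolution_iff.2 hv, rfl⟩
    exact ⟨i, ⟨v t, hq, hok, hm⟩, (hst.elem t i _ hi).trans ha⟩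

theorem length_le_flatten [DecidableEq A] [DecidableEq F] {atoms : List (Atom A F T)}
    {parts : List (List ℕ)}
    (hw : List.Forall₂ (fun x v => x.Written num v) atoms parts) :
    atoms.length ≤ parts.flatten.length := by
  induction hw with
  | nil => simp
  | cons h _ ih =>
    have := written_length_pos h
    simp only [List.length_cons, List.flatten_cons, List.length_append]
    omega

/-- Each attribute, FD and node has an atom of its own. Consequently all numbers of domain elements
are below the length of the input, which can therefore serve as the row length of the matrices. -/
theorem card_le_length [Fintype A] [Fintype F] [Fintype T] {atoms : List (Atom A F T)}
    (h : ∀ x, x ∈ atoms ↔ D.Holds x) : Fintype.card (A ⊕ F ⊕ T) ≤ atoms.length := by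
  classical
  let g : A ⊕ F ⊕ T → Atom A F T :=
    Sum.elim .att (Sum.elim .fd fun s => .bag s (D.At s) (D.Fd s))
  have hg : Function.Injective g := by
    rintro (a | f | s) (a' | f' | s') h <;> simp_all [g]
  rw [← Finset.card_univ, ← Finset.card_image_of_injective _ hg]
  refine (Finset.card_le_card fun x hx => ?_).trans (List.toFinset_card_le atoms)
  obtain ⟨y, -, rfl⟩ := Finset.mem_image.1 hx
  rw [List.mem_toFinset, h]
  rcases y with a | f | s
  · trivial
  · trivial
  · exact ⟨rfl, rfl⟩

/-- Bags have at most `w + 1` elements, hence views with `w + 1` positions. The table of multiples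
takes one iteration per entry of the input, reading takes one per atom, and the other four loops
take at most one per node; all these numbers are bounded by `u.length`. -/
theorem exists_computes [Fintype A] [Fintype F] [Fintype T] [DecidableEq A] [DecidableEq F]
    {N w : ℕ} (num : A ⊕ F ⊕ T ≃ Fin N)
    {u : List ℕ} (hD : D.IsModifiedNormalized) (hw : D.WidthLE w)
    (hu : D.EncodedBy (fun x => (num x : ℕ)) u) :
    0 < u.length ∧ ∃ τ, Computes (w + 1) u.length (init u) τ ∧
      ∀ m, τ.arr 1 m ≠ 0 ↔ ∃ a : A, (num (.inl a) : ℕ) = m ∧ D.PrimePred a := by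
  obtain ⟨atoms, parts, -, hatoms, hwr, rfl⟩ := hu
  set u := parts.flatten
  let nm : A ⊕ F ⊕ T → ℕ := fun x => num x
  have hnum : Function.Injective nm := Fin.val_injective.comp num.injective
  have hlen : atoms.length ≤ u.length := length_le_flatten hwr
  have hcard := card_le_length hatoms
  have hN : N ≤ u.length := by
    have := Fintype.card_congr num
    rw [Fintype.card_fin] at this
    omega
  have hlt : ∀ y, nm y < u.length := fun y => (num y).2.trans_le hN
  have hT : Fintype.card T ≤ u.length :=
    (Fintype.card_le_of_injective (fun t : T => (Sum.inr (Sum.inr t) : A ⊕ F ⊕ T))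
      (Sum.inr_injective.comp Sum.inr_injective)).trans (hcard.trans hlen)
  have hT0 : 0 < Fintype.card T := Fintype.card_pos_iff.2 ⟨D.root⟩
  refine ⟨hT0.trans_le hT, ?_⟩
  -- the table of multiples
  have hmul := iterate_mulBody u
  obtain ⟨h₁, h₂, h₃, h₄⟩ := hmul u.length
  have hR : ∀ k, (mulBody^[k] (init u)).reg 0 = u.length := fun k => by
    rw [(hmul k).2.1 0 (by simp)]
    rfl
  generalize hσ₁ : mulBody^[u.length] (init u) = σ₁ at h₁ h₂ h₃ h₄
  have loop₁ : LoopRel (fun σ => σ.reg 1 < σ.reg 0) mulBody u.length (init u) σ₁ :=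
    ⟨u.length, le_rfl, fun i hi => by beta_reduce; rw [hR, (hmul i).1]; exact hi,
      by beta_reduce; rw [hR, (hmul _).1]; simp, hσ₁.symm⟩
  -- reading the input
  have hread : Reading D nm u.length ∅ (setR 1 (fun _ => 0) σ₁) := by
    refine ⟨by simp, h₃, ?_, ?_, by simp, by simp, by simp, ?_, ?_, by simp, by simp, ?_, ?_, ?_⟩
    all_goals simp [h₄, h₂, init]
  obtain ⟨h₅, h₆, h₇⟩ := hread.iterate hnum hlt hwr (fun x hx => (hatoms x).1 hx)
    (fun i w hi => by simp [look, h₄, init, hi, u]) (by simp [h₂, init, u])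
  generalize hσ₂ : readBody^[atoms.length] (setR 1 (fun _ => 0) σ₁) = σ₂ at h₆ h₇
  have loop₂ : LoopRel (fun σ => σ.reg 1 < σ.reg 0) readBody u.length (setR 1 (fun _ => 0) σ₁) σ₂ :=
    ⟨atoms.length, hlen, h₅, by rwa [hσ₂], hσ₂.symm⟩
  obtain ⟨as, fs, hlist, hst₂⟩ := h₇.stored hlt (by simpa using hatoms)
  -- the search
  have hsearch : Searching D nm as fs 0
      (setR 4 (fun _ => 1) (putA 11 (fun _ => 0) (fun σ => σ.reg 2) σ₂)) := by
    refine ⟨(hst₂.of_unchanged (unchanged_putA (.inr (by simp)) _ _ _)).of_unchanged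
      (unchanged_setR (by simp) _ _), ⟨by simpa using h₇.clean.2.1, by simpa using h₇.clean.2.2⟩,
      by simpa using h₇.clean.1, _, Frontier.init, by simp, fun i t hi => ?_⟩
    rw [List.getElem?_singleton] at hi
    split_ifs at hi with h0
    obtain rfl : D.root = t := by simpa using hi
    simp [h0, hst₂.root, nm]
  have hs₃ := hsearch.iterate le_rfl
  obtain ⟨L, hL, hq⟩ := hs₃.queue
  have hr₃ : _ = Fintype.card T := hq.1.trans hL.length_eq
  generalize hσ₃ : bfsBody^[Fintype.card T] _ = σ₃ at hs₃ hq hr₃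
  have loop₃ : LoopRel (fun σ => σ.reg 3 < σ.reg 4) bfsBody u.length
      (setR 4 (fun _ => 1) (putA 11 (fun _ => 0) (fun σ => σ.reg 2) σ₂)) σ₃ :=
    ⟨Fintype.card T, hT, fun i hi => ((hsearch.iterate hi.le).step hi).1,
      by beta_reduce; rw [hσ₃, hs₃.pos, hr₃]; simp, hσ₃.symm⟩
  have hn := hL.isTopDown
  set node : ℕ → T := fun i => L.getD i D.root
  -- the bottom-up pass
  have hp₃ : Passing D nm as fs (Fintype.card T) node (Fintype.card T) σ₃ := by
    refine ⟨hs₃.stored, hs₃.pos, hr₃, fun i hi => hq.2 i _ ?_⟩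
    rw [← hL.length_eq] at hi
    simp [node, List.getElem?_eq_getElem hi]
  have hp₃' : Passing D nm as fs (Fintype.card T) node (Fintype.card T - 1) (previousNode σ₃) :=
    hp₃.move (e := fun σ => σ.reg 3 - 1) (congrArg (· - 1) hp₃.pos)
  have hG₃ : UpInv D.toRootedTree (fun s q => q.Ok (D.label (slot (w + 1) as fs) s))
      (EdgeOk D (slot (w + 1) as fs)) (Fintype.card T) node (Fintype.card T)
      (views (w + 1) nm (previousNode σ₃)) := by
    refine ⟨fun f _ t => ?_, fun i hi hi' => by omega⟩
    have : (previousNode σ₃).arr 12 (nm (.inr (.inr t))) = 0 := hs₃.blank.2 _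
    rw [views, candidates, this]
    trivial
  have hup := hp₃'.iterate_upBody hnum hn hG₃
  obtain ⟨hp₄, hG₄, hb₄⟩ := hup (Fintype.card T - 1) (by omega)
  generalize hσ₄ : (upBody (w + 1))^[Fintype.card T - 1] (previousNode σ₃) = σ₄ at hp₄ hG₄ hb₄
  have loop₄ : LoopRel (fun σ => σ.reg 3 ≠ 0) (upBody (w + 1)) u.length (previousNode σ₃) σ₄ := by
    refine ⟨Fintype.card T - 1, by omega, fun i hi => ?_, ?_, hσ₄.symm⟩
    · beta_reduce
      rw [(hup i (by omega)).1.pos]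
      omega
    · beta_reduce
      rw [hσ₄, hp₄.pos]
      omega
  -- the top-down pass
  rw [show Fintype.card T - (Fintype.card T - 1) = 1 by omega] at hG₄
  have hdown := Passing.iterate_downBody hnum hn (hp₄.move (e := fun _ => 1) rfl)
    (UpInv.downInv hn hG₄)
  obtain ⟨hp₅, hG₅, hb₅⟩ := hdown (Fintype.card T - 1) (by omega)
  generalize hσ₅ : (downBody (w + 1))^[Fintype.card T - 1] (setR 3 (fun _ => 1) σ₄) = σ₅
    at hp₅ hG₅ hb₅
  rw [show Fintype.card T - 1 + 1 = Fintype.card T by omega] at hp₅ hG₅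
  have loop₅ : LoopRel (fun σ => σ.reg 3 < σ.reg 4) (downBody (w + 1)) u.length
      (setR 3 (fun _ => 1) σ₄) σ₅ := by
    refine ⟨Fintype.card T - 1, by omega, fun i hi => ?_, ?_, hσ₅.symm⟩
    · beta_reduce
      rw [(hdown i (by omega)).1.pos, (hdown i (by omega)).1.count]
      omega
    · beta_reduce
      rw [hσ₅, hp₅.pos, hp₅.count]
      omega
  -- the output
  have hblank : ∀ m, (setR 3 (fun _ => 0) σ₅).arr 1 m = 0 := fun m =>
    (hb₅ m).trans ((hb₄ m).trans (hs₃.blank.1 m))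
  have hp₅' : Passing D nm as fs (Fintype.card T) node 0 (setR 3 (fun _ => 0) σ₅) :=
    hp₅.move (e := fun _ => 0) rfl
  have hwrite := hp₅'.iterate_writeBody (K := w + 1) hblank
  refine ⟨_, ⟨σ₁, loop₁, σ₂, loop₂, σ₃, loop₃, σ₄, loop₄, σ₅, loop₅, Fintype.card T, hT,
    fun i hi => ?_, ?_, rfl⟩, fun m => ?_⟩
  · beta_reduce
    rw [(hwrite i hi.le).1.pos, (hwrite i hi.le).1.count]
    exact hi
  · beta_reduce
    rw [(hwrite _ le_rfl).1.pos, (hwrite _ le_rfl).1.count]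
    simp
  · rw [(hwrite _ le_rfl).2.2.2]
    have hmark : ∀ t, Marked (w + 1) nm (setR 3 (fun _ => 0) σ₅) t m ↔ _ := fun t =>
      marked_iff hnum hp₅'.stored hn hG₅
    have hprime : ∀ a, D.PrimePred a ↔ _ := fun a => (TreeDecomposition.primePred_iff hD a).trans
      (TreeDecomposition.isPrimeAttribute_iff_exists_isCertificate hD.rhs_mem
        (hlist.isIndexing hw) a)
    simp only [hmark, hprime]
    constructor
    · rintro ⟨i, -, a, j, v, ha, hj, hv, hm⟩
      exact ⟨a, ha, v, _, j, hv, hj, hm⟩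
    · rintro ⟨a, ha, v, t, j, hv, hj, hm⟩
      obtain ⟨i, hi, rfl⟩ := hn.surj t
      exact ⟨i, hi, a, j, v, ha, hj, hv, hm⟩

end PrimeAttr.RAM

theorem mainTheorem5 :
    -- `prime` selects precisely the prime attributes
    (∀ (A F T : Type*) [Fintype A] [Fintype F] [Fintype T] [DecidableEq A] [DecidableEq F]
        (S : PrimeAttr.RelSchema A F) (D : PrimeAttr.TreeDecomposition S T),
        D.IsModifiedNormalized → ∀ a : A, D.PrimePred a ↔ S.IsPrimeAttribute a) ∧
    -- for fixed width `w`, the extension of `prime` is computed in linear time: on termination,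
    -- the nonzero cells of array `1` are those whose index is the number of an attribute in it
    (∀ w : ℕ, ∃ (p : PrimeAttr.RAM.Program) (c : ℕ),
      ∀ (A F T : Type*) [Fintype A] [Fintype F] [Fintype T] [DecidableEq A] [DecidableEq F]
        (S : PrimeAttr.RelSchema A F) (D : PrimeAttr.TreeDecomposition S T)
        (N : ℕ) (num : A ⊕ F ⊕ T ≃ Fin N) (u : List ℕ),
        D.IsModifiedNormalized → D.WidthLE w → D.EncodedBy (fun x => (num x : ℕ)) u →
        ∃ (τ : PrimeAttr.RAM.State) (t : ℕ),
          PrimeAttr.RAM.Exec p (PrimeAttr.RAM.init u) τ t ∧ t ≤ c * u.length ∧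
          ∀ n : ℕ, τ.arr 1 n ≠ 0 ↔ ∃ a : A, (num (Sum.inl a) : ℕ) = n ∧ D.PrimePred a) := by
  refine ⟨fun A F T _ _ _ _ _ S D hD a => PrimeAttr.TreeDecomposition.primePred_iff hD a,
    fun w => ?_⟩
  obtain ⟨p, c, hp⟩ := PrimeAttr.RAM.linear_computes (w + 1)
  -- The bound `c * (m + 1)` is at most `2 * c * m` because the input is nonempty: the root
  -- contributes a `bag` atom.
  refine ⟨p, 2 * c, fun A F T _ _ _ _ _ S D N num u hD hw hu => ?_⟩
  obtain ⟨hpos, τ, hτ, hout⟩ := PrimeAttr.RAM.exists_computes num hD hw hu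
  obtain ⟨t, ht, he⟩ := hp _ _ _ hτ
  refine ⟨τ, t, he, ht.trans ?_, hout⟩
  rw [mul_comm 2 c, mul_assoc]
  exact Nat.mul_le_mul_left c (by omega)
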